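/- **Setting.** Let $M>0$ and consider the Schwarzschild exterior $\mathbb{R}\times(2M,\infty)\times S^2$ with metric $$g=(1-2M/r)\,dt^2-(1-2M/r)^{-1}dr^2-r^2(d\theta^2+\sin^2\theta\,d\phi^2),$$ with $\partial_t$ future pointing and with either choice of orientation. Let $*$ be the Hodge dual on two-forms, ${*}F_{ab}=\tfrac12 e_{abcd}F^{cd}$ with $e$ the volume form, and put $\xi^a=(\partial_t)^a$, $U_a=-r^{-1}\nabla_a r$, $Y_{ab}=-2r^3\sin\theta\,d\theta_{[a}d\phi_{b]}$. Let $F_{ab}$ be a smooth real two-form on the exterior which solves the Maxwell equations $\nabla^aF_{ab}=0$, $\nabla_{[a}F_{bc]}=0$, and define $$Z_{ab}=-\tfrac43\,{*}F_{[a}{}^{c}Y_{b]c},\qquad \beta_a=-\tfrac12U^bZ_{ab}-\tfrac12 i\,U^b{*}Z_{ab}-\tfrac12\nabla_bZ_a{}^b-\tfrac12 i\,\nabla_b{*}Z_a{}^b,$$ $$\mathbf H_{ab}=\beta_{(a}\bar\beta_{b)}-\tfrac12 g_{ab}\beta^c\bar\beta_c .$$ With $$A^a=\frac{(r-3M)(r-2M)}{2r^2}(\partial_r)^a,\qquad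 q=\frac{9M^2(r-2M)(2r-3M)}{4r^5},$$ define the real current $$\mathbf P_a=\mathbf H_{ab}A^b+\tfrac14q\beta^bZ_{ab}+\tfrac14q\bar\beta^bZ_{ab}-\tfrac14 i\,q\beta^b{*}Z_{ab}+\tfrac14 i\,q\bar\beta^b{*}Z_{ab}+\tfrac1{16}Z_{bc}Z^{bc}\nabla_aq-\tfrac14Z_a{}^cZ_{bc}\nabla^bq .$$ A *spherically symmetric slice* $\Sigma$ is a smooth spacelike hypersurface of the exterior given as the image of a smooth injective map $\Phi:D\to\{r>2M\}$, where $D\subseteq\mathbb{R}^3$ is open and invariant under rotations, $\Phi$ commutes with the action of $SO(3)$, and $-\Phi^*g$ is positive definite. **Theorem.** For every real constant $c_1$ with $|c_1|\le 10/9$ and every spherically symmetric slice $\Sigma$ with future pointing timelike normal $N^a$, $N^aN_a=1$, and induced volume element $d\mu_\Sigma$, $$\int_\Sigma N^a\bigl(\mathbf H_{ab}\xi^b+c_1\mathbf P_a\bigr)\,d\mu_\Sigma\ \ge\ 0 .$$ If the integrand is not assumed to be integrable, this means that the integral of its negative part is at most the integral of its positive part, as elements of $[0,\infty]$. -/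

import Mathlib

open MeasureTheory Set
open scoped ContDiff

noncomputable section

namespace Schwarzschild

/-- Coordinates `(t, x¹, x², x³)` on the Schwarzschild exterior, where `(x¹, x², x³)` are the
Cartesian coordinates belonging to the Schwarzschild spherical coordinates:
`x¹ = r sin θ cos φ`, `x² = r sin θ sin φ`, `x³ = r cos θ`.  They cover the whole exterior,
poles included, by one smooth chart. -/
abbrev Spacetime := Fin 4 → ℝ

/-- Euclidean three-space. -/
abbrev E3 := EuclideanSpace ℝ (Fin 3)

/-- The area radius `r`. -/
def rad (p : Spacetime) : ℝ := √(p 1 ^ 2 + p 2 ^ 2 + p 3 ^ 2)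

/-- The exterior region `r > 2M`. -/
def exterior (M : ℝ) : Set Spacetime := {p | 2 * M < rad p}

/-- The coordinate partial derivative `∂_a f`. -/
def pd (a : Fin 4) (f : Spacetime → ℝ) (p : Spacetime) : ℝ :=
  fderiv ℝ f p (Pi.single a 1)

/-- The components of `dt`. -/
def dt (a : Fin 4) : ℝ := if a = 0 then 1 else 0

/-- The components of `dr = (x¹ dx¹ + x² dx² + x³ dx³) / r`. -/
def dr (p : Spacetime) (a : Fin 4) : ℝ := if a = 0 then 0 else p a / rad p

/-- The components of the flat spatial metric `(dx¹)² + (dx²)² + (dx³)²`. -/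
def flat (a b : Fin 4) : ℝ := if a = b ∧ a ≠ 0 then 1 else 0

/-- The Schwarzschild metric
`g = (1 - 2M/r) dt² - (1 - 2M/r)⁻¹ dr² - r² (dθ² + sin² θ dφ²)`, where
`r² (dθ² + sin² θ dφ²) = (dx¹)² + (dx²)² + (dx³)² - dr²`. -/
def metric (M : ℝ) (p : Spacetime) : Matrix (Fin 4) (Fin 4) ℝ :=
  Matrix.of fun a b =>
    (1 - 2 * M / rad p) * (dt a * dt b)
      - (1 - 2 * M / rad p)⁻¹ * (dr p a * dr p b)
      - (flat a b - dr p a * dr p b)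

/-- The inverse metric `g^{ab}`. -/
def invMetric (M : ℝ) (p : Spacetime) : Matrix (Fin 4) (Fin 4) ℝ := (metric M p)⁻¹

/-- The scalar product `g_{ab} v^a w^b`. -/
def inner4 (M : ℝ) (p v w : Spacetime) : ℝ := ∑ a, ∑ b, metric M p a b * v a * w b

/-- The Christoffel symbols `Γ^c_{ab}` of the Levi-Civita connection. -/
def christoffel (M : ℝ) (p : Spacetime) (c a b : Fin 4) : ℝ :=
  (1 / 2) * ∑ d, invMetric M p c d *
    (pd a (fun y => metric M y b d) p + pd b (fun y => metric M y a d) p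
      - pd d (fun y => metric M y a b) p)

/-- Covariant two-tensor fields, by components. -/
abbrev Tensor2 := Spacetime → Fin 4 → Fin 4 → ℝ

/-- The covariant derivative `∇_c T_{ab}`. -/
def cov (M : ℝ) (T : Tensor2) (p : Spacetime) (c a b : Fin 4) : ℝ :=
  pd c (fun y => T y a b) p
    - ∑ d, christoffel M p d c a * T p d b
    - ∑ d, christoffel M p d c b * T p a d

/-- The Levi-Civita symbol, with `leviCivita 0 1 2 3 = 1`. -/
def leviCivita (a b c d : Fin 4) : ℝ :=
  Matrix.det (Matrix.of fun i j : Fin 4 => if ![a, b, c, d] i = j then (1 : ℝ) else 0)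

/-- The volume form `e_{abcd}` of the orientation `o`: positive on `(∂_t, ∂_1, ∂_2, ∂_3)`
if `o = 1`, and negative if `o = -1`. -/
def volForm (M : ℝ) (o : ℤˣ) (p : Spacetime) (a b c d : Fin 4) : ℝ :=
  ((o : ℤ) : ℝ) * √|(metric M p).det| * leviCivita a b c d

/-- The Hodge dual `*T_{ab} = ½ e_{abcd} T^{cd}`. -/
def hodge (M : ℝ) (o : ℤˣ) (T : Tensor2) : Tensor2 := fun p a b =>
  (1 / 2) * ∑ c, ∑ d, ∑ c', ∑ d',
    volForm M o p a b c d * invMetric M p c c' * invMetric M p d d' * T p c' d'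

/-- `F` is a smooth real two-form on the exterior with `∇^a F_{ab} = 0` and
`∇_{[a} F_{bc]} = 0`. -/
structure IsMaxwellField (M : ℝ) (F : Tensor2) : Prop where
  smooth : ContDiffOn ℝ ∞ F (exterior M)
  antisymm : ∀ p ∈ exterior M, ∀ a b, F p a b = - F p b a
  divergence : ∀ p ∈ exterior M, ∀ b, ∑ a, ∑ c, invMetric M p a c * cov M F p c a b = 0
  closed : ∀ p ∈ exterior M, ∀ a b c,
    cov M F p a b c + cov M F p b c a + cov M F p c a b = 0

/-- The Killing-Yano tensor `Y_{ab} = -2 r³ sin θ dθ_{[a} dφ_{b]}`.  As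
`r² sin θ dθ ∧ dφ` is the area form of the sphere of radius `r`, this is
`Y(u, v) = -det(x, u, v)` on the spatial parts of `u`, `v`. -/
def killingYano (p : Spacetime) (a b : Fin 4) : ℝ := - ∑ c, leviCivita 0 c a b * p c

/-- `U_a = -r⁻¹ ∇_a r`. -/
def covU (p : Spacetime) (a : Fin 4) : ℝ := - (rad p)⁻¹ * pd a rad p

/-- `Z_{ab} = -(4/3) *F_{[a}{}^c Y_{b]c}`. -/
def fieldZ (M : ℝ) (o : ℤˣ) (F : Tensor2) : Tensor2 := fun p a b =>
  - (4 / 3) * ((1 / 2) *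
    ∑ c, ∑ d, invMetric M p c d *
      (hodge M o F p a d * killingYano p b c - hodge M o F p b d * killingYano p a c))

/-- `U^b T_{ab}`. -/
def contractU (M : ℝ) (T : Tensor2) (p : Spacetime) (a : Fin 4) : ℝ :=
  ∑ b, ∑ c, invMetric M p b c * covU p c * T p a b

/-- `∇_b T_a{}^b`. -/
def divSecond (M : ℝ) (T : Tensor2) (p : Spacetime) (a : Fin 4) : ℝ :=
  ∑ b, ∑ c, invMetric M p b c * cov M T p c a b

/-- `β_a = -½ U^b Z_{ab} - ½ i U^b *Z_{ab} - ½ ∇_b Z_a{}^b - ½ i ∇_b *Z_a{}^b`. -/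
def beta (M : ℝ) (o : ℤˣ) (F : Tensor2) (p : Spacetime) (a : Fin 4) : ℂ :=
  - (1 / 2) * (contractU M (fieldZ M o F) p a : ℂ)
    - (1 / 2) * Complex.I * (contractU M (hodge M o (fieldZ M o F)) p a : ℂ)
    - (1 / 2) * (divSecond M (fieldZ M o F) p a : ℂ)
    - (1 / 2) * Complex.I * (divSecond M (hodge M o (fieldZ M o F)) p a : ℂ)

/-- `β^a`. -/
def betaUp (M : ℝ) (o : ℤˣ) (F : Tensor2) (p : Spacetime) (a : Fin 4) : ℂ :=
  ∑ b, (invMetric M p a b : ℂ) * beta M o F p b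

/-- The superenergy tensor `H_{ab} = β_{(a} β̄_{b)} - ½ g_{ab} β^c β̄_c` (the expression is
real, so that taking the real part only changes the type). -/
def superH (M : ℝ) (o : ℤˣ) (F : Tensor2) (p : Spacetime) (a b : Fin 4) : ℝ :=
  ((1 / 2) * (beta M o F p a * star (beta M o F p b) + beta M o F p b * star (beta M o F p a))
    - (1 / 2) * (metric M p a b : ℂ) *
        ∑ c, betaUp M o F p c * star (beta M o F p c)).re

/-- The Killing vector field `ξ = ∂_t`. -/
def xi : Spacetime := Pi.single 0 1

/-- `A = ((r - 3M)(r - 2M) / (2 r²)) ∂_r`, where `∂_r = (xⁱ / r) ∂_i`. -/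
def vecA (M : ℝ) (p : Spacetime) : Spacetime := fun a =>
  (rad p - 3 * M) * (rad p - 2 * M) / (2 * rad p ^ 2) * (if a = 0 then 0 else p a / rad p)

/-- `q = 9 M² (r - 2M)(2r - 3M) / (4 r⁵)`. -/
def scalarQ (M : ℝ) (p : Spacetime) : ℝ :=
  9 * M ^ 2 * (rad p - 2 * M) * (2 * rad p - 3 * M) / (4 * rad p ^ 5)

/-- The current
`P_a = H_{ab} A^b + ¼ q β^b Z_{ab} + ¼ q β̄^b Z_{ab} - ¼ i q β^b *Z_{ab} + ¼ i q β̄^b *Z_{ab}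
  + (1/16) Z_{bc} Z^{bc} ∇_a q - ¼ Z_a{}^c Z_{bc} ∇^b q`
(the expression is real, so that taking the real part only changes the type). -/
def currentP (M : ℝ) (o : ℤˣ) (F : Tensor2) (p : Spacetime) (a : Fin 4) : ℝ :=
  let Z := fieldZ M o F
  let W := hodge M o Z
  let q : ℂ := (scalarQ M p : ℂ)
  (∑ b, superH M o F p a b * vecA M p b)
    + (∑ b, ((1 / 4) * q * betaUp M o F p b * (Z p a b : ℂ)
        + (1 / 4) * q * star (betaUp M o F p b) * (Z p a b : ℂ)
        - (1 / 4) * Complex.I * q * betaUp M o F p b * (W p a b : ℂ)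
        + (1 / 4) * Complex.I * q * star (betaUp M o F p b) * (W p a b : ℂ))).re
    + (1 / 16) * (∑ b, ∑ c, ∑ b', ∑ c',
        invMetric M p b b' * invMetric M p c c' * Z p b c * Z p b' c') * pd a (scalarQ M) p
    - (1 / 4) * ∑ b, ∑ c, ∑ b', ∑ c',
        invMetric M p c c' * Z p a c' * Z p b c * (invMetric M p b b' * pd b' (scalarQ M) p)

/-- The action of a rotation on Euclidean three-space. -/
def rot3 (R : Matrix (Fin 3) (Fin 3) ℝ) (x : E3) : E3 := WithLp.toLp 2 (R.mulVec x.ofLp)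

/-- The action of a rotation on spacetime, at fixed `t`. -/
def rot4 (R : Matrix (Fin 3) (Fin 3) ℝ) (p : Spacetime) : Spacetime :=
  Fin.cons (p 0) (R.mulVec (Fin.tail p))

/-- A spherically symmetric spacelike slice `Σ` of the exterior: the image of a rotation
invariant open set `dom ⊆ ℝ³` under a smooth injective map `emb` into the exterior, which
commutes with rotations and for which the pulled back metric is negative definite. -/
structure SphericalSlice (M : ℝ) where
  dom : Set E3
  emb : E3 → Spacetime
  isOpen_dom : IsOpen dom
  smooth : ContDiffOn ℝ ∞ emb dom
  injOn : InjOn emb dom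
  mapsTo : MapsTo emb dom (exterior M)
  spacelike : ∀ x ∈ dom, ∀ v : E3, v ≠ 0 →
    inner4 M (emb x) (fderiv ℝ emb x v) (fderiv ℝ emb x v) < 0
  rot_mem : ∀ R ∈ Matrix.specialOrthogonalGroup (Fin 3) ℝ, ∀ x ∈ dom, rot3 R x ∈ dom
  equivariant : ∀ R ∈ Matrix.specialOrthogonalGroup (Fin 3) ℝ, ∀ x ∈ dom,
    emb (rot3 R x) = rot4 R (emb x)

namespace SphericalSlice

variable {M : ℝ}

/-- The Riemannian metric `-g` induced on the slice, in the coordinates of `dom`. -/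
def induced (S : SphericalSlice M) (x : E3) : Matrix (Fin 3) (Fin 3) ℝ :=
  Matrix.of fun i j => - inner4 M (S.emb x)
    (fderiv ℝ S.emb x (EuclideanSpace.single i 1)) (fderiv ℝ S.emb x (EuclideanSpace.single j 1))

/-- The induced volume measure `μ_Σ`, in the coordinates of `dom`. -/
def vol (S : SphericalSlice M) : Measure E3 :=
  (volume.restrict S.dom).withDensity fun x => ENNReal.ofReal √(S.induced x).det

/-- `N x` is the future pointing unit normal of the slice at the point `S.emb x`. -/
structure IsUnitNormal (S : SphericalSlice M) (N : E3 → Spacetime) : Prop where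
  unit : ∀ x ∈ S.dom, inner4 M (S.emb x) (N x) (N x) = 1
  future : ∀ x ∈ S.dom, 0 < inner4 M (S.emb x) (N x) xi
  orthogonal : ∀ x ∈ S.dom, ∀ v : E3, inner4 M (S.emb x) (N x) (fderiv ℝ S.emb x v) = 0

/-- The energy density `N^a (H_{ab} ξ^b + c₁ P_a)` at the point `S.emb x`. -/
def density (S : SphericalSlice M) (o : ℤˣ) (F : Tensor2) (N : E3 → Spacetime) (c₁ : ℝ)
    (x : E3) : ℝ :=
  ∑ a, N x a * ((∑ b, superH M o F (S.emb x) a b * xi b) + c₁ * currentP M o F (S.emb x) a)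

end SphericalSlice

end Schwarzschild

end

noncomputable section

namespace Schwarzschild

/-! On a spherically symmetric slice the normal has only a time component `a` and a radial component
`b`, and these, like the volume density, are constant on the rotation orbits. Hence it suffices to
bound the density below by terms whose integrals over the orbits vanish.

Put f = 1 - 2M/r. The two-form `Z` is encoded by two vector fields tangent to the spheres: its
electric part S, and D, whose cross product with x gives the magnetic part up to a radial factor.
Let X± = (S ± D)/2. The combinations β_t ± f β_r have real part div X± and imaginary part (x · curl
X±)/r up to sign (`re_beta_zero`, `im_beta_zero`, `dot_re_beta`, `dot_im_beta`). With m = (1 -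
3M/r)/2, the density becomes the sum over both signs of (a ± b/f)/4 times a quadratic form
consisting of (1 ± cm)((div X)² + (x · curl X)²/r²), of f(1 ∓ cm) times the square of the tangential
part of β, of a cross term of strength cq between X and that tangential part, and of a multiple ±c
of |X|² coming from the gradient of q (`density_eq`). The weights a ± b/f are positive because the
normal is timelike and future pointing.

Borrow 2|X|²/r² from the derivative terms. What is left in X and the tangential part of β is a
nonnegative quadratic form when |c| ≤ 10/9 (`coercive_part`); this is an elementary inequality in s
= M/r on 0 < s < 1/2, since |m| ≤ 1/2 keeps 1 ± cm at least 4/9. This gives `density_ge`, whose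
lower bound contains only the excess (div X)² + (x · curl X)²/r² - 2|X|²/r².

The excess has nonnegative integral over each sphere, because 2/r² is the first eigenvalue of the
Hodge Laplacian on one-forms there. In Bochner form: the excess is the square of the trace-free
symmetric gradient plus the sphere divergence of V div V - (V · ∇)V, and this divergence is a sum of
derivatives along rotation generators (`excess_ge`). Such derivatives, multiplied by rotation
invariant weights, integrate to zero over compact invariant sets (`integral_rotGen`). Exhausting the
slice by such sets gives the comparison of positive and negative parts without integrability. -/

/-- The components of the spatial position vector. -/
def spat (p : Spacetime) (a : Fin 4) : ℝ := if a = 0 then 0 else p a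

theorem isOpen_exterior (M : ℝ) : IsOpen (exterior M) := by
  have : Continuous rad := by unfold rad; fun_prop
  exact isOpen_lt continuous_const this

theorem exterior_mem_nhds {M : ℝ} {p : Spacetime} (hp : p ∈ exterior M) : exterior M ∈ nhds p :=
  (isOpen_exterior M).mem_nhds hp

theorem rad_sq (p : Spacetime) : rad p ^ 2 = p 1 ^ 2 + p 2 ^ 2 + p 3 ^ 2 :=
  Real.sq_sqrt (by positivity)

theorem rad_pos {M : ℝ} (hM : 0 < M) {p : Spacetime} (hp : p ∈ exterior M) : 0 < rad p :=
  lt_trans (by positivity) (show 2 * M < rad p from hp)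

theorem contDiffAt_rad {p : Spacetime} (hp : 0 < rad p) {n : WithTop ℕ∞} :
    ContDiffAt ℝ n rad p := by
  unfold rad
  refine ContDiffAt.sqrt ?_ ?_
  · fun_prop
  · have := rad_sq p
    have h2 : 0 < rad p ^ 2 := by positivity
    rw [← this]; exact h2.ne'

theorem differentiableAt_rad {p : Spacetime} (hp : 0 < rad p) : DifferentiableAt ℝ rad p :=
  (contDiffAt_rad hp (n := 1)).differentiableAt (by norm_num)

/-! ### Partial derivatives and radial functions -/

section PartialDerivatives

variable {f g : Spacetime → ℝ} {p : Spacetime}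

theorem pd_congr (h : f =ᶠ[nhds p] g) (a : Fin 4) : pd a f p = pd a g p := by
  simp only [pd, h.fderiv_eq]

theorem pd_const (c : ℝ) (a : Fin 4) : pd a (fun _ => c) p = 0 := by
  simp [pd]

theorem pd_add (hf : DifferentiableAt ℝ f p) (hg : DifferentiableAt ℝ g p) (a : Fin 4) :
    pd a (fun y => f y + g y) p = pd a f p + pd a g p := by
  simp only [pd]
  rw [fderiv_fun_add hf hg]; rfl

theorem pd_sub (hf : DifferentiableAt ℝ f p) (hg : DifferentiableAt ℝ g p) (a : Fin 4) :
    pd a (fun y => f y - g y) p = pd a f p - pd a g p := by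
  simp only [pd]
  rw [fderiv_fun_sub hf hg]; rfl

theorem pd_neg (a : Fin 4) : pd a (fun y => - f y) p = - pd a f p := by
  simp only [pd]
  rw [fderiv_fun_neg]; rfl

theorem pd_mul (hf : DifferentiableAt ℝ f p) (hg : DifferentiableAt ℝ g p) (a : Fin 4) :
    pd a (fun y => f y * g y) p = pd a f p * g p + f p * pd a g p := by
  simp only [pd]
  rw [fderiv_fun_mul hf hg]
  simp [mul_comm, add_comm]

theorem pd_const_mul (c : ℝ) (hf : DifferentiableAt ℝ f p) (a : Fin 4) :
    pd a (fun y => c * f y) p = c * pd a f p := by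
  rw [pd_mul (differentiableAt_const c) hf, pd_const]; ring

theorem pd_coord (a b : Fin 4) : pd a (fun y => y b) p = if a = b then 1 else 0 := by
  have : fderiv ℝ (fun y : Spacetime => y b) p = ContinuousLinearMap.proj b :=
    (ContinuousLinearMap.proj (R := ℝ) (φ := fun _ : Fin 4 => ℝ) b).fderiv
  simp [pd, this, Pi.single_apply, eq_comm]

theorem differentiableAt_spat (b : Fin 4) : DifferentiableAt ℝ (fun y => spat y b) p := by
  unfold spat
  by_cases h : b = 0 <;> simp [h]
  fun_prop

theorem pd_spat (a b : Fin 4) : pd a (fun y => spat y b) p = flat a b := by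
  unfold spat flat
  by_cases h : b = 0
  · subst h
    simp [pd_const]
  · simp only [h, if_false, pd_coord]
    by_cases h' : a = b
    · subst h'; simp [h]
    · simp [h']

/-- Differentiating the polynomial r² avoids the square root. -/
theorem pd_rad (hp : 0 < rad p) (a : Fin 4) : pd a rad p = spat p a / rad p := by
  have h1 : pd a (fun y => rad y * rad y) p
      = pd a (fun y => y 1 * y 1 + y 2 * y 2 + y 3 * y 3) p := by
    congr 1
    funext y
    have := rad_sq y
    nlinarith
  rw [pd_mul (differentiableAt_rad hp) (differentiableAt_rad hp),
    pd_add (by fun_prop) (by fun_prop), pd_add (by fun_prop) (by fun_prop),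
    pd_mul (by fun_prop) (by fun_prop), pd_mul (by fun_prop) (by fun_prop),
    pd_mul (by fun_prop) (by fun_prop), pd_coord, pd_coord, pd_coord] at h1
  rw [eq_div_iff hp.ne']
  fin_cases a <;> simp [spat] at h1 ⊢ <;> grind

theorem pd_comp_rad {φ : ℝ → ℝ} {φ' : ℝ} (hp : 0 < rad p) (h : HasDerivAt φ φ' (rad p))
    (a : Fin 4) : pd a (fun y => φ (rad y)) p = φ' * (spat p a / rad p) := by
  have := (h.comp_hasFDerivAt p (differentiableAt_rad hp).hasFDerivAt).fderiv
  rw [← pd_rad hp]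
  simp only [pd]
  change (fderiv ℝ (φ ∘ rad) p) _ = _
  rw [this]
  simp

end PartialDerivatives

/-! ### The Schwarzschild metric and connection in Cartesian coordinates -/

section MetricFacts

variable {M : ℝ} {p : Spacetime}

theorem dr_eq (p : Spacetime) (a : Fin 4) : dr p a = spat p a / rad p := by
  unfold dr spat; split_ifs <;> simp

theorem metric_eq (hM : 0 < M) (hp : p ∈ exterior M) (a b : Fin 4) :
    metric M p a b = (1 - 2 * M / rad p) * (dt a * dt b) - flat a b
      - 2 * M / (rad p ^ 2 * (rad p - 2 * M)) * (spat p a * spat p b) := by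
  have hr := rad_pos hM hp
  have h2 : rad p - 2 * M ≠ 0 := (sub_pos.2 (show 2 * M < rad p from hp)).ne'
  have h3 : 1 - 2 * M / rad p = (rad p - 2 * M) / rad p := by field_simp
  simp only [metric, Matrix.of_apply, dr_eq]
  rw [h3]
  field_simp
  ring

theorem invMetric_eq (hM : 0 < M) (hp : p ∈ exterior M) (a b : Fin 4) :
    invMetric M p a b = rad p / (rad p - 2 * M) * (dt a * dt b) - flat a b
      + 2 * M / rad p ^ 3 * (spat p a * spat p b) := by
  have hr := rad_pos hM hp
  have h2 : rad p - 2 * M ≠ 0 := (sub_pos.2 (show 2 * M < rad p from hp)).ne'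
  have hs := rad_sq p
  suffices h : invMetric M p = Matrix.of fun a b => rad p / (rad p - 2 * M) * (dt a * dt b)
      - flat a b + 2 * M / rad p ^ 3 * (spat p a * spat p b) by rw [h]; rfl
  refine Matrix.inv_eq_right_inv ?_
  ext i j
  simp only [Matrix.mul_apply, metric_eq hM hp, Matrix.of_apply, Fin.sum_univ_four]
  have h3 : p 3 ^ 2 = rad p ^ 2 - p 1 ^ 2 - p 2 ^ 2 := by linarith
  fin_cases i <;> fin_cases j <;> simp [dt, flat, spat] <;> field_simp <;> ring_nf <;>
    grind

/-- The factors f and 1/f in the time and radial directions cancel, so the volume form is just the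
signed Levi-Civita symbol. -/
theorem det_metric (hM : 0 < M) (hp : p ∈ exterior M) : (metric M p).det = -1 := by
  have hr := rad_pos hM hp
  have h2 : rad p - 2 * M ≠ 0 := (sub_pos.2 (show 2 * M < rad p from hp)).ne'
  have hs := rad_sq p
  rw [Matrix.det_succ_row_zero]
  simp only [Matrix.det_fin_three, Fin.sum_univ_four, Matrix.submatrix_apply, metric_eq hM hp]
  simp [dt, flat, spat, Fin.succAbove]
  field_simp
  grind

/-- The first derivatives of the metric. -/
theorem pd_metric (hM : 0 < M) (hp : p ∈ exterior M) (a b c : Fin 4) :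
    pd c (fun y => metric M y a b) p = 2 * M / rad p ^ 3 * spat p c * (dt a * dt b)
      + 2 * M * (3 * rad p - 4 * M) / (rad p ^ 4 * (rad p - 2 * M) ^ 2) *
          spat p c * (spat p a * spat p b)
      - 2 * M / (rad p ^ 2 * (rad p - 2 * M)) * (flat c a * spat p b + spat p a * flat c b) := by
  have hr := rad_pos hM hp
  have h2 : rad p - 2 * M ≠ 0 := (sub_pos.2 (show 2 * M < rad p from hp)).ne'
  have e : (fun y => metric M y a b) =ᶠ[nhds p] fun y =>
      (fun s => (1 - 2 * M / s) * (dt a * dt b) - flat a b) (rad y)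
      - (fun s => 2 * M / (s ^ 2 * (s - 2 * M))) (rad y) * (spat y a * spat y b) := by
    filter_upwards [exterior_mem_nhds hp] with y hy
    rw [metric_eq hM hy]
  have d1 : HasDerivAt (fun s : ℝ => (1 - 2 * M / s) * (dt a * dt b) - flat a b)
      (2 * M / rad p ^ 2 * (dt a * dt b)) (rad p) := by
    have := ((((hasDerivAt_inv hr.ne').const_mul (2 * M)).const_sub 1).mul_const
      (dt a * dt b)).sub_const (flat a b)
    simp only [← div_eq_mul_inv] at this
    refine this.congr_deriv ?_
    field_simp
  have d2 : HasDerivAt (fun s : ℝ => 2 * M / (s ^ 2 * (s - 2 * M)))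
      (- (2 * M * (3 * rad p - 4 * M)) / (rad p ^ 3 * (rad p - 2 * M) ^ 2)) (rad p) := by
    have := ((((hasDerivAt_id (rad p)).pow 2).mul ((hasDerivAt_id (rad p)).sub_const (2 * M))).inv
      (by simp; exact ⟨hr.ne', h2⟩)).const_mul (2 * M)
    refine this.congr_deriv ?_
    simp
    field_simp
    ring
  have k1 : DifferentiableAt ℝ
      (fun y => (fun s : ℝ => (1 - 2 * M / s) * (dt a * dt b) - flat a b) (rad y)) p :=
    DifferentiableAt.comp p d1.differentiableAt (differentiableAt_rad hr)
  have k2 : DifferentiableAt ℝ (fun y => (fun s : ℝ => 2 * M / (s ^ 2 * (s - 2 * M))) (rad y)) p :=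
    DifferentiableAt.comp p (g := fun s : ℝ => 2 * M / (s ^ 2 * (s - 2 * M)))
      d2.differentiableAt (differentiableAt_rad hr)
  have k3 := (differentiableAt_spat (p := p) a).fun_mul (differentiableAt_spat (p := p) b)
  rw [pd_congr e, pd_sub k1 (k2.fun_mul k3), pd_mul k2 k3, pd_comp_rad hr d1, pd_comp_rad hr d2,
    pd_mul (differentiableAt_spat a) (differentiableAt_spat b), pd_spat, pd_spat]
  field_simp
  ring

theorem christoffel_eq (hM : 0 < M) (hp : p ∈ exterior M) (c a b : Fin 4) :
    christoffel M p c a b =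
      M / (rad p ^ 2 * (rad p - 2 * M)) * dt c * (spat p a * dt b + spat p b * dt a)
      + (1 - 2 * M / rad p) * spat p c * (M / rad p ^ 3 * (dt a * dt b)
        - M * (3 * rad p - 4 * M) / (rad p ^ 4 * (rad p - 2 * M) ^ 2) * (spat p a * spat p b)
        + 2 * M / (rad p ^ 2 * (rad p - 2 * M)) * flat a b) := by
  have hr := rad_pos hM hp
  have h2 : rad p - 2 * M ≠ 0 := (sub_pos.2 (show 2 * M < rad p from hp)).ne'
  have hs := rad_sq p
  have hflat : ∀ a b, flat a b = flat b a := by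
    intro a b; unfold flat; congr 1; grind
  have e : ∀ d, pd a (fun y => metric M y b d) p + pd b (fun y => metric M y a d) p
      - pd d (fun y => metric M y a b) p = 2 * (
        M / rad p ^ 3 * ((spat p a * dt b + spat p b * dt a) * dt d - dt a * dt b * spat p d)
        + M * (3 * rad p - 4 * M) / (rad p ^ 4 * (rad p - 2 * M) ^ 2) *
          (spat p a * spat p b * spat p d)
        - 2 * M / (rad p ^ 2 * (rad p - 2 * M)) * (flat a b * spat p d)) := by
    intro d
    rw [pd_metric hM hp, pd_metric hM hp, pd_metric hM hp, hflat b a, hflat d a, hflat d b]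
    ring
  unfold christoffel
  simp only [e, invMetric_eq hM hp, Fin.sum_univ_four]
  have h3 : p 3 ^ 2 = rad p ^ 2 - p 1 ^ 2 - p 2 ^ 2 := by linarith
  -- The lower indices enter only through these five scalars, so a case split on `c` alone suffices.
  generalize spat p a = A
  generalize spat p b = B
  generalize dt a = ta
  generalize dt b = tb
  generalize flat a b = G
  fin_cases c <;> simp [dt, flat, spat] <;> field_simp <;> ring_nf <;>
    try grind

end MetricFacts

/-- The cross product of vectors in `ℝ³`. -/
def crs (u v : Fin 3 → ℝ) : Fin 3 → ℝ :=
  ![u 1 * v 2 - u 2 * v 1, u 2 * v 0 - u 0 * v 2, u 0 * v 1 - u 1 * v 0]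

/-- The dot product of vectors in `ℝ³`. -/
def dot (u v : Fin 3 → ℝ) : ℝ := u 0 * v 0 + u 1 * v 1 + u 2 * v 2

/-- The spatial position. -/
def pos (p : Spacetime) : Fin 3 → ℝ := ![p 1, p 2, p 3]

/-- The two-form with electric part `E` and magnetic part `B`. -/
def twoForm (E B : Fin 3 → ℝ) : Matrix (Fin 4) (Fin 4) ℝ :=
  !![0, E 0, E 1, E 2; - E 0, 0, B 2, - B 1; - E 1, - B 2, 0, B 0; - E 2, B 1, - B 0, 0]

/-- The selection matrix maps the Vandermonde matrix on the nodes 0, 1, 2, 3 to the one on the nodes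
`a`, `b`, `c`, `d`. Comparing determinants gives a product formula that is easy to evaluate; 12 is
the Vandermonde determinant of 0, 1, 2, 3. -/
theorem leviCivita_eq (a b c d : Fin 4) : leviCivita a b c d =
    (((b : ℕ) : ℝ) - ((a : ℕ) : ℝ)) * (((c : ℕ) : ℝ) - ((a : ℕ) : ℝ)) *
    (((d : ℕ) : ℝ) - ((a : ℕ) : ℝ)) * (((c : ℕ) : ℝ) - ((b : ℕ) : ℝ)) *
    (((d : ℕ) : ℝ) - ((b : ℕ) : ℝ)) * (((d : ℕ) : ℝ) - ((c : ℕ) : ℝ)) / 12 := by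
  have hI0 : Finset.Ioi (0 : Fin 4) = {1, 2, 3} := by decide
  have hI1 : Finset.Ioi (1 : Fin 4) = {2, 3} := by decide
  have hI2 : Finset.Ioi (2 : Fin 4) = {3} := by decide
  have hI3 : Finset.Ioi (3 : Fin 4) = ∅ := by decide
  have h : (Matrix.of fun i j : Fin 4 => if ![a, b, c, d] i = j then (1 : ℝ) else 0) *
      Matrix.vandermonde (fun i : Fin 4 => ((i : ℕ) : ℝ)) =
      Matrix.vandermonde (fun i : Fin 4 => ((![a, b, c, d] i : ℕ) : ℝ)) := by
    ext i j
    simp [Matrix.mul_apply, Matrix.vandermonde]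
  have h' := congrArg Matrix.det h
  rw [Matrix.det_mul, Matrix.det_vandermonde, Matrix.det_vandermonde] at h'
  simp only [Fin.prod_univ_four, hI0, hI1, hI2, hI3] at h'
  simp at h'
  unfold leviCivita
  rw [eq_div_iff (by norm_num)]
  norm_num at h'
  linarith

/-! ### Hodge duality on electric and magnetic parts -/

section Hodge

variable {M : ℝ} {p : Spacetime}

/-- Raising both indices of a two-form, electric part. -/
def raiseE (M : ℝ) (p : Spacetime) (E : Fin 3 → ℝ) (i : Fin 3) : ℝ :=
  - (rad p / (rad p - 2 * M) * E i
    - 2 * M / (rad p ^ 2 * (rad p - 2 * M)) * (pos p i * dot (pos p) E))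

/-- Raising both indices of a two-form, magnetic part. -/
def raiseB (M : ℝ) (p : Spacetime) (B : Fin 3 → ℝ) (i : Fin 3) : ℝ :=
  (1 - 2 * M / rad p) * B i + 2 * M / rad p ^ 3 * (pos p i * dot (pos p) B)

theorem raise_twoForm (hM : 0 < M) (hp : p ∈ exterior M) (E B : Fin 3 → ℝ) (c d : Fin 4) :
    ∑ c', ∑ d', invMetric M p c c' * invMetric M p d d' * twoForm E B c' d' =
      twoForm (raiseE M p E) (raiseB M p B) c d := by
  have hr := rad_pos hM hp
  have h2 : rad p - 2 * M ≠ 0 := (sub_pos.2 (show 2 * M < rad p from hp)).ne'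
  have hs := rad_sq p
  simp only [invMetric_eq hM hp, Fin.sum_univ_four]
  fin_cases c <;> fin_cases d <;>
    simp [dt, flat, spat, twoForm, raiseE, raiseB, pos, dot] <;> field_simp <;> grind

theorem hodge_twoForm (hM : 0 < M) (hp : p ∈ exterior M) (o : ℤˣ) {T : Tensor2}
    {E B : Fin 3 → ℝ} (hT : T p = twoForm E B) (a b : Fin 4) :
    hodge M o T p a b = ((o : ℤ) : ℝ) * twoForm (raiseB M p B) (raiseE M p E) a b := by
  have h1 : hodge M o T p a b = (1 / 2) * ((o : ℤ) : ℝ) * ∑ c, ∑ d, leviCivita a b c d *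
      twoForm (raiseE M p E) (raiseB M p B) c d := by
    unfold hodge
    simp only [← raise_twoForm hM hp, hT, volForm, det_metric hM hp, Finset.mul_sum]
    simp
    refine Finset.sum_congr rfl fun c _ => Finset.sum_congr rfl fun d _ =>
      Finset.sum_congr rfl fun c' _ => Finset.sum_congr rfl fun d' _ => by ring
  rw [h1]
  simp only [leviCivita_eq, Fin.sum_univ_four]
  fin_cases a <;> fin_cases b <;> simp [twoForm] <;> ring

end Hodge

/-- The electric part of a two-form. -/
def fldE (F : Tensor2) (p : Spacetime) : Fin 3 → ℝ := ![F p 0 1, F p 0 2, F p 0 3]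

/-- The magnetic part of a two-form. -/
def fldB (F : Tensor2) (p : Spacetime) : Fin 3 → ℝ := ![F p 2 3, F p 3 1, F p 1 2]

theorem eq_twoForm {F : Tensor2} {p : Spacetime} (h : ∀ a b, F p a b = - F p b a) :
    F p = twoForm (fldE F p) (fldB F p) := by
  have hd : ∀ a, F p a a = 0 := fun a => by linarith [h a a]
  ext a b
  fin_cases a <;> fin_cases b <;> simp [twoForm, fldE, fldB, hd] <;> exact h _ _

/-- The electric part of `Z`, a tangential field. -/
def fieldS (M : ℝ) (o : ℤˣ) (F : Tensor2) (p : Spacetime) (i : Fin 3) : ℝ :=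
  2 / 3 * ((o : ℤ) : ℝ) * (1 - 2 * M / rad p) * crs (pos p) (fldB F p) i

/-- The tangential field which determines the magnetic part of `Z`. -/
def fieldD (_M : ℝ) (o : ℤˣ) (F : Tensor2) (p : Spacetime) (i : Fin 3) : ℝ :=
  - (2 / 3) * ((o : ℤ) : ℝ) *
    (rad p * fldE F p i - pos p i * dot (pos p) (fldE F p) / rad p)

/-- The magnetic part of `Z`. -/
def magZ (M : ℝ) (o : ℤˣ) (F : Tensor2) (p : Spacetime) (i : Fin 3) : ℝ :=
  1 / (rad p - 2 * M) * crs (pos p) (fieldD M o F p) i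

/-- The electric part of `*Z`. -/
def elecW (M : ℝ) (o : ℤˣ) (F : Tensor2) (p : Spacetime) (i : Fin 3) : ℝ :=
  ((o : ℤ) : ℝ) * (1 / rad p) * crs (pos p) (fieldD M o F p) i

/-- The magnetic part of `*Z`. -/
def magW (M : ℝ) (o : ℤˣ) (F : Tensor2) (p : Spacetime) (i : Fin 3) : ℝ :=
  - ((o : ℤ) : ℝ) * (rad p / (rad p - 2 * M)) * fieldS M o F p i

/-! ### Tangential fields encoding Z and its dual -/

section ExplicitFields

variable {M : ℝ} {p : Spacetime}

theorem killingYano_eq (p : Spacetime) (a b : Fin 4) :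
    killingYano p a b = twoForm 0 (fun i => - pos p i) a b := by
  simp only [killingYano, leviCivita_eq, Fin.sum_univ_four]
  fin_cases a <;> fin_cases b <;> simp [twoForm, pos] <;> norm_num

theorem sign_mul_self (o : ℤˣ) : ((o : ℤ) : ℝ) * ((o : ℤ) : ℝ) = 1 := by
  rcases Int.units_eq_one_or o with h | h <;> simp [h]

theorem dot_pos_self (p : Spacetime) : dot (pos p) (pos p) = rad p ^ 2 := by
  rw [rad_sq]; simp [dot, pos]; ring

theorem dot_fieldS (M : ℝ) (o : ℤˣ) (F : Tensor2) (p : Spacetime) :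
    dot (pos p) (fieldS M o F p) = 0 := by
  simp [dot, fieldS, crs]; ring

theorem dot_fieldD (hr : 0 < rad p) (o : ℤˣ) (F : Tensor2) :
    dot (pos p) (fieldD M o F p) = 0 := by
  have h := dot_pos_self p
  simp only [dot, fieldD] at h ⊢
  field_simp
  linear_combination (2 * ((o : ℤ) : ℝ) * (pos p 0 * fldE F p 0 + pos p 1 * fldE F p 1
    + pos p 2 * fldE F p 2)) * h

/-- `killingYano` is purely magnetic and radial. Contracting it with the dual of F therefore
discards the radial parts of the electric and magnetic fields and rotates the tangential ones by a
quarter turn. -/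
theorem fieldZ_eq (hM : 0 < M) (hp : p ∈ exterior M) (o : ℤˣ) {F : Tensor2}
    (hF : ∀ a b, F p a b = - F p b a) :
    fieldZ M o F p = twoForm (fieldS M o F p) (magZ M o F p) := by
  have hr := rad_pos hM hp
  have h2 : rad p - 2 * M ≠ 0 := (sub_pos.2 (show 2 * M < rad p from hp)).ne'
  have hs := rad_sq p
  have h3 : p 3 ^ 2 = rad p ^ 2 - p 1 ^ 2 - p 2 ^ 2 := by linarith
  ext a b
  simp only [fieldZ, hodge_twoForm hM hp o (eq_twoForm hF), killingYano_eq, invMetric_eq hM hp,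
    Fin.sum_univ_four]
  clear hF
  fin_cases a <;> fin_cases b <;>
    simp [dt, flat, spat, twoForm, raiseE, raiseB, pos, dot, fieldS, fieldD, magZ, crs] <;>
    field_simp <;> grind

theorem hodge_fieldZ_eq (hM : 0 < M) (hp : p ∈ exterior M) (o : ℤˣ) {F : Tensor2}
    (hF : ∀ a b, F p a b = - F p b a) :
    hodge M o (fieldZ M o F) p = twoForm (elecW M o F p) (magW M o F p) := by
  have hr := rad_pos hM hp
  have h2 : rad p - 2 * M ≠ 0 := (sub_pos.2 (show 2 * M < rad p from hp)).ne'
  have hs := dot_fieldS M o F p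
  have h1 : dot (pos p) (magZ M o F p) = 0 := by
    simp [dot, magZ, crs]; ring
  have e1 : ∀ i, ((o : ℤ) : ℝ) * raiseB M p (magZ M o F p) i = elecW M o F p i := by
    intro i
    simp only [raiseB, h1, magZ, elecW]
    field_simp
    ring
  have e2 : ∀ i, ((o : ℤ) : ℝ) * raiseE M p (fieldS M o F p) i = magW M o F p i := by
    intro i
    simp only [raiseE, hs, magW]
    ring
  ext a b
  rw [hodge_twoForm hM hp o (fieldZ_eq hM hp o hF)]
  fin_cases a <;> fin_cases b <;> simp [twoForm, e1, e2]

end ExplicitFields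

/-! ### Spacetime divergences as flat divergence and curl -/

section Divergence

variable {M : ℝ} {p : Spacetime}

/-- The flat divergence of a spatial vector field. -/
def div3 (V : Spacetime → Fin 3 → ℝ) (p : Spacetime) : ℝ :=
  ∑ i : Fin 3, pd i.succ (fun y => V y i) p

/-- The matrix of the spatial derivatives of a spatial vector field. -/
def jac (V : Spacetime → Fin 3 → ℝ) (p : Spacetime) (i j : Fin 3) : ℝ :=
  pd i.succ (fun y => V y j) p

/-- The flat curl of a spatial vector field. -/
def curl3 (V : Spacetime → Fin 3 → ℝ) (p : Spacetime) : Fin 3 → ℝ :=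
  ![jac V p 1 2 - jac V p 2 1, jac V p 2 0 - jac V p 0 2, jac V p 0 1 - jac V p 1 0]

/-- `V` is orthogonal to the radial direction, in the exterior. -/
def Tangential (M : ℝ) (V : Spacetime → Fin 3 → ℝ) : Prop :=
  ∀ p ∈ exterior M, dot (pos p) (V p) = 0

/-- Componentwise differentiability in the exterior. -/
def SmoothOn (M : ℝ) (V : Spacetime → Fin 3 → ℝ) : Prop :=
  ∀ i, ContDiffOn ℝ ∞ (fun y => V y i) (exterior M)

theorem SmoothOn.diff {V : Spacetime → Fin 3 → ℝ} (h : SmoothOn M V) (hp : p ∈ exterior M)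
    (i : Fin 3) : DifferentiableAt ℝ (fun y => V y i) p :=
  ((h i).contDiffAt (exterior_mem_nhds hp)).differentiableAt (by simp)

theorem pos_apply (p : Spacetime) (i : Fin 3) : pos p i = p i.succ := by
  fin_cases i <;> rfl

/-- This and the next lemma differentiate x · V = 0; they eliminate all radial components of the
derivatives of V. -/
theorem Tangential.pd_zero {V : Spacetime → Fin 3 → ℝ} (h : Tangential M V)
    (hV : SmoothOn M V) (hp : p ∈ exterior M) :
    ∑ j, pos p j * pd 0 (fun y => V y j) p = 0 := by
  have e : (fun y : Spacetime => y 1 * V y 0 + y 2 * V y 1 + y 3 * V y 2) =ᶠ[nhds p]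
      fun _ => 0 := by
    filter_upwards [exterior_mem_nhds hp] with y hy
    exact h y hy
  have := pd_congr e 0
  rw [pd_const, pd_add, pd_add, pd_mul, pd_mul, pd_mul] at this
  · simp only [pd_coord] at this
    simp [Fin.sum_univ_three, pos] at this ⊢
    linarith
  all_goals
    have h0 := hV.diff hp 0
    have h1 := hV.diff hp 1
    have h2 := hV.diff hp 2
    fun_prop

theorem Tangential.pd_succ {V : Spacetime → Fin 3 → ℝ} (h : Tangential M V)
    (hV : SmoothOn M V) (hp : p ∈ exterior M) (i : Fin 3) :
    ∑ j, pos p j * jac V p i j = - V p i := by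
  have e : (fun y : Spacetime => y 1 * V y 0 + y 2 * V y 1 + y 3 * V y 2) =ᶠ[nhds p]
      fun _ => 0 := by
    filter_upwards [exterior_mem_nhds hp] with y hy
    exact h y hy
  have := pd_congr e i.succ
  rw [pd_const, pd_add, pd_add, pd_mul, pd_mul, pd_mul] at this
  · simp only [pd_coord] at this
    fin_cases i <;> simp [Fin.sum_univ_three, pos, jac] at this ⊢ <;> linarith
  all_goals
    have h0 := hV.diff hp 0
    have h1 := hV.diff hp 1
    have h2 := hV.diff hp 2
    fun_prop

theorem pd_twoForm {T : Tensor2} {P Q : Spacetime → Fin 3 → ℝ}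
    (hT : ∀ y ∈ exterior M, T y = twoForm (P y) (Q y)) (hp : p ∈ exterior M) (c a b : Fin 4) :
    pd c (fun y => T y a b) p =
      twoForm (fun i => pd c (fun y => P y i) p) (fun i => pd c (fun y => Q y i) p) a b := by
  have e : (fun y => T y a b) =ᶠ[nhds p] fun y => twoForm (P y) (Q y) a b := by
    filter_upwards [exterior_mem_nhds hp] with y hy
    rw [hT y hy]
  rw [pd_congr e]
  fin_cases a <;> fin_cases b <;> simp [twoForm, pd_const, pd_neg]

/-- The Christoffel terms enter only through x · P, and the radial correction of the inverse metric
meets x^i x^j ∂_i P_j = -x · P. Both vanish for tangential P, leaving the flat divergence. -/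
theorem divSecond_zero (hM : 0 < M) {T : Tensor2} {P Q : Spacetime → Fin 3 → ℝ}
    (hT : ∀ y ∈ exterior M, T y = twoForm (P y) (Q y)) (hP : Tangential M P)
    (hP' : SmoothOn M P) (hp : p ∈ exterior M) :
    divSecond M T p 0 = - div3 P p := by
  have hr := rad_pos hM hp
  have h2 : rad p - 2 * M ≠ 0 := (sub_pos.2 (show 2 * M < rad p from hp)).ne'
  have hs := rad_sq p
  have k := hP p hp
  have k0 := hP.pd_succ hP' hp 0
  have k1 := hP.pd_succ hP' hp 1
  have k2 := hP.pd_succ hP' hp 2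
  simp only [divSecond, cov, invMetric_eq hM hp, christoffel_eq hM hp, pd_twoForm hT hp, hT p hp,
    Fin.sum_univ_four, div3, Fin.sum_univ_three, jac, dot] at *
  simp [dt, flat, spat, twoForm, pos] at *
  linear_combination (2 * M / rad p ^ 3) * (p 1 * k0 + p 2 * k1 + p 3 * k2) +
    (- ((-1 + 2 * M * (p 1 ^ 2 + p 2 ^ 2 + p 3 ^ 2) / rad p ^ 3) * (M / (rad p ^ 2 * (rad p - 2 * M)))
      - rad p / (rad p - 2 * M) * (1 - 2 * M / rad p) * (M / rad p ^ 3))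
    - (1 - 2 * M / rad p) * (M / rad p ^ 3 * (rad p / (rad p - 2 * M))
      - M * (3 * rad p - 4 * M) / (rad p ^ 4 * (rad p - 2 * M) ^ 2) *
        (- (p 1 ^ 2 + p 2 ^ 2 + p 3 ^ 2) + 2 * M * (p 1 ^ 2 + p 2 ^ 2 + p 3 ^ 2) ^ 2 / rad p ^ 3)
      + 2 * M / (rad p ^ 2 * (rad p - 2 * M)) *
        (-3 + 2 * M * (p 1 ^ 2 + p 2 ^ 2 + p 3 ^ 2) / rad p ^ 3)) - 2 * M / rad p ^ 3) * k

/-- The time derivative contributes x · ∂_t P = 0 and the connection terms cancel, so only the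
magnetic part survives in the radial component. -/
theorem dot_divSecond (hM : 0 < M) {T : Tensor2} {P Q : Spacetime → Fin 3 → ℝ}
    (hT : ∀ y ∈ exterior M, T y = twoForm (P y) (Q y)) (hP : Tangential M P)
    (hP' : SmoothOn M P) (hp : p ∈ exterior M) :
    ∑ i : Fin 3, pos p i * divSecond M T p i.succ = - dot (pos p) (curl3 Q p) := by
  have k := hP.pd_zero hP' hp
  simp only [divSecond, cov, invMetric_eq hM hp, christoffel_eq hM hp, pd_twoForm hT hp, hT p hp,
    Fin.sum_univ_four, Fin.sum_univ_three, curl3, jac, dot] at *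
  simp [dt, flat, spat, twoForm, pos] at *
  linear_combination - (rad p / (rad p - 2 * M)) * k

end Divergence

/-! ### Smoothness of the tangential fields -/

section Smoothness

variable {M : ℝ} {p : Spacetime}

theorem contDiffOn_rad (hM : 0 < M) : ContDiffOn ℝ ∞ rad (exterior M) :=
  fun _ hp => (contDiffAt_rad (rad_pos hM hp)).contDiffWithinAt

theorem contDiffOn_coord (a : Fin 4) : ContDiffOn ℝ ∞ (fun y : Spacetime => y a) (exterior M) := by
  fun_prop

theorem smoothOn_pos : SmoothOn M pos := by
  intro i
  simp only [pos_apply]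
  exact contDiffOn_coord _

theorem SmoothOn.crs_pos {V : Spacetime → Fin 3 → ℝ} (hV : SmoothOn M V) :
    SmoothOn M (fun y => crs (pos y) (V y)) := by
  have h : ∀ i j, ContDiffOn ℝ ∞ (fun y => pos y i * V y j) (exterior M) :=
    fun i j => (smoothOn_pos i).mul (hV j)
  intro i
  fin_cases i
  exacts [(h 1 2).sub (h 2 1), (h 2 0).sub (h 0 2), (h 0 1).sub (h 1 0)]

theorem SmoothOn.contDiffOn_dot {V : Spacetime → Fin 3 → ℝ} (hV : SmoothOn M V) :
    ContDiffOn ℝ ∞ (fun y => dot (pos y) (V y)) (exterior M) := by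
  have h : ∀ i j, ContDiffOn ℝ ∞ (fun y => pos y i * V y j) (exterior M) :=
    fun i j => (smoothOn_pos i).mul (hV j)
  exact ((h 0 0).add (h 1 1)).add (h 2 2)

theorem SmoothOn.smul {V : Spacetime → Fin 3 → ℝ} {φ : Spacetime → ℝ}
    (hφ : ContDiffOn ℝ ∞ φ (exterior M)) (hV : SmoothOn M V) :
    SmoothOn M (fun y i => φ y * V y i) :=
  fun i => hφ.mul (hV i)

theorem contDiffOn_inv_rad (hM : 0 < M) :
    ContDiffOn ℝ ∞ (fun y => (rad y)⁻¹) (exterior M) :=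
  (contDiffOn_rad hM).inv fun _ hp => (rad_pos hM hp).ne'

theorem smoothOn_fld {F : Tensor2} (hF : ContDiffOn ℝ ∞ F (exterior M)) :
    SmoothOn M (fldE F) ∧ SmoothOn M (fldB F) := by
  have h : ∀ a b, ContDiffOn ℝ ∞ (fun y => F y a b) (exterior M) := fun a b =>
    contDiffOn_pi.1 (contDiffOn_pi.1 hF a) b
  constructor <;> intro i <;> fin_cases i <;> simp [fldE, fldB, h]

theorem smoothOn_fieldS (hM : 0 < M) (o : ℤˣ) {F : Tensor2}
    (hF : ContDiffOn ℝ ∞ F (exterior M)) : SmoothOn M (fieldS M o F) := by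
  refine SmoothOn.smul (V := fun y => crs (pos y) (fldB F y))
    (contDiffOn_const.mul (contDiffOn_const.sub ?_)) (smoothOn_fld hF).2.crs_pos
  simpa only [div_eq_mul_inv] using contDiffOn_const.mul (contDiffOn_inv_rad hM)

theorem smoothOn_fieldD (hM : 0 < M) (o : ℤˣ) {F : Tensor2}
    (hF : ContDiffOn ℝ ∞ F (exterior M)) : SmoothOn M (fieldD M o F) := by
  intro i
  refine contDiffOn_const.mul (((contDiffOn_rad hM).mul ((smoothOn_fld hF).1 i)).sub ?_)
  simpa only [div_eq_mul_inv] using ((smoothOn_pos i).mul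
    (smoothOn_fld hF).1.contDiffOn_dot).mul (contDiffOn_inv_rad hM)

end Smoothness

/-! ### Divergence and radial curl of radial multiples -/

section RadialProducts

variable {M : ℝ} {p : Spacetime} {V : Spacetime → Fin 3 → ℝ}

theorem jac_radial_mul (hr : 0 < rad p) {φ : ℝ → ℝ} {φ' : ℝ} (h : HasDerivAt φ φ' (rad p))
    (hV : ∀ j, DifferentiableAt ℝ (fun y => V y j) p) (i j : Fin 3) :
    jac (fun y k => φ (rad y) * V y k) p i j =
      φ' / rad p * pos p i * V p j + φ (rad p) * jac V p i j := by
  have h1 : DifferentiableAt ℝ (fun y => φ (rad y)) p :=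
    DifferentiableAt.comp p h.differentiableAt (differentiableAt_rad hr)
  simp only [jac]
  rw [pd_mul h1 (hV j), pd_comp_rad hr h]
  simp [spat, pos_apply]
  left
  ring

theorem jac_crs (hV : ∀ j, DifferentiableAt ℝ (fun y => V y j) p) (i j : Fin 3) :
    jac (fun y => crs (pos y) (V y)) p i j =
      crs (Pi.single i 1) (V p) j + crs (pos p) (jac V p i) j := by
  have h0 := hV 0
  have h1 := hV 1
  have h2 := hV 2
  have e : ∀ a b : Fin 3, pd i.succ (fun y => pos y a * V y b) p =
      Pi.single (M := fun _ => ℝ) i 1 a * V p b + pos p a * jac V p i b := by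
    intro a b
    simp only [pos_apply]
    rw [pd_mul (by fun_prop) (hV b), pd_coord]
    simp [jac, Pi.single_apply, eq_comm]
  have d : ∀ a b : Fin 3, DifferentiableAt ℝ (fun y => pos y a * V y b) p := by
    intro a b
    simp only [pos_apply]
    have := hV b
    fun_prop
  have key : ∀ a b c d', pd i.succ (fun y => pos y a * V y b - pos y c * V y d') p =
      (Pi.single (M := fun _ => ℝ) i 1 a * V p b + pos p a * jac V p i b)
      - (Pi.single (M := fun _ => ℝ) i 1 c * V p d' + pos p c * jac V p i d') := by
    intro a b c d'
    rw [pd_sub (d a b) (d c d'), e, e]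
  fin_cases j
  · exact (key 1 2 2 1).trans (by simp [crs]; ring)
  · exact (key 2 0 0 2).trans (by simp [crs]; ring)
  · exact (key 0 1 1 0).trans (by simp [crs]; ring)

/-- The divergence of a radial multiple of `x × V`. -/
theorem div3_radial_crs (hr : 0 < rad p) {φ : ℝ → ℝ} {φ' : ℝ} (h : HasDerivAt φ φ' (rad p))
    (hV : ∀ j, DifferentiableAt ℝ (fun y => V y j) p) :
    div3 (fun y k => φ (rad y) * crs (pos y) (V y) k) p =
      - φ (rad p) * dot (pos p) (curl3 V p) := by
  have d : ∀ j, DifferentiableAt ℝ (fun y => crs (pos y) (V y) j) p := by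
    have h0 := hV 0
    have h1 := hV 1
    have h2 := hV 2
    intro j
    fin_cases j <;> simp [crs, pos] <;> fun_prop
  change ∑ i, jac (fun y k => φ (rad y) * crs (pos y) (V y) k) p i i = _
  simp only [jac_radial_mul hr h d, jac_crs hV]
  simp [Fin.sum_univ_three, crs, dot, curl3]
  ring

/-- The radial part of the curl of a radial multiple of `V`. -/
theorem dot_curl3_radial (hr : 0 < rad p) {φ : ℝ → ℝ} {φ' : ℝ} (h : HasDerivAt φ φ' (rad p))
    (hV : ∀ j, DifferentiableAt ℝ (fun y => V y j) p) :
    dot (pos p) (curl3 (fun y k => φ (rad y) * V y k) p) =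
      φ (rad p) * dot (pos p) (curl3 V p) := by
  simp only [dot, curl3, jac_radial_mul hr h hV]
  simp
  ring

/-- The radial part of the curl of `x × V`, for tangential `V`. -/
theorem dot_curl3_crs (hV : SmoothOn M V) (hT : Tangential M V) (hp : p ∈ exterior M) :
    dot (pos p) (curl3 (fun y => crs (pos y) (V y)) p) = rad p ^ 2 * div3 V p := by
  have k := hT p hp
  have k0 := hT.pd_succ hV hp 0
  have k1 := hT.pd_succ hV hp 1
  have k2 := hT.pd_succ hV hp 2
  rw [← dot_pos_self]
  change _ = _ * ∑ i, jac V p i i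
  simp only [curl3, jac_crs (hV.diff hp), Fin.sum_univ_three, dot] at *
  simp [crs]
  linear_combination (-1) * k - pos p 0 * k0 - pos p 1 * k1 - pos p 2 * k2

end RadialProducts

/-! ### Time and radial components of β -/

section Beta

variable {M : ℝ} {p : Spacetime}

theorem covU_eq (hr : 0 < rad p) (a : Fin 4) :
    covU p a = - (spat p a / rad p ^ 2) := by
  rw [covU, pd_rad hr]
  field_simp

theorem contractU_eq (hM : 0 < M) (hp : p ∈ exterior M) (T : Tensor2) (a : Fin 4) :
    contractU M T p a = (rad p - 2 * M) / rad p ^ 3 * ∑ b, spat p b * T p a b := by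
  have hr := rad_pos hM hp
  have hs := rad_sq p
  have e : ∀ b, ∑ c, invMetric M p b c * covU p c * T p a b =
      (rad p - 2 * M) / rad p ^ 3 * (spat p b * T p a b) := by
    intro b
    simp only [invMetric_eq hM hp, covU_eq hr, Fin.sum_univ_four]
    fin_cases b <;> simp [dt, flat, spat] <;> field_simp <;> grind
  unfold contractU
  rw [Finset.mul_sum]
  exact Finset.sum_congr rfl fun b _ => e b

/-- Together with `dot_contractU` this shows that the terms with U affect only the tangential
components of β. -/
theorem contractU_zero (hM : 0 < M) (hp : p ∈ exterior M) {T : Tensor2} {P Q : Fin 3 → ℝ}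
    (hT : T p = twoForm P Q) (hP : dot (pos p) P = 0) : contractU M T p 0 = 0 := by
  rw [contractU_eq hM hp, hT]
  simp [Fin.sum_univ_four, twoForm, spat, dot, pos] at *
  right
  linarith

theorem dot_contractU (hM : 0 < M) (hp : p ∈ exterior M) {T : Tensor2} {P Q : Fin 3 → ℝ}
    (hT : T p = twoForm P Q) : ∑ i : Fin 3, pos p i * contractU M T p i.succ = 0 := by
  simp only [contractU_eq hM hp, hT]
  simp [Fin.sum_univ_four, Fin.sum_univ_three, twoForm, spat, pos]
  ring

theorem re_beta (o : ℤˣ) (F : Tensor2) (a : Fin 4) :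
    (beta M o F p a).re = - (1 / 2) * (contractU M (fieldZ M o F) p a
      + divSecond M (fieldZ M o F) p a) := by
  simp [beta]
  ring

theorem im_beta (o : ℤˣ) (F : Tensor2) (a : Fin 4) :
    (beta M o F p a).im = - (1 / 2) * (contractU M (hodge M o (fieldZ M o F)) p a
      + divSecond M (hodge M o (fieldZ M o F)) p a) := by
  simp [beta]
  ring

variable {F : Tensor2} (o : ℤˣ)

theorem tangential_fieldS (M : ℝ) (o : ℤˣ) (F : Tensor2) : Tangential M (fieldS M o F) :=
  fun p _ => dot_fieldS M o F p

theorem tangential_fieldD (hM : 0 < M) : Tangential M (fieldD M o F) :=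
  fun _ hp => dot_fieldD (rad_pos hM hp) o F

theorem tangential_elecW (M : ℝ) (o : ℤˣ) (F : Tensor2) : Tangential M (elecW M o F) := by
  intro p _
  simp [dot, elecW, crs]
  ring

theorem smoothOn_elecW (hM : 0 < M) (hF : ContDiffOn ℝ ∞ F (exterior M)) :
    SmoothOn M (elecW M o F) := by
  refine SmoothOn.smul (V := fun y => crs (pos y) (fieldD M o F y)) (contDiffOn_const.mul ?_)
    (smoothOn_fieldD hM o hF).crs_pos
  simpa only [one_div] using contDiffOn_inv_rad hM

theorem hasDerivAt_inv_sub {s c : ℝ} (h : s - c ≠ 0) :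
    HasDerivAt (fun s : ℝ => 1 / (s - c)) (- 1 / (s - c) ^ 2) s := by
  simp only [one_div]
  exact ((hasDerivAt_id s).sub_const c).inv h

/-- This and the next three lemmas give all that is needed of β explicitly. Its tangential
components stay free unknowns, absorbed later by a quadratic form. -/
theorem re_beta_zero (hM : 0 < M) (hF : ContDiffOn ℝ ∞ F (exterior M))
    (hA : ∀ p ∈ exterior M, ∀ a b, F p a b = - F p b a) (hp : p ∈ exterior M) :
    (beta M o F p 0).re = 1 / 2 * div3 (fieldS M o F) p := by
  rw [re_beta, contractU_zero hM hp (fieldZ_eq hM hp o (hA p hp)) (dot_fieldS M o F p),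
    divSecond_zero hM (fun y hy => fieldZ_eq hM hy o (hA y hy)) (tangential_fieldS M o F)
      (smoothOn_fieldS hM o hF) hp]
  ring

theorem im_beta_zero (hM : 0 < M) (hF : ContDiffOn ℝ ∞ F (exterior M))
    (hA : ∀ p ∈ exterior M, ∀ a b, F p a b = - F p b a) (hp : p ∈ exterior M) :
    (beta M o F p 0).im =
      - (1 / 2) * ((o : ℤ) : ℝ) * (dot (pos p) (curl3 (fieldD M o F) p) / rad p) := by
  have hr := rad_pos hM hp
  have h := div3_radial_crs hr
    (((hasDerivAt_inv_sub (c := 0) (by simpa using hr.ne')).const_mul ((o : ℤ) : ℝ)))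
    ((smoothOn_fieldD hM o hF).diff hp)
  simp only [sub_zero] at h
  rw [im_beta,
    contractU_zero hM hp (hodge_fieldZ_eq hM hp o (hA p hp)) (tangential_elecW M o F p hp),
    divSecond_zero hM (fun y hy => hodge_fieldZ_eq hM hy o (hA y hy)) (tangential_elecW M o F)
      (smoothOn_elecW o hM hF) hp]
  change - (1 / 2) * (0 + - div3 (fun y k => ((o : ℤ) : ℝ) * (1 / rad y) *
    crs (pos y) (fieldD M o F y) k) p) = _
  rw [h]
  ring

/-- The magnetic part of Z is a radial multiple of x × D, and x · curl(x × D) = r² div D for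
tangential D. -/
theorem dot_re_beta (hM : 0 < M) (hF : ContDiffOn ℝ ∞ F (exterior M))
    (hA : ∀ p ∈ exterior M, ∀ a b, F p a b = - F p b a) (hp : p ∈ exterior M) :
    ∑ i : Fin 3, pos p i * (beta M o F p i.succ).re =
      1 / 2 * (rad p ^ 2 / (rad p - 2 * M)) * div3 (fieldD M o F) p := by
  have hr := rad_pos hM hp
  have h2 : rad p - 2 * M ≠ 0 := (sub_pos.2 (show 2 * M < rad p from hp)).ne'
  have k1 := dot_contractU hM hp (fieldZ_eq hM hp o (hA p hp))
  have k2 := dot_divSecond hM (fun y hy => fieldZ_eq hM hy o (hA y hy)) (tangential_fieldS M o F)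
      (smoothOn_fieldS hM o hF) hp
  have k3 : dot (pos p) (curl3 (magZ M o F) p) = _ :=
    dot_curl3_radial hr (hasDerivAt_inv_sub h2)
    (V := fun y => crs (pos y) (fieldD M o F y))
    ((smoothOn_fieldD hM o hF).crs_pos.diff hp)
  rw [k3, dot_curl3_crs (smoothOn_fieldD hM o hF) (tangential_fieldD o hM) hp] at k2
  simp only [re_beta, Fin.sum_univ_three] at *
  linear_combination - (1 / 2) * k1 - (1 / 2) * k2

theorem dot_im_beta (hM : 0 < M) (hF : ContDiffOn ℝ ∞ F (exterior M))
    (hA : ∀ p ∈ exterior M, ∀ a b, F p a b = - F p b a) (hp : p ∈ exterior M) :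
    ∑ i : Fin 3, pos p i * (beta M o F p i.succ).im =
      - (1 / 2) * ((o : ℤ) : ℝ) * (rad p / (rad p - 2 * M)) *
        dot (pos p) (curl3 (fieldS M o F) p) := by
  have hr := rad_pos hM hp
  have h2 : rad p - 2 * M ≠ 0 := (sub_pos.2 (show 2 * M < rad p from hp)).ne'
  have k1 := dot_contractU hM hp (hodge_fieldZ_eq hM hp o (hA p hp))
  have k2 := dot_divSecond hM (fun y hy => hodge_fieldZ_eq hM hy o (hA y hy))
    (tangential_elecW M o F) (smoothOn_elecW o hM hF) hp
  have d : HasDerivAt (fun s : ℝ => s / (s - 2 * M)) _ (rad p) :=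
    (hasDerivAt_id (rad p)).div ((hasDerivAt_id (rad p)).sub_const (2 * M)) h2
  have k3 : dot (pos p) (curl3 (magW M o F) p) = _ :=
    dot_curl3_radial hr (d.const_mul (- ((o : ℤ) : ℝ))) (V := fieldS M o F)
    ((smoothOn_fieldS hM o hF).diff hp)
  rw [k3] at k2
  simp only [im_beta, Fin.sum_univ_three] at *
  linear_combination - (1 / 2) * k1 - (1 / 2) * k2

end Beta

/-! ### Contractions occurring in the energy density -/

section DensityTerms

variable {M : ℝ} {p : Spacetime}

/-- The vector with time component `a` and radial component `b`. -/
def radialVec (p : Spacetime) (a b : ℝ) : Spacetime :=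
  ![a, b * (p 1 / rad p), b * (p 2 / rad p), b * (p 3 / rad p)]

/-- The spatial part of a covector. -/
def tail3 (u : Fin 4 → ℝ) : Fin 3 → ℝ := ![u 1, u 2, u 3]

theorem raise_covector (hM : 0 < M) (hp : p ∈ exterior M) (u : Fin 4 → ℝ) (b : Fin 4) :
    ∑ c, invMetric M p b c * u c = rad p / (rad p - 2 * M) * (dt b * u 0)
      - (1 - dt b) * u b + 2 * M / rad p ^ 3 * (spat p b * dot (pos p) (tail3 u)) := by
  simp only [invMetric_eq hM hp, Fin.sum_univ_four]
  fin_cases b <;> simp [dt, flat, spat, dot, pos, tail3] <;> ring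

/-- The norm squared of a covector. -/
def normSq (M : ℝ) (p : Spacetime) (u : Fin 4 → ℝ) : ℝ :=
  rad p / (rad p - 2 * M) * u 0 ^ 2 - dot (tail3 u) (tail3 u)
    + 2 * M / rad p ^ 3 * dot (pos p) (tail3 u) ^ 2

theorem sum_raise_mul (hM : 0 < M) (hp : p ∈ exterior M) (u : Fin 4 → ℝ) :
    ∑ b, (∑ c, invMetric M p b c * u c) * u b = normSq M p u := by
  simp only [raise_covector hM hp, Fin.sum_univ_four]
  simp [dt, spat, dot, pos, tail3, normSq]
  ring

theorem contract_Z (hM : 0 < M) (hp : p ∈ exterior M) {S D : Fin 3 → ℝ}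
    (hS : dot (pos p) S = 0) (hD : dot (pos p) D = 0) (u : Fin 4 → ℝ) (a b : ℝ) :
    ∑ i, radialVec p a b i * ∑ j, (∑ c, invMetric M p j c * u c) *
      twoForm S (fun i => 1 / (rad p - 2 * M) * crs (pos p) D i) i j =
      - (a * dot S (tail3 u) + b * (rad p / (rad p - 2 * M)) * dot D (tail3 u)) := by
  have hr := rad_pos hM hp
  have h2 : rad p - 2 * M ≠ 0 := (sub_pos.2 (show 2 * M < rad p from hp)).ne'
  have hs := rad_sq p
  simp only [raise_covector hM hp, Fin.sum_univ_four]
  simp [dt, spat, dot, pos, tail3, twoForm, radialVec, crs] at *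
  have h3 : p 1 * p 1 + p 2 * p 2 + p 3 * p 3 = rad p ^ 2 := by linarith
  field_simp
  grind

theorem contract_W (hM : 0 < M) (hp : p ∈ exterior M) (S D : Fin 3 → ℝ) (o : ℝ)
    (u : Fin 4 → ℝ) (a b : ℝ) :
    ∑ i, radialVec p a b i * ∑ j, (∑ c, invMetric M p j c * u c) *
      twoForm (fun i => o * (1 / rad p) * crs (pos p) D i)
        (fun i => - o * (rad p / (rad p - 2 * M)) * S i) i j =
      - (o / rad p) * (a * dot (crs (pos p) D) (tail3 u)
        + b * (rad p / (rad p - 2 * M)) * dot (crs (pos p) S) (tail3 u)) := by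
  have hr := rad_pos hM hp
  have h2 : rad p - 2 * M ≠ 0 := (sub_pos.2 (show 2 * M < rad p from hp)).ne'
  simp only [raise_covector hM hp, Fin.sum_univ_four]
  simp [dt, spat, dot, pos, tail3, twoForm, radialVec, crs] at *
  field_simp
  ring

theorem square_Z (hM : 0 < M) (hp : p ∈ exterior M) {S D : Fin 3 → ℝ}
    (hS : dot (pos p) S = 0) (hD : dot (pos p) D = 0) :
    ∑ b, ∑ c, ∑ b', ∑ c', invMetric M p b b' * invMetric M p c c' *
      twoForm S (fun i => 1 / (rad p - 2 * M) * crs (pos p) D i) b c *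
      twoForm S (fun i => 1 / (rad p - 2 * M) * crs (pos p) D i) b' c' =
      - 2 * (rad p / (rad p - 2 * M)) * (dot S S - dot D D) := by
  have hr := rad_pos hM hp
  have h2 : rad p - 2 * M ≠ 0 := (sub_pos.2 (show 2 * M < rad p from hp)).ne'
  have hs := rad_sq p
  set B : Fin 3 → ℝ := fun i => 1 / (rad p - 2 * M) * crs (pos p) D i with hB
  have e : ∀ b c, ∑ b', ∑ c', invMetric M p b b' * invMetric M p c c' * twoForm S B b c *
      twoForm S B b' c' = twoForm S B b c * twoForm (raiseE M p S) (raiseB M p B) b c := by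
    intro b c
    rw [← raise_twoForm hM hp, Finset.mul_sum]
    refine Finset.sum_congr rfl fun b' _ => ?_
    rw [Finset.mul_sum]
    exact Finset.sum_congr rfl fun c' _ => by ring
  have k : dot (pos p) B = 0 := by
    simp [hB, dot, crs]; ring
  simp only [e]
  simp only [Fin.sum_univ_four]
  simp only [twoForm, raiseE, raiseB, hS, k]
  simp [hB, crs, dot, pos] at *
  field_simp
  -- Lagrange's identity |x × D|² = r²|D|² for D orthogonal to x.
  have lag : (p 2 * D 2 - p 3 * D 1) ^ 2 + (p 3 * D 0 - p 1 * D 2) ^ 2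
      + (p 1 * D 1 - p 2 * D 0) ^ 2 = rad p ^ 2 * (D 0 ^ 2 + D 1 ^ 2 + D 2 ^ 2) := by
    linear_combination (D 0 ^ 2 + D 1 ^ 2 + D 2 ^ 2) * (-hs)
      - (p 1 * D 0 + p 2 * D 1 + p 3 * D 2) * hD
  linear_combination 2 * lag

/-- Contracting Z with the radial covector gives a multiple of D. The remaining contraction is then
the case u = -rD of `contract_Z`, so the nested sum never has to be expanded at once. -/
theorem contract_ZZ (hM : 0 < M) (hp : p ∈ exterior M) {S D : Fin 3 → ℝ}
    (hS : dot (pos p) S = 0) (hD : dot (pos p) D = 0) (a b : ℝ) :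
    ∑ i, radialVec p a b i * ∑ j, ∑ c, ∑ j', ∑ c', invMetric M p c c' *
      twoForm S (fun i => 1 / (rad p - 2 * M) * crs (pos p) D i) i c' *
      twoForm S (fun i => 1 / (rad p - 2 * M) * crs (pos p) D i) j c *
      (invMetric M p j j' * spat p j') =
      rad p * (a * dot S D + b * (rad p / (rad p - 2 * M)) * dot D D) := by
  have hr := rad_pos hM hp
  have h2 : rad p - 2 * M ≠ 0 := (sub_pos.2 (show 2 * M < rad p from hp)).ne'
  have hs := rad_sq p
  set B : Fin 3 → ℝ := fun i => 1 / (rad p - 2 * M) * crs (pos p) D i with hB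
  have k : dot (pos p) (tail3 (spat p)) = rad p ^ 2 := by
    rw [← dot_pos_self]; simp [dot, tail3, pos, spat]
  have e0 : ∀ j, ∑ j', invMetric M p j j' * spat p j' = - ((rad p - 2 * M) / rad p) * spat p j := by
    intro j
    rw [raise_covector hM hp, k]
    fin_cases j <;> simp [dt, spat] <;> field_simp <;> ring
  have e1 : ∀ c, ∑ j, twoForm S B j c * spat p j =
      rad p ^ 2 / (rad p - 2 * M) * (![0, D 0, D 1, D 2] : Fin 4 → ℝ) c := by
    intro c
    simp only [Fin.sum_univ_four]
    fin_cases c <;> simp [twoForm, spat, hB, crs, dot, pos] at * <;> field_simp <;> grind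
  have e2 : ∀ i, ∑ j, ∑ c, ∑ j', ∑ c', invMetric M p c c' * twoForm S B i c' * twoForm S B j c *
      (invMetric M p j j' * spat p j') =
      ∑ c', (∑ c, invMetric M p c' c * (- rad p * (![0, D 0, D 1, D 2] : Fin 4 → ℝ) c))
        * twoForm S B i c' := by
    intro i
    have hsym : ∀ c c', invMetric M p c c' = invMetric M p c' c := by
      intro c c'
      rw [invMetric_eq hM hp, invMetric_eq hM hp]
      have : flat c c' = flat c' c := by unfold flat; congr 1; grind
      rw [this]; ring
    calc _ = ∑ j, ∑ c, ∑ c', invMetric M p c c' * twoForm S B i c' *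
          ((twoForm S B j c * spat p j) * (- ((rad p - 2 * M) / rad p))) := by
          refine Finset.sum_congr rfl fun j _ => Finset.sum_congr rfl fun c _ => ?_
          rw [Finset.sum_comm]
          refine Finset.sum_congr rfl fun c' _ => ?_
          rw [← Finset.mul_sum, e0]
          ring
      _ = ∑ c, ∑ c', ∑ j, invMetric M p c c' * twoForm S B i c' *
          ((twoForm S B j c * spat p j) * (- ((rad p - 2 * M) / rad p))) := by
          rw [Finset.sum_comm]
          exact Finset.sum_congr rfl fun c _ => Finset.sum_comm
      _ = ∑ c, ∑ c', invMetric M p c' c * (- rad p * (![0, D 0, D 1, D 2] : Fin 4 → ℝ) c)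
          * twoForm S B i c' := by
          refine Finset.sum_congr rfl fun c _ => Finset.sum_congr rfl fun c' _ => ?_
          rw [← Finset.mul_sum, ← Finset.sum_mul, e1, hsym c c']
          field_simp
      _ = _ := by
          rw [Finset.sum_comm]
          exact Finset.sum_congr rfl fun c _ => (Finset.sum_mul _ _ _).symm
  simp only [e2]
  rw [contract_Z hM hp hS hD]
  simp [dot, tail3]
  ring

theorem hasDerivAt_scalarQ {s : ℝ} (hs : s ≠ 0) :
    HasDerivAt (fun s : ℝ => 9 * M ^ 2 * (s - 2 * M) * (2 * s - 3 * M) / (4 * s ^ 5))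
      (- (9 * M ^ 2 * (3 * s ^ 2 - 14 * M * s + 15 * M ^ 2)) / (2 * s ^ 6)) s := by
  have h1 := ((((hasDerivAt_id s).sub_const (2 * M)).const_mul (9 * M ^ 2)).mul
    (((hasDerivAt_id s).const_mul 2).sub_const (3 * M))).div
    (((hasDerivAt_id s).pow 5).const_mul 4) (by simpa using hs)
  refine h1.congr_deriv ?_
  simp
  field_simp
  ring

theorem pd_scalarQ (hr : 0 < rad p) (a : Fin 4) : pd a (scalarQ M) p =
    - (9 * M ^ 2 * (3 * rad p ^ 2 - 14 * M * rad p + 15 * M ^ 2)) / (2 * rad p ^ 6) *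
      (spat p a / rad p) :=
  pd_comp_rad hr (hasDerivAt_scalarQ hr.ne') a

end DensityTerms

/-! ### Scalar inequalities in s = M/r and Cauchy–Schwarz bounds -/

section ScalarInequalities

theorem abs_coeff_le {s : ℝ} (h0 : 0 < s) (h1 : s < 1 / 2) :
    |1 / 2 * (1 - 3 * s) + 9 / 4 * s ^ 2 * (3 - 14 * s + 15 * s ^ 2)| ≤ 1 / 2 := by
  rw [abs_le]
  constructor
  · nlinarith [mul_pos h0 h0, sq_nonneg (s - 2 / 5), sq_nonneg (s ^ 2 - 1 / 4),
      sq_nonneg (s * (s - 2 / 5)), mul_pos h0 (sub_pos.2 h1)]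
  -- The constant 2/3 makes 9/4 · s · 2/3 cancel the -3s/2 of the first summand exactly.
  · have : s * (3 - 14 * s + 15 * s ^ 2) ≤ 2 / 3 := by
      nlinarith [mul_pos h0 (sub_pos.2 h1), sq_nonneg (s - 1 / 7),
        mul_pos h0 (mul_pos h0 (sub_pos.2 h1))]
    nlinarith [mul_le_mul_of_nonneg_left this h0.le]

/-- This is the discriminant condition for `quadratic_nonneg`, written in s = M/r. Both coefficients
stay above 1 - (10/9)(1/2) = 4/9, whereas the square of the cross coefficient is small. -/
theorem mul_coeff_ge {s c : ℝ} (h0 : 0 < s) (h1 : s < 1 / 2) (hc : |c| ≤ 10 / 9) :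
    2 * c ^ 2 * (9 / 4 * s ^ 2 * (1 - 2 * s) * (2 - 3 * s)) ^ 2 ≤
      (1 - 2 * s) * (1 - c * (1 / 2 * (1 - 3 * s))) *
        (2 * (1 + c * (1 / 2 * (1 - 3 * s))) + c * (9 / 2 * s ^ 2 * (3 - 14 * s + 15 * s ^ 2))) := by
  have hA : 4 / 9 ≤ 1 - c * (1 / 2 * (1 - 3 * s)) := by
    have k : |c * (1 / 2 * (1 - 3 * s))| ≤ 10 / 9 * (1 / 2) := by
      rw [abs_mul]
      refine mul_le_mul hc ?_ (abs_nonneg _) (by norm_num)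
      rw [abs_le]; constructor <;> linarith
    linarith [(abs_le.1 k).2]
  have hB : 4 / 9 ≤ 1 + c * (1 / 2 * (1 - 3 * s) + 9 / 4 * s ^ 2 * (3 - 14 * s + 15 * s ^ 2)) := by
    have k : |c * (1 / 2 * (1 - 3 * s) + 9 / 4 * s ^ 2 * (3 - 14 * s + 15 * s ^ 2))|
        ≤ 10 / 9 * (1 / 2) := by
      rw [abs_mul]
      exact mul_le_mul hc (abs_coeff_le h0 h1) (abs_nonneg _) (by norm_num)
    linarith [(abs_le.1 k).1]
  have hAB : 4 / 9 * (4 / 9) ≤ (1 - c * (1 / 2 * (1 - 3 * s))) *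
      (1 + c * (1 / 2 * (1 - 3 * s) + 9 / 4 * s ^ 2 * (3 - 14 * s + 15 * s ^ 2))) :=
    mul_le_mul hA hB (by norm_num) (by linarith)
  have h2 : 0 < 1 - 2 * s := by linarith
  -- This factor and s(2 - 3s) below are both largest at s = 1/3, the photon sphere r = 3M.
  have k1 : s ^ 2 * (1 - 2 * s) ≤ 1 / 27 := by
    nlinarith [mul_nonneg (sq_nonneg (s - 1 / 3)) (by linarith : 0 ≤ s + 1 / 6)]
  have k2 : (s * (2 - 3 * s)) ^ 2 ≤ 1 / 9 := by
    have u : s * (2 - 3 * s) ≤ 1 / 3 := by nlinarith [sq_nonneg (s - 1 / 3)]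
    have v : 0 ≤ s * (2 - 3 * s) := mul_nonneg h0.le (by linarith)
    nlinarith
  have k3 : (s ^ 2 * (1 - 2 * s)) * (s * (2 - 3 * s)) ^ 2 ≤ 1 / 27 * (1 / 9) :=
    mul_le_mul k1 k2 (sq_nonneg _) (by norm_num)
  have k4 : c ^ 2 ≤ (10 / 9) ^ 2 := sq_le_sq' (by linarith [(abs_le.1 hc).1]) (abs_le.1 hc).2
  have k5 : c ^ 2 * ((s ^ 2 * (1 - 2 * s)) * (s * (2 - 3 * s)) ^ 2) ≤
      (10 / 9) ^ 2 * (1 / 27 * (1 / 9)) :=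
    mul_le_mul k4 k3 (by positivity) (by norm_num)
  -- A common factor 2(1 - 2s) is taken out of both sides; 81/16 is the square of the 9/4 in q.
  have k6 := mul_le_mul_of_nonneg_left (show 81 / 16 *
      (c ^ 2 * ((s ^ 2 * (1 - 2 * s)) * (s * (2 - 3 * s)) ^ 2)) ≤
    (1 - c * (1 / 2 * (1 - 3 * s))) *
      (1 + c * (1 / 2 * (1 - 3 * s) + 9 / 4 * s ^ 2 * (3 - 14 * s + 15 * s ^ 2))) by
      norm_num at k5 hAB ⊢; linarith) (mul_nonneg zero_le_two h2.le)
  linarith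

/-- The hypotheses give (2km)² ≤ 4 · At · BX, which is at most (At + BX)² by the
arithmetic-geometric mean inequality. -/
theorem quadratic_nonneg {A B k m t X : ℝ} (hA : 0 ≤ A) (hB : 0 ≤ B) (ht : 0 ≤ t) (hX : 0 ≤ X)
    (hm : m ^ 2 ≤ 2 * t * X) (hk : 2 * k ^ 2 ≤ A * B) : 0 ≤ A * t - 2 * k * m + B * X := by
  have h1 : (2 * k * m) ^ 2 ≤ (A * t + B * X) ^ 2 := by
    have h2 : 2 * k ^ 2 * m ^ 2 ≤ A * B * (2 * t * X) :=
      mul_le_mul hk hm (sq_nonneg _) (mul_nonneg hA hB)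
    nlinarith [sq_nonneg (A * t - B * X)]
  have := abs_le_of_sq_le_sq' h1 (by positivity)
  linarith [this.2]

/-- Since X is orthogonal to x, u may be replaced by its projection off x before applying
Cauchy–Schwarz. -/
theorem dot_sq_le {x X u : Fin 3 → ℝ} {r : ℝ} (hr : 0 < r) (hx : dot x x = r ^ 2)
    (hX : dot x X = 0) : dot X u ^ 2 ≤ dot X X * (dot u u - dot x u ^ 2 / r ^ 2) := by
  set d := dot x u / r ^ 2 with hd
  have hd' : dot x u = d * r ^ 2 := by rw [hd]; field_simp
  have e1 : dot X u = dot X (fun i => u i - d * x i) := by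
    simp only [dot] at *
    linear_combination d * hX
  have e2 : dot u u - dot x u ^ 2 / r ^ 2 = dot (fun i => u i - d * x i) (fun i => u i - d * x i) := by
    rw [hd']
    field_simp
    simp only [dot] at *
    linear_combination 2 * d * hd' - d ^ 2 * hx
  rw [e1, e2]
  simp only [dot]
  nlinarith [sq_nonneg (X 0 * (u 1 - d * x 1) - X 1 * (u 0 - d * x 0)),
    sq_nonneg (X 0 * (u 2 - d * x 2) - X 2 * (u 0 - d * x 0)),
    sq_nonneg (X 1 * (u 2 - d * x 2) - X 2 * (u 1 - d * x 1))]

theorem dot_crs_self {x X : Fin 3 → ℝ} (hX : dot x X = 0) :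
    dot (crs x X) (crs x X) = dot x x * dot X X := by
  simp [dot, crs] at *
  linear_combination (-(x 0 * X 0 + x 1 * X 1 + x 2 * X 2)) * hX

theorem dot_self_nonneg (X : Fin 3 → ℝ) : 0 ≤ dot X X := by
  simp only [dot]; nlinarith [sq_nonneg (X 0), sq_nonneg (X 1), sq_nonneg (X 2)]

end ScalarInequalities

/-! ### Pointwise lower bound for the energy density -/

section DensityBound

variable {M : ℝ} {p : Spacetime} {F : Tensor2} (o : ℤˣ)

/-- The real part of `β`. -/
def reBeta (M : ℝ) (o : ℤˣ) (F : Tensor2) (p : Spacetime) (a : Fin 4) : ℝ := (beta M o F p a).re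

/-- The imaginary part of `β`. -/
def imBeta (M : ℝ) (o : ℤˣ) (F : Tensor2) (p : Spacetime) (a : Fin 4) : ℝ := (beta M o F p a).im

theorem betaUp_re (a : Fin 4) :
    (betaUp M o F p a).re = ∑ b, invMetric M p a b * reBeta M o F p b := by
  simp [betaUp, reBeta]

theorem betaUp_im (a : Fin 4) :
    (betaUp M o F p a).im = ∑ b, invMetric M p a b * imBeta M o F p b := by
  simp [betaUp, imBeta]

theorem superH_eq (hM : 0 < M) (hp : p ∈ exterior M) (a b : Fin 4) :
    superH M o F p a b = reBeta M o F p a * reBeta M o F p b + imBeta M o F p a * imBeta M o F p b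
      - 1 / 2 * metric M p a b *
        (normSq M p (reBeta M o F p) + normSq M p (imBeta M o F p)) := by
  have e : (∑ c, betaUp M o F p c * star (beta M o F p c)).re =
      normSq M p (reBeta M o F p) + normSq M p (imBeta M o F p) := by
    rw [← sum_raise_mul hM hp, ← sum_raise_mul hM hp, ← Finset.sum_add_distrib, Complex.re_sum]
    refine Finset.sum_congr rfl fun c _ => ?_
    simp [betaUp_re, betaUp_im, reBeta, imBeta]
  unfold superH
  rw [Complex.sub_re, mul_assoc (1 / 2 : ℂ) (metric M p a b : ℂ)]
  rw [show (1 / 2 : ℂ) = ((1 / 2 : ℝ) : ℂ) by push_cast; rfl, Complex.re_ofReal_mul,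
    Complex.re_ofReal_mul, Complex.re_ofReal_mul, e]
  simp [reBeta, imBeta]
  ring

theorem metric_radial (hM : 0 < M) (hp : p ∈ exterior M) (a b a' b' : ℝ) :
    ∑ i, ∑ j, metric M p i j * radialVec p a b i * radialVec p a' b' j =
      (1 - 2 * M / rad p) * (a * a') - rad p / (rad p - 2 * M) * (b * b') := by
  have hr := rad_pos hM hp
  have h2 : rad p - 2 * M ≠ 0 := (sub_pos.2 (show 2 * M < rad p from hp)).ne'
  have hs := rad_sq p
  simp only [metric_eq hM hp, Fin.sum_univ_four]
  simp [dt, flat, spat, radialVec]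
  field_simp
  grind

theorem sum_radial (u : Fin 4 → ℝ) (a b : ℝ) :
    ∑ i, radialVec p a b i * u i = a * u 0 + b * (dot (pos p) (tail3 u) / rad p) := by
  simp [Fin.sum_univ_four, radialVec, dot, pos, tail3]
  ring

theorem superH_radial (hM : 0 < M) (hp : p ∈ exterior M) (a b a' b' : ℝ) :
    ∑ i, radialVec p a b i * ∑ j, superH M o F p i j * radialVec p a' b' j =
      (a * reBeta M o F p 0 + b * (dot (pos p) (tail3 (reBeta M o F p)) / rad p)) *
        (a' * reBeta M o F p 0 + b' * (dot (pos p) (tail3 (reBeta M o F p)) / rad p))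
      + (a * imBeta M o F p 0 + b * (dot (pos p) (tail3 (imBeta M o F p)) / rad p)) *
        (a' * imBeta M o F p 0 + b' * (dot (pos p) (tail3 (imBeta M o F p)) / rad p))
      - 1 / 2 * ((1 - 2 * M / rad p) * (a * a') - rad p / (rad p - 2 * M) * (b * b')) *
        (normSq M p (reBeta M o F p) + normSq M p (imBeta M o F p)) := by
  rw [← metric_radial hM hp, ← sum_radial, ← sum_radial, ← sum_radial, ← sum_radial]
  simp only [superH_eq o hM hp, Fin.sum_univ_four]
  ring

/-- The terms in β and its conjugate pair up to twice a real part with Z and twice an imaginary part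
with the dual of Z. -/
theorem currentP_eq (a : Fin 4) :
    currentP M o F p a = (∑ b, superH M o F p a b * vecA M p b)
      + 1 / 2 * scalarQ M p *
        ((∑ b, (∑ c, invMetric M p b c * reBeta M o F p c) * fieldZ M o F p a b)
        + ∑ b, (∑ c, invMetric M p b c * imBeta M o F p c) * hodge M o (fieldZ M o F) p a b)
      + (1 / 16) * (∑ b, ∑ c, ∑ b', ∑ c', invMetric M p b b' * invMetric M p c c' *
        fieldZ M o F p b c * fieldZ M o F p b' c') * pd a (scalarQ M) p
      - (1 / 4) * ∑ b, ∑ c, ∑ b', ∑ c', invMetric M p c c' * fieldZ M o F p a c' *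
        fieldZ M o F p b c * (invMetric M p b b' * pd b' (scalarQ M) p) := by
  dsimp only [currentP]
  congr 3
  rw [← Finset.sum_add_distrib, Finset.mul_sum, Complex.re_sum]
  refine Finset.sum_congr rfl fun b _ => ?_
  rw [← betaUp_re, ← betaUp_im]
  simp [-one_div]
  norm_num
  ring

/-- The field `½ (S + ε D)`; for `ε = ±1` this is an outgoing or ingoing null component. -/
def nullField (M : ℝ) (o : ℤˣ) (F : Tensor2) (ε : ℝ) (p : Spacetime) (i : Fin 3) : ℝ :=
  1 / 2 * (fieldS M o F p i + ε * fieldD M o F p i)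

/-- The excess of `(div V)² + (curl V)²` over its lower bound from the first eigenvalue. -/
def excess (V : Spacetime → Fin 3 → ℝ) (p : Spacetime) : ℝ :=
  div3 V p ^ 2 + (dot (pos p) (curl3 V p) / rad p) ^ 2 - 2 * dot (V p) (V p) / rad p ^ 2

theorem jac_nullField (hM : 0 < M) (hF : ContDiffOn ℝ ∞ F (exterior M)) (hp : p ∈ exterior M)
    (ε : ℝ) (i j : Fin 3) : jac (nullField M o F ε) p i j =
      1 / 2 * (jac (fieldS M o F) p i j + ε * jac (fieldD M o F) p i j) := by
  have h1 := (smoothOn_fieldS hM o hF).diff hp j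
  have h2 := (smoothOn_fieldD hM o hF).diff hp j
  simp only [jac, nullField]
  rw [pd_const_mul _ (h1.fun_add (h2.const_mul ε)), pd_add h1 (h2.const_mul ε), pd_const_mul _ h2]

theorem div3_nullField (hM : 0 < M) (hF : ContDiffOn ℝ ∞ F (exterior M)) (hp : p ∈ exterior M)
    (ε : ℝ) : div3 (nullField M o F ε) p =
      1 / 2 * (div3 (fieldS M o F) p + ε * div3 (fieldD M o F) p) := by
  change ∑ i, jac (nullField M o F ε) p i i = 1 / 2 * (∑ i, jac (fieldS M o F) p i i
    + ε * ∑ i, jac (fieldD M o F) p i i)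
  simp only [jac_nullField o hM hF hp, Fin.sum_univ_three]
  ring

theorem dot_curl3_nullField (hM : 0 < M) (hF : ContDiffOn ℝ ∞ F (exterior M))
    (hp : p ∈ exterior M) (ε : ℝ) : dot (pos p) (curl3 (nullField M o F ε) p) =
      1 / 2 * (dot (pos p) (curl3 (fieldS M o F) p)
        + ε * dot (pos p) (curl3 (fieldD M o F) p)) := by
  simp only [curl3, jac_nullField o hM hF hp, dot]
  simp
  ring

/-- The coefficient of the Morawetz vector field. -/
def morawetz (M r : ℝ) : ℝ := 1 / 2 * (1 - 3 * M / r)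

/-- Nonnegativity of the part of the density which is quadratic in the tangential part of `β` and
in one null component `X`. -/
theorem coercive_part (hM : 0 < M) (hp : p ∈ exterior M) {X : Fin 3 → ℝ}
    (hX : dot (pos p) X = 0) (u v : Fin 3 → ℝ) {c η : ℝ} (hη : η ^ 2 = 1) (hc : |c| ≤ 10 / 9) :
    0 ≤ (1 - 2 * M / rad p) * (1 - c * morawetz M (rad p)) *
        ((dot u u - dot (pos p) u ^ 2 / rad p ^ 2) + (dot v v - dot (pos p) v ^ 2 / rad p ^ 2))
      - 2 * (c * scalarQ M p) * (dot X u + η / rad p * dot (crs (pos p) X) v)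
      + (2 * (1 + c * morawetz M (rad p)) / rad p ^ 2
        + c * (9 * M ^ 2 * (3 * rad p ^ 2 - 14 * M * rad p + 15 * M ^ 2) / (2 * rad p ^ 6))) *
        dot X X := by
  have hr := rad_pos hM hp
  have hpos := dot_pos_self p
  have h2 : 2 * M < rad p := hp
  have s0 : 0 < M / rad p := by positivity
  have s1 : M / rad p < 1 / 2 := by rw [div_lt_iff₀ hr]; linarith
  -- Every coefficient is a power of r times a polynomial in s = M/r, which reduces the claim to
  -- `mul_coeff_ge`.
  obtain ⟨s, hs⟩ : ∃ s, s = M / rad p := ⟨_, rfl⟩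
  rw [← hs] at s0 s1
  have hMs : M = s * rad p := by rw [hs]; field_simp
  have key := mul_coeff_ge s0 s1 hc
  have e1 : 1 - 2 * M / rad p = 1 - 2 * s := by rw [hMs]; field_simp
  have e2 : morawetz M (rad p) = 1 / 2 * (1 - 3 * s) := by
    unfold morawetz; rw [hMs]; field_simp
  have e3 : scalarQ M p = (9 / 4 * s ^ 2 * (1 - 2 * s) * (2 - 3 * s)) / rad p := by
    unfold scalarQ
    generalize rad p = r at *
    subst hMs
    field_simp
  have e4 : 2 * (1 + c * morawetz M (rad p)) / rad p ^ 2
        + c * (9 * M ^ 2 * (3 * rad p ^ 2 - 14 * M * rad p + 15 * M ^ 2) / (2 * rad p ^ 6)) =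
      (2 * (1 + c * (1 / 2 * (1 - 3 * s))) + c * (9 / 2 * s ^ 2 * (3 - 14 * s + 15 * s ^ 2)))
        / rad p ^ 2 := by
    rw [e2]
    generalize rad p = r at *
    subst hMs
    field_simp
  have tu := dot_sq_le hr hpos hX (u := u)
  have tv := dot_sq_le (X := crs (pos p) X) hr hpos (by simp [dot, crs]; ring) (u := v)
  rw [dot_crs_self hX, hpos] at tv
  have hA0 : 0 < 1 - c * (1 / 2 * (1 - 3 * s)) := by
    have k : |c * (1 / 2 * (1 - 3 * s))| ≤ 10 / 9 * (1 / 2) := by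
      rw [abs_mul]
      refine mul_le_mul hc ?_ (abs_nonneg _) (by norm_num)
      rw [abs_le]; constructor <;> linarith
    linarith [(abs_le.1 k).2]
  have hA : 0 < (1 - 2 * s) * (1 - c * (1 / 2 * (1 - 3 * s))) := mul_pos (by linarith) hA0
  have hB : 0 ≤ 2 * (1 + c * (1 / 2 * (1 - 3 * s)))
      + c * (9 / 2 * s ^ 2 * (3 - 14 * s + 15 * s ^ 2)) :=
    nonneg_of_mul_nonneg_right (le_trans (by positivity) key) hA
  -- This quantity is the squared length of the tangential part of w.
  have hproj : ∀ w : Fin 3 → ℝ, 0 ≤ dot w w - dot (pos p) w ^ 2 / rad p ^ 2 := by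
    intro w
    have h := dot_sq_le (X := fun i => w i - dot (pos p) w / rad p ^ 2 * pos p i) hr hpos ?_
      (u := fun i => w i - dot (pos p) w / rad p ^ 2 * pos p i)
    · have e5 : dot (fun i => w i - dot (pos p) w / rad p ^ 2 * pos p i)
          (fun i => w i - dot (pos p) w / rad p ^ 2 * pos p i) =
          dot w w - dot (pos p) w ^ 2 / rad p ^ 2 := by
        have : dot (fun i => w i - dot (pos p) w / rad p ^ 2 * pos p i)
          (fun i => w i - dot (pos p) w / rad p ^ 2 * pos p i) =
          dot w w - 2 * (dot (pos p) w / rad p ^ 2) * dot (pos p) w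
            + (dot (pos p) w / rad p ^ 2) ^ 2 * dot (pos p) (pos p) := by
          simp only [dot]; ring
        rw [this, hpos]
        field_simp
        ring
      rw [← e5]
      exact dot_self_nonneg _
    · have : dot (pos p) (fun i => w i - dot (pos p) w / rad p ^ 2 * pos p i) =
          dot (pos p) w - dot (pos p) w / rad p ^ 2 * dot (pos p) (pos p) := by
        simp only [dot]; ring
      rw [this, hpos]
      field_simp
      ring
  rw [e1, e4, e3, e2]
  refine quadratic_nonneg hA.le (by positivity) (add_nonneg (hproj u) (hproj v))
    (dot_self_nonneg X) ?_ ?_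
  -- The cross term is a sum of two products, each bounded by Cauchy–Schwarz; squaring the sum costs
  -- the factor 2.
  · generalize dot u u - dot (pos p) u ^ 2 / rad p ^ 2 = U at *
    generalize dot v v - dot (pos p) v ^ 2 / rad p ^ 2 = V at *
    have tv' : (η / rad p * dot (crs (pos p) X) v) ^ 2 ≤ dot X X * V := by
      rw [mul_pow, div_pow, hη, one_div_mul_eq_div, div_le_iff₀ (by positivity)]
      linarith
    nlinarith [sq_nonneg (dot X u - η / rad p * dot (crs (pos p) X) v)]
  · rw [mul_pow, div_pow, ← mul_div_assoc, ← mul_div_assoc]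
    refine (div_le_div_of_nonneg_right key (sq_nonneg (rad p))).trans' (le_of_eq ?_) |>.trans
      (le_of_eq ?_) <;> ring

theorem sum_mul_current (N H A B C x G : Fin 4 → ℝ) (c q z k r : ℝ) :
    ∑ i, N i * (H i + c * (A i + 1 / 2 * q * (B i + C i) + 1 / 16 * z * (k * (x i / r))
      - 1 / 4 * (k / r * G i))) =
    (∑ i, N i * H i) + c * ((∑ i, N i * A i)
      + 1 / 2 * q * ((∑ i, N i * B i) + ∑ i, N i * C i)
      + 1 / 16 * z * (k / r) * (∑ i, N i * x i) - 1 / 4 * (k / r) * ∑ i, N i * G i) := by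
  simp only [Fin.sum_univ_four]
  ring

theorem dot_comb (S D u : Fin 3 → ℝ) (ε : ℝ) :
    dot (fun i => 1 / 2 * (S i + ε * D i)) u = 1 / 2 * (dot S u + ε * dot D u) := by
  simp only [dot]; ring

theorem dot_crs_comb (x S D u : Fin 3 → ℝ) (ε : ℝ) :
    dot (crs x (fun i => 1 / 2 * (S i + ε * D i))) u =
      1 / 2 * (dot (crs x S) u + ε * dot (crs x D) u) := by
  simp [dot, crs]; ring

theorem dot_comb_self (S D : Fin 3 → ℝ) (ε : ℝ) :
    dot (fun i => 1 / 2 * (S i + ε * D i)) (fun i => 1 / 2 * (S i + ε * D i)) =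
      1 / 4 * (dot S S + 2 * ε * dot S D + ε ^ 2 * dot D D) := by
  simp only [dot]; ring

theorem dot_neg_left (X u : Fin 3 → ℝ) : dot (fun i => - X i) u = - dot X u := by
  simp only [dot]; ring

theorem dot_neg_neg (X : Fin 3 → ℝ) : dot (fun i => - X i) (fun i => - X i) = dot X X := by
  simp only [dot]; ring

theorem dot_crs_neg (x X u : Fin 3 → ℝ) :
    dot (crs x (fun i => - X i)) u = - dot (crs x X) u := by
  simp [dot, crs]; ring

theorem dot_comm' (u v : Fin 3 → ℝ) : dot u v = dot v u := by
  simp only [dot]; ring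

/-- The density of the modified energy in terms of scalar invariants. -/
theorem density_eq (hM : 0 < M) (hA : ∀ a b, F p a b = - F p b a) (hp : p ∈ exterior M)
    (a b c : ℝ) :
    ∑ i, radialVec p a b i * ((∑ j, superH M o F p i j * xi j) + c * currentP M o F p i) =
      (a * reBeta M o F p 0 + b * (dot (pos p) (tail3 (reBeta M o F p)) / rad p)) *
          reBeta M o F p 0
        + (a * imBeta M o F p 0 + b * (dot (pos p) (tail3 (imBeta M o F p)) / rad p)) *
          imBeta M o F p 0
        - 1 / 2 * ((1 - 2 * M / rad p) * a) *
          (normSq M p (reBeta M o F p) + normSq M p (imBeta M o F p))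
      + c * (morawetz M (rad p) * (((rad p - 2 * M) / rad p) *
          ((a * reBeta M o F p 0 + b * (dot (pos p) (tail3 (reBeta M o F p)) / rad p)) *
            (dot (pos p) (tail3 (reBeta M o F p)) / rad p)
          + (a * imBeta M o F p 0 + b * (dot (pos p) (tail3 (imBeta M o F p)) / rad p)) *
            (dot (pos p) (tail3 (imBeta M o F p)) / rad p))
          + 1 / 2 * b * (normSq M p (reBeta M o F p) + normSq M p (imBeta M o F p)))
        - 1 / 2 * scalarQ M p * (a * dot (fieldS M o F p) (tail3 (reBeta M o F p))
          + b * (rad p / (rad p - 2 * M)) * dot (fieldD M o F p) (tail3 (reBeta M o F p))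
          + ((o : ℤ) : ℝ) / rad p * (a * dot (crs (pos p) (fieldD M o F p)) (tail3 (imBeta M o F p))
            + b * (rad p / (rad p - 2 * M)) *
              dot (crs (pos p) (fieldS M o F p)) (tail3 (imBeta M o F p))))
        + 9 * M ^ 2 * (3 * rad p ^ 2 - 14 * M * rad p + 15 * M ^ 2) / (2 * rad p ^ 6) *
          (1 / 8 * (b * (rad p / (rad p - 2 * M))) *
            (dot (fieldS M o F p) (fieldS M o F p) - dot (fieldD M o F p) (fieldD M o F p))
          + 1 / 4 * (a * dot (fieldS M o F p) (fieldD M o F p)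
            + b * (rad p / (rad p - 2 * M)) * dot (fieldD M o F p) (fieldD M o F p)))) := by
  have hr := rad_pos hM hp
  have h2 : 0 < rad p - 2 * M := sub_pos.2 (show 2 * M < rad p from hp)
  have h3 := h2.ne'
  have exi : xi = radialVec p 1 0 := by
    ext i; fin_cases i <;> simp [xi, radialVec]
  have eA : vecA M p = radialVec p 0 (morawetz M (rad p) * ((rad p - 2 * M) / rad p)) := by
    ext i
    fin_cases i <;> simp [vecA, radialVec, morawetz] <;> field_simp <;> exact Or.inl trivial
  have eq' := pd_scalarQ (M := M) hr
  have hS := dot_fieldS M o F p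
  have hD := dot_fieldD (M := M) hr o F
  have c1 := superH_radial (F := F) o hM hp a b 1 0
  have c2 := superH_radial (F := F) o hM hp a b 0 (morawetz M (rad p) * ((rad p - 2 * M) / rad p))
  have c3 := contract_Z hM hp hS hD (reBeta M o F p) a b
  have c4 := contract_W hM hp (fieldS M o F p) (fieldD M o F p) ((o : ℤ) : ℝ) (imBeta M o F p) a b
  have c5 := square_Z hM hp hS hD
  have c6 := contract_ZZ hM hp hS hD a b
  have c7 : ∑ i, radialVec p a b i * spat p i = b * rad p := by
    rw [sum_radial]
    have : dot (pos p) (tail3 (spat p)) = rad p ^ 2 := by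
      rw [← dot_pos_self]; simp [dot, tail3, pos, spat]
    rw [this, show spat p 0 = 0 from rfl]
    field_simp
    ring
  have zz : twoForm (fieldS M o F p) (fun i => 1 / (rad p - 2 * M) * crs (pos p) (fieldD M o F p) i)
      = fieldZ M o F p := (fieldZ_eq hM hp o hA).symm
  have ww : twoForm (fun i => ((o : ℤ) : ℝ) * (1 / rad p) * crs (pos p) (fieldD M o F p) i)
      (fun i => - ((o : ℤ) : ℝ) * (rad p / (rad p - 2 * M)) * fieldS M o F p i)
      = hodge M o (fieldZ M o F) p := (hodge_fieldZ_eq hM hp o hA).symm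
  rw [zz] at c3 c5 c6
  rw [ww] at c4
  set Q' : ℝ := - (9 * M ^ 2 * (3 * rad p ^ 2 - 14 * M * rad p + 15 * M ^ 2)) / (2 * rad p ^ 6)
    with hQ'
  have expand : ∑ i, radialVec p a b i *
      ((∑ j, superH M o F p i j * xi j) + c * currentP M o F p i) =
      (∑ i, radialVec p a b i * ∑ j, superH M o F p i j * radialVec p 1 0 j)
      + c * ((∑ i, radialVec p a b i * ∑ j, superH M o F p i j *
          radialVec p 0 (morawetz M (rad p) * ((rad p - 2 * M) / rad p)) j)
        + 1 / 2 * scalarQ M p * ((∑ i, radialVec p a b i * ∑ j,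
            (∑ c, invMetric M p j c * reBeta M o F p c) * fieldZ M o F p i j)
          + ∑ i, radialVec p a b i * ∑ j,
            (∑ c, invMetric M p j c * imBeta M o F p c) * hodge M o (fieldZ M o F) p i j)
        + 1 / 16 * (∑ b, ∑ c, ∑ b', ∑ c', invMetric M p b b' * invMetric M p c c' *
            fieldZ M o F p b c * fieldZ M o F p b' c') * (Q' / rad p) *
              (∑ i, radialVec p a b i * spat p i)
        - 1 / 4 * (Q' / rad p) * ∑ i, radialVec p a b i * ∑ j, ∑ c, ∑ j', ∑ c',
            invMetric M p c c' * fieldZ M o F p i c' * fieldZ M o F p j c *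
            (invMetric M p j j' * spat p j')) := by
    have e6 : ∀ i, ∑ j, ∑ c, ∑ j', ∑ c', invMetric M p c c' * fieldZ M o F p i c' *
        fieldZ M o F p j c * (invMetric M p j j' * pd j' (scalarQ M) p) =
        (Q' / rad p) * ∑ j, ∑ c, ∑ j', ∑ c', invMetric M p c c' * fieldZ M o F p i c' *
        fieldZ M o F p j c * (invMetric M p j j' * spat p j') := by
      intro i
      simp only [Finset.mul_sum, eq']
      refine Finset.sum_congr rfl fun j _ => Finset.sum_congr rfl fun c _ =>
        Finset.sum_congr rfl fun j' _ => Finset.sum_congr rfl fun c' _ => by ring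
    simp only [currentP_eq, e6, exi, eA]
    simp only [eq']
    exact sum_mul_current _ _ _ _ _ _ _ _ _ _ _ _
  rw [expand, c1, c2, c3, c4, c5, c6, c7, hQ']
  field_simp
  ring

/-- The lower bound for the density of the modified energy. -/
theorem density_ge (hM : 0 < M) (hF : ContDiffOn ℝ ∞ F (exterior M))
    (hA : ∀ p ∈ exterior M, ∀ a b, F p a b = - F p b a) (hp : p ∈ exterior M) {a b c : ℝ}
    (hab : |b| * (rad p / (rad p - 2 * M)) < a) (hc : |c| ≤ 10 / 9) :
    1 / 4 * (a + b * (rad p / (rad p - 2 * M))) * (1 + c * morawetz M (rad p)) *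
        excess (nullField M o F 1) p
      + 1 / 4 * (a - b * (rad p / (rad p - 2 * M))) * (1 - c * morawetz M (rad p)) *
        excess (nullField M o F (-1)) p ≤
      ∑ i, radialVec p a b i * ((∑ j, superH M o F p i j * xi j) + c * currentP M o F p i) := by
  have hr := rad_pos hM hp
  have h2 : 0 < rad p - 2 * M := sub_pos.2 (show 2 * M < rad p from hp)
  have ho := sign_mul_self o
  have hoo : (((o : ℤ) : ℝ)) ^ 2 = 1 := by rw [sq]; exact ho
  have ho' : (-((o : ℤ) : ℝ)) ^ 2 = 1 := by rw [neg_sq]; exact hoo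
  have hS := dot_fieldS M o F p
  have hD := dot_fieldD (M := M) hr o F
  have b1 : reBeta M o F p 0 = _ := re_beta_zero o hM hF hA hp
  have b2 : imBeta M o F p 0 = _ := im_beta_zero o hM hF hA hp
  have b3 : dot (pos p) (tail3 (reBeta M o F p)) =
      1 / 2 * (rad p ^ 2 / (rad p - 2 * M)) * div3 (fieldD M o F) p := by
    have := dot_re_beta o hM hF hA hp
    rw [Fin.sum_univ_three] at this
    exact this
  have b4 : dot (pos p) (tail3 (imBeta M o F p)) =
      - (1 / 2) * ((o : ℤ) : ℝ) * (rad p / (rad p - 2 * M)) *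
        dot (pos p) (curl3 (fieldS M o F) p) := by
    have := dot_im_beta o hM hF hA hp
    rw [Fin.sum_univ_three] at this
    exact this
  have hα : 0 ≤ 1 / 4 * (a + b * (rad p / (rad p - 2 * M))) := by
    have := neg_abs_le (b * (rad p / (rad p - 2 * M)))
    rw [abs_mul, abs_of_pos (div_pos hr h2)] at this
    linarith
  have hα' : 0 ≤ 1 / 4 * (a - b * (rad p / (rad p - 2 * M))) := by
    have := le_abs_self (b * (rad p / (rad p - 2 * M)))
    rw [abs_mul, abs_of_pos (div_pos hr h2)] at this
    linarith
  have hX : ∀ ε, dot (pos p) (nullField M o F ε p) = 0 := by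
    intro ε
    rw [dot_comm']
    change dot (fun i => 1 / 2 * (fieldS M o F p i + ε * fieldD M o F p i)) (pos p) = 0
    rw [dot_comb, dot_comm', hS, dot_comm' _ (pos p), hD]
    ring
  have x1 := hX 1
  have x2 : dot (pos p) (fun i => - nullField M o F (-1) p i) = 0 := by
    rw [dot_comm', dot_neg_left, dot_comm', hX, neg_zero]
  have k1 := mul_nonneg hα (coercive_part hM hp x1 (tail3 (reBeta M o F p))
    (tail3 (imBeta M o F p)) hoo hc)
  -- The other null component follows by reversing the radial direction: c, the orientation sign and
  -- X all change sign.
  have k2 := mul_nonneg hα' (coercive_part hM hp x2 (tail3 (reBeta M o F p))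
    (tail3 (imBeta M o F p)) ho' (c := -c) (by rwa [abs_neg]))
  have v1 : ∀ ε u, dot (nullField M o F ε p) u = _ := fun ε u => dot_comb _ _ u ε
  have v3 : ∀ ε u, dot (crs (pos p) (nullField M o F ε p)) u = _ :=
    fun ε u => dot_crs_comb _ _ _ u ε
  have v5 : ∀ ε, dot (nullField M o F ε p) (nullField M o F ε p) = _ :=
    fun ε => dot_comb_self _ _ ε
  rw [v5, v1, v3, b3, b4] at k1
  rw [dot_neg_neg, dot_neg_left, dot_crs_neg, v5, v1, v3, b3, b4] at k2
  rw [density_eq o hM (hA p hp) hp]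
  simp only [excess, div3_nullField o hM hF hp, dot_curl3_nullField o hM hF hp, v5, normSq,
    b1, b2, b3, b4]
  clear v1 v3 v5 b1 b2 b3 b4 hα hα' hab hc ho hoo ho' hS hD hX x1 x2
  have hsgn : ((o : ℤ) : ℝ) = 1 ∨ ((o : ℤ) : ℝ) = -1 := by
    rcases Int.units_eq_one_or o with h | h <;> simp [h]
  generalize morawetz M (rad p) = m at k1 k2 ⊢
  generalize scalarQ M p = q at k1 k2 ⊢
  generalize dot (tail3 (reBeta M o F p)) (tail3 (reBeta M o F p)) = uu at k1 k2 ⊢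
  generalize dot (tail3 (imBeta M o F p)) (tail3 (imBeta M o F p)) = vv at k1 k2 ⊢
  generalize dot (fieldS M o F p) (tail3 (reBeta M o F p)) = su at k1 k2 ⊢
  generalize dot (fieldD M o F p) (tail3 (reBeta M o F p)) = du at k1 k2 ⊢
  generalize dot (crs (pos p) (fieldS M o F p)) (tail3 (imBeta M o F p)) = sv at k1 k2 ⊢
  generalize dot (crs (pos p) (fieldD M o F p)) (tail3 (imBeta M o F p)) = dv at k1 k2 ⊢
  generalize dot (fieldS M o F p) (fieldS M o F p) = ss at k1 k2 ⊢
  generalize dot (fieldS M o F p) (fieldD M o F p) = sd at k1 k2 ⊢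
  generalize dot (fieldD M o F p) (fieldD M o F p) = dd at k1 k2 ⊢
  generalize dot (pos p) (curl3 (fieldS M o F) p) = cs at k1 k2 ⊢
  generalize dot (pos p) (curl3 (fieldD M o F) p) = cd at k1 k2 ⊢
  generalize div3 (fieldS M o F) p = ds at k1 k2 ⊢
  generalize div3 (fieldD M o F) p = dvd at k1 k2 ⊢
  generalize ((o : ℤ) : ℝ) = w at hsgn k1 k2 ⊢
  generalize rad p = r at hr h2 k1 k2 ⊢
  have h3 := h2.ne'
  -- The difference of the two sides is exactly the sum of the two coercive parts.
  refine le_of_sub_nonneg (le_of_le_of_eq (add_nonneg k1 k2) ?_)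
  rcases hsgn with rfl | rfl
  · field_simp
    ring
  · field_simp
    ring

end DensityBound

/-! ### The Bochner identity on spheres -/

section Bochner

variable {M : ℝ} {p : Spacetime} {V : Spacetime → Fin 3 → ℝ}

/-- The trace-free symmetric part of a tangential matrix has nonnegative norm. -/
theorem traceless_nonneg (x : Fin 3 → ℝ) (D : Fin 3 → Fin 3 → ℝ) (hx : 0 < dot x x)
    (hE : ∑ i, ∑ j, x i * x j * D i j = 0) :
    0 ≤ (x 0 * (D 1 2 - D 2 1) + x 1 * (D 2 0 - D 0 2) + x 2 * (D 0 1 - D 1 0)) ^ 2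
      - dot x x * (∑ i, D i i) ^ 2 + 2 * dot x x * (∑ i, ∑ j, D i j * D j i)
      - 4 * ∑ j, (∑ a, x a * D j a) * (∑ b, x b * D b j) := by
  -- K is the gradient with its derivative index rotated by x. A is |x|² times twice the trace-free
  -- symmetric part of the tangential projection of K, and its squared norm is the asserted
  -- expression up to the factor 2|x|⁴.
  set K : Fin 3 → Fin 3 → ℝ := fun i j => crs x (fun b => D b j) i with hK
  set A : Fin 3 → Fin 3 → ℝ := fun i j =>
    dot x x * (K i j + K j i) - (∑ a, K i a * x a) * x j - (∑ a, K j a * x a) * x i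
      - (∑ a, K a a) * (dot x x * (if i = j then 1 else 0) - x i * x j) with hA
  have key : 2 * dot x x ^ 2 *
      ((x 0 * (D 1 2 - D 2 1) + x 1 * (D 2 0 - D 0 2) + x 2 * (D 0 1 - D 1 0)) ^ 2
      - dot x x * (∑ i, D i i) ^ 2 + 2 * dot x x * (∑ i, ∑ j, D i j * D j i)
      - 4 * ∑ j, (∑ a, x a * D j a) * (∑ b, x b * D b j)) =
      ∑ i, ∑ j, A i j ^ 2
      - (∑ i, ∑ j, x i * x j * D i j) * (2 * dot x x ^ 2 * (2 * ∑ i, D i i)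
        + 2 * dot x x * ∑ i, ∑ j, x i * x j * D i j) := by
    simp only [hA, hK, dot, crs, Fin.sum_univ_three]
    simp
    ring
  rw [hE, zero_mul, sub_zero] at key
  have h1 : 0 ≤ ∑ i, ∑ j, A i j ^ 2 :=
    Finset.sum_nonneg fun i _ => Finset.sum_nonneg fun j _ => sq_nonneg _
  rw [← key] at h1
  exact nonneg_of_mul_nonneg_right h1 (by positivity)

theorem contDiffOn_pd {f : Spacetime → ℝ} (hf : ContDiffOn ℝ ∞ f (exterior M)) (a : Fin 4) :
    ContDiffOn ℝ ∞ (pd a f) (exterior M) := by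
  have h := hf.fderiv_of_isOpen (isOpen_exterior M) (m := ∞) (by simp)
  exact h.clm_apply contDiffOn_const

theorem SmoothOn.jac (hV : SmoothOn M V) (i : Fin 3) : SmoothOn M (fun y => jac V y i) :=
  fun j => contDiffOn_pd (hV j) i.succ

theorem SmoothOn.div3 (hV : SmoothOn M V) : ContDiffOn ℝ ∞ (div3 V) (exterior M) :=
  ContDiffOn.sum fun i _ => contDiffOn_pd (hV i) i.succ

theorem pd_comm {f : Spacetime → ℝ} (hf : ContDiffOn ℝ ∞ f (exterior M)) (hp : p ∈ exterior M)
    (a b : Fin 4) : pd a (pd b f) p = pd b (pd a f) p := by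
  have hc : ContDiffAt ℝ ∞ f p := hf.contDiffAt (exterior_mem_nhds hp)
  have hs : IsSymmSndFDerivAt ℝ f p := (contDiffAt_infty.1 hc 2).isSymmSndFDerivAt (by simp)
  have hd : DifferentiableAt ℝ (fderiv ℝ f) p :=
    (hc.fderiv_right (m := 1) (by norm_cast)).differentiableAt (by norm_num)
  have e : ∀ a b : Fin 4, pd a (pd b f) p =
      fderiv ℝ (fderiv ℝ f) p (Pi.single a 1) (Pi.single b 1) := by
    intro a b
    change fderiv ℝ (fun y => fderiv ℝ f y (Pi.single b 1)) p (Pi.single a 1) = _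
    rw [fderiv_clm_apply hd (differentiableAt_const _)]
    simp
  rw [e, e]
  exact hs _ _

/-- The generator of the rotations about the `i`-th axis. -/
def rotGen (i : Fin 3) (p : Spacetime) : Spacetime :=
  Fin.cons 0 (crs (Pi.single i 1) (pos p))

theorem fderiv_rotGen {f : Spacetime → ℝ} (i : Fin 3) :
    fderiv ℝ f p (rotGen i p) =
      dot (crs (Pi.single i 1) (pos p)) (fun a => pd a.succ f p) := by
  have : rotGen i p = ∑ a : Fin 3, crs (Pi.single i 1) (pos p) a • Pi.single a.succ (1 : ℝ) := by
    ext b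
    refine Fin.cases ?_ (fun b => ?_) b
    · simp [rotGen]
    · simp only [rotGen, Fin.cons_succ, Finset.sum_apply, Pi.smul_apply, Pi.single_apply,
        Fin.succ_inj, smul_eq_mul, mul_ite, mul_one, mul_zero]
      simp
  rw [this, map_sum]
  simp only [map_smul, smul_eq_mul, dot, Fin.sum_univ_three]
  rfl

/-- The sum of rotational derivatives of `x × W` in terms of the first derivatives of `W`. -/
theorem sum_rotGen_crs {W : Spacetime → Fin 3 → ℝ}
    (hW : ∀ j, DifferentiableAt ℝ (fun y => W y j) p) :
    ∑ i, fderiv ℝ (fun y => crs (pos y) (W y) i) p (rotGen i p) =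
      rad p ^ 2 * div3 W p - 2 * dot (pos p) (W p)
        - ∑ a, ∑ b, pos p a * pos p b * jac W p b a := by
  have e : ∀ i, fderiv ℝ (fun y => crs (pos y) (W y) i) p (rotGen i p) =
      dot (crs (Pi.single i 1) (pos p)) (fun a => jac (fun y => crs (pos y) (W y)) p a i) :=
    fun i => fderiv_rotGen i
  simp only [e, jac_crs hW, ← dot_pos_self]
  change _ = _ * ∑ i, jac W p i i - _ - _
  simp [Fin.sum_univ_three, dot, crs]
  ring

/-- The vector field `V div V - (V · ∇) V`. -/
def bochnerField (V : Spacetime → Fin 3 → ℝ) (y : Spacetime) (k : Fin 3) : ℝ :=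
  V y k * div3 V y - ∑ j, V y j * jac V y j k

theorem SmoothOn.bochnerField (hV : SmoothOn M V) : SmoothOn M (bochnerField V) :=
  fun k => ((hV k).mul hV.div3).sub (ContDiffOn.sum fun j _ => (hV j).mul (hV.jac j k))

theorem jac_bochnerField (hV : SmoothOn M V) (hp : p ∈ exterior M) (b k : Fin 3) :
    jac (bochnerField V) p b k = jac V p b k * div3 V p
      + V p k * (∑ i, pd b.succ (fun y => jac V y i i) p)
      - ∑ j, (jac V p b j * jac V p j k + V p j * pd b.succ (fun y => jac V y j k) p) := by
  have d1 := hV.diff hp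
  have d2 : ∀ j k, DifferentiableAt ℝ (fun y => jac V y j k) p := fun j k => (hV.jac j).diff hp k
  have e1 : pd b.succ (div3 V) p = ∑ i, pd b.succ (fun y => jac V y i i) p := by
    have h : div3 V = fun y => jac V y 0 0 + jac V y 1 1 + jac V y 2 2 := by
      funext y; simp [div3, jac, Fin.sum_univ_three]
    rw [h, pd_add ((d2 0 0).fun_add (d2 1 1)) (d2 2 2), pd_add (d2 0 0) (d2 1 1),
      Fin.sum_univ_three]
  have d3 : DifferentiableAt ℝ (div3 V) p :=
    (hV.div3.contDiffAt (exterior_mem_nhds hp)).differentiableAt (by simp)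
  have d4 : ∀ j k, DifferentiableAt ℝ (fun y => V y j * jac V y j k) p :=
    fun j k => (d1 j).fun_mul (d2 j k)
  have e2 : ∀ j, pd b.succ (fun y => V y j * jac V y j k) p =
      jac V p b j * jac V p j k + V p j * pd b.succ (fun y => jac V y j k) p :=
    fun j => pd_mul (d1 j) (d2 j k) _
  have e3 : (fun y => bochnerField V y k) = fun y => V y k * div3 V y -
      (V y 0 * jac V y 0 k + V y 1 * jac V y 1 k + V y 2 * jac V y 2 k) := by
    funext y; simp [bochnerField, Fin.sum_univ_three]
  change pd b.succ (fun y => bochnerField V y k) p = _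
  rw [e3, pd_sub ((d1 k).fun_mul d3) (((d4 0 k).fun_add (d4 1 k)).fun_add (d4 2 k)),
    pd_add ((d4 0 k).fun_add (d4 1 k)) (d4 2 k), pd_add (d4 0 k) (d4 1 k),
    pd_mul (d1 k) d3, e1, e2, e2, e2, Fin.sum_univ_three, Fin.sum_univ_three]
  rfl

/-- The relation x · V = 0 differentiated twice; it removes the second derivatives of V contracted
with x. -/
theorem Tangential.pd_jac (hT : Tangential M V) (hV : SmoothOn M V) (hp : p ∈ exterior M)
    (b j : Fin 3) :
    ∑ a, pos p a * pd b.succ (fun y => jac V y j a) p = - jac V p b j - jac V p j b := by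
  have d2 : ∀ k, DifferentiableAt ℝ (fun y => jac V y j k) p := fun k => (hV.jac j).diff hp k
  have d0 : ∀ k, DifferentiableAt ℝ (fun y => pos y k) p := fun k => smoothOn_pos.diff hp k
  have e : (fun y : Spacetime => pos y 0 * jac V y j 0 + pos y 1 * jac V y j 1
      + pos y 2 * jac V y j 2) =ᶠ[nhds p] fun y => - V y j := by
    filter_upwards [exterior_mem_nhds hp] with y hy
    have := hT.pd_succ hV hy j
    rwa [Fin.sum_univ_three] at this
  have h := pd_congr e b.succ
  have d3 : ∀ k, DifferentiableAt ℝ (fun y => pos y k * jac V y j k) p :=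
    fun k => (d0 k).fun_mul (d2 k)
  have hpos : ∀ k, pd b.succ (fun y => pos y k) p = if b = k then 1 else 0 := by
    intro k
    simp only [pos_apply, pd_coord, Fin.succ_inj]
  rw [pd_neg, pd_add ((d3 0).fun_add (d3 1)) (d3 2), pd_add (d3 0) (d3 1),
    pd_mul (d0 0) (d2 0), pd_mul (d0 1) (d2 1), pd_mul (d0 2) (d2 2), hpos, hpos, hpos] at h
  change _ = - jac V p b j at h
  rw [Fin.sum_univ_three]
  fin_cases b <;> simp at h ⊢ <;> linarith

/-- The integrated Bochner inequality on the spheres, in pointwise form. -/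
theorem excess_ge (hT : Tangential M V) (hV : SmoothOn M V) (hM : 0 < M) (hp : p ∈ exterior M) :
    2 / rad p ^ 2 *
      ∑ i, fderiv ℝ (fun y => crs (pos y) (bochnerField V y) i) p (rotGen i p) ≤ excess V p := by
  have hr := rad_pos hM hp
  have k := hT p hp
  have kj := hT.pd_succ hV hp
  have kk := hT.pd_jac hV hp
  have hsym : ∀ b j k, pd b.succ (fun y => jac V y j k) p = pd j.succ (fun y => jac V y b k) p :=
    fun b j k => pd_comm (hV k) hp b.succ j.succ
  have hpos := dot_pos_self p
  have hE : ∑ i, ∑ j, pos p i * pos p j * jac V p i j = 0 := by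
    have h0 := kj 0
    have h1 := kj 1
    have h2 := kj 2
    simp only [Fin.sum_univ_three, dot] at *
    linear_combination pos p 0 * h0 + pos p 1 * h1 + pos p 2 * h2 - k
  have htr := traceless_nonneg (pos p) (jac V p) (by rw [hpos]; positivity) hE
  -- Here (x × ∇) · (x × W) is r² times the sphere divergence of the tangential part of W. For the
  -- field V div V - (V · ∇)V all second derivatives of V cancel by their symmetry and by
  -- tangentiality.
  have hsum : ∑ i, fderiv ℝ (fun y => crs (pos y) (bochnerField V y) i) p (rotGen i p) =
      rad p ^ 2 * ((∑ i, jac V p i i) ^ 2 - ∑ i, ∑ j, jac V p i j * jac V p j i)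
        - dot (V p) (V p) - 2 * ∑ j, V p j * ∑ b, pos p b * jac V p b j := by
    rw [sum_rotGen_crs (hV.bochnerField.diff hp)]
    have h1 : div3 (bochnerField V) p =
        (∑ i, jac V p i i) ^ 2 - ∑ i, ∑ j, jac V p i j * jac V p j i := by
      change ∑ i, jac (bochnerField V) p i i = _
      simp only [jac_bochnerField hV hp]
      change ∑ i, (jac V p i i * (∑ i, jac V p i i) + _ - _) = _
      have s01 := hsym 0 1
      have s02 := hsym 0 2
      have s12 := hsym 1 2
      simp only [Fin.sum_univ_three]
      rw [s01 0, s01 1, s02 0, s02 2, s12 1, s12 2]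
      ring
    have h2 : dot (pos p) (bochnerField V p) = dot (V p) (V p) := by
      have h0 := kj 0
      have h1 := kj 1
      have h2 := kj 2
      simp only [bochnerField, Fin.sum_univ_three, dot] at *
      linear_combination div3 V p * k - V p 0 * h0 - V p 1 * h1 - V p 2 * h2
    have h3 : ∑ a, ∑ b, pos p a * pos p b * jac (bochnerField V) p b a =
        2 * (∑ j, V p j * ∑ b, pos p b * jac V p b j) - dot (V p) (V p) := by
      have t : ∀ b, ∑ a, pos p a * jac (bochnerField V) p b a =
          - V p b * div3 V p + ∑ j, (2 * jac V p b j * V p j + V p j * jac V p j b) := by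
        intro b
        have kb := kj b
        have h0 := kj 0
        have h1 := kj 1
        have h2 := kj 2
        have g0 := kk b 0
        have g1 := kk b 1
        have g2 := kk b 2
        simp only [jac_bochnerField hV hp]
        simp only [Fin.sum_univ_three, dot] at *
        linear_combination div3 V p * kb + (pd b.succ (fun y => jac V y 0 0) p
          + pd b.succ (fun y => jac V y 1 1) p + pd b.succ (fun y => jac V y 2 2) p) * k
          - jac V p b 0 * h0 - jac V p b 1 * h1 - jac V p b 2 * h2
          - V p 0 * g0 - V p 1 * g1 - V p 2 * g2
      have t' : ∑ a, ∑ b, pos p a * pos p b * jac (bochnerField V) p b a =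
          ∑ b, pos p b * ∑ a, pos p a * jac (bochnerField V) p b a := by
        simp only [Fin.sum_univ_three]; ring
      rw [t']
      simp only [t]
      have h0 := kj 0
      have h1 := kj 1
      have h2 := kj 2
      simp only [Fin.sum_univ_three, dot] at *
      linear_combination (- div3 V p) * k + V p 0 * h0 + V p 1 * h1 + V p 2 * h2
    rw [h1, h2, h3]
    ring
  rw [hsum]
  have hx : ∑ j, (∑ a, pos p a * jac V p j a) * (∑ b, pos p b * jac V p b j) =
      - ∑ j, V p j * ∑ b, pos p b * jac V p b j := by
    simp only [kj, Fin.sum_univ_three]; ring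
  rw [hx, hpos] at htr
  have hc : dot (pos p) (curl3 V p) = pos p 0 * (jac V p 1 2 - jac V p 2 1)
      + pos p 1 * (jac V p 2 0 - jac V p 0 2) + pos p 2 * (jac V p 0 1 - jac V p 1 0) := by
    simp [dot, curl3]
  rw [← hc] at htr
  change _ ≤ (∑ i, jac V p i i) ^ 2 + _ - _
  generalize (∑ i, jac V p i i) = d at *
  generalize ∑ i, ∑ j, jac V p i j * jac V p j i = T at *
  generalize ∑ j, V p j * ∑ b, pos p b * jac V p b j = Y at *
  have hr2 : 0 < rad p ^ 2 := by positivity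
  rw [← sub_nonneg]
  -- The gap in the inequality is the trace-free expression divided by r².
  refine le_of_le_of_eq (div_nonneg htr hr2.le) ?_
  field_simp
  ring

end Bochner

/-! ### Rotations and their action on spacetime -/

section Rotations

/-- The rotation about the unit vector `n` by the angle `s`. -/
def rotMat (n : Fin 3 → ℝ) (s : ℝ) : Matrix (Fin 3) (Fin 3) ℝ :=
  Matrix.of fun a b => Real.cos s * (if a = b then 1 else 0) + (1 - Real.cos s) * (n a * n b)
    + Real.sin s * crs n (Pi.single b 1) a

/-- Rodrigues' rotation formula. -/
theorem rotMat_mulVec (n v : Fin 3 → ℝ) (s : ℝ) : (rotMat n s).mulVec v =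
    fun a => Real.cos s * v a + (1 - Real.cos s) * (dot n v * n a) + Real.sin s * crs n v a := by
  ext a
  simp only [rotMat, Matrix.mulVec, dotProduct, Fin.sum_univ_three, Matrix.of_apply]
  fin_cases a <;> simp [crs, dot] <;> ring

theorem rotMat_mem {n : Fin 3 → ℝ} (hn : dot n n = 1) (s : ℝ) :
    rotMat n s ∈ Matrix.specialOrthogonalGroup (Fin 3) ℝ := by
  have hs := Real.sin_sq_add_cos_sq s
  rw [Matrix.mem_specialOrthogonalGroup_iff, Matrix.mem_orthogonalGroup_iff]
  simp only [dot] at hn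
  constructor
  · ext a b
    simp only [Matrix.mul_apply, Fin.sum_univ_three]
    fin_cases a <;> fin_cases b <;> simp [rotMat, crs] <;> grind
  · rw [Matrix.det_fin_three]
    simp [rotMat, crs]
    grind

theorem dot_mulVec {R : Matrix (Fin 3) (Fin 3) ℝ}
    (hR : R ∈ Matrix.specialOrthogonalGroup (Fin 3) ℝ) (v w : Fin 3 → ℝ) :
    dot (R.mulVec v) (R.mulVec w) = dot v w := by
  have h : ∀ u v : Fin 3 → ℝ, dot u v = u ⬝ᵥ v := by
    intro u v; simp [dot, dotProduct, Fin.sum_univ_three]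
  have h1 := (Matrix.mem_orthogonalGroup_iff' _ _).1 (Matrix.mem_specialOrthogonalGroup_iff.1 hR).1
  rw [h, h, Matrix.dotProduct_mulVec, ← Matrix.mulVec_transpose, Matrix.mulVec_mulVec, h1,
    Matrix.one_mulVec]

theorem pos_rot4 (R : Matrix (Fin 3) (Fin 3) ℝ) (p : Spacetime) :
    pos (rot4 R p) = R.mulVec (pos p) := by
  have h : Fin.tail p = pos p := by
    ext i; fin_cases i <;> rfl
  ext i
  rw [pos_apply, rot4, Fin.cons_succ, h]

theorem rot4_zero (R : Matrix (Fin 3) (Fin 3) ℝ) (p : Spacetime) : rot4 R p 0 = p 0 := rfl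

theorem spacetime_ext {p q : Spacetime} (h0 : p 0 = q 0) (h : pos p = pos q) : p = q := by
  ext a
  refine Fin.cases h0 (fun i => ?_) a
  rw [← pos_apply p, ← pos_apply q, h]

theorem rad_eq (p : Spacetime) : rad p = √(dot (pos p) (pos p)) := by
  rw [dot_pos_self]
  exact (Real.sqrt_sq (Real.sqrt_nonneg _)).symm

theorem rad_rot4 {R : Matrix (Fin 3) (Fin 3) ℝ}
    (hR : R ∈ Matrix.specialOrthogonalGroup (Fin 3) ℝ) (p : Spacetime) :
    rad (rot4 R p) = rad p := by
  rw [rad_eq, rad_eq, pos_rot4, dot_mulVec hR]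

theorem inner4_eq {M : ℝ} (hM : 0 < M) {p : Spacetime} (hp : p ∈ exterior M) (v w : Spacetime) :
    inner4 M p v w = (1 - 2 * M / rad p) * (v 0 * w 0) - dot (pos v) (pos w)
      - 2 * M / (rad p ^ 2 * (rad p - 2 * M)) * (dot (pos p) (pos v) * dot (pos p) (pos w)) := by
  simp only [inner4, metric_eq hM hp, Fin.sum_univ_four]
  simp [dt, flat, spat, pos, dot]
  ring

theorem rot4_mem_exterior {M : ℝ} {R : Matrix (Fin 3) (Fin 3) ℝ}
    (hR : R ∈ Matrix.specialOrthogonalGroup (Fin 3) ℝ) {p : Spacetime} (hp : p ∈ exterior M) :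
    rot4 R p ∈ exterior M := by
  change 2 * M < rad (rot4 R p)
  rw [rad_rot4 hR]
  exact hp

theorem inner4_rot4 {M : ℝ} (hM : 0 < M) {R : Matrix (Fin 3) (Fin 3) ℝ}
    (hR : R ∈ Matrix.specialOrthogonalGroup (Fin 3) ℝ) {p : Spacetime} (hp : p ∈ exterior M)
    (v w : Spacetime) : inner4 M (rot4 R p) (rot4 R v) (rot4 R w) = inner4 M p v w := by
  rw [inner4_eq hM (rot4_mem_exterior hR hp), inner4_eq hM hp]
  simp only [pos_rot4, rot4_zero, dot_mulVec hR, rad_rot4 hR]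

/-- Rotations of Euclidean space as continuous linear maps. -/
def rotL3 (R : Matrix (Fin 3) (Fin 3) ℝ) : E3 →L[ℝ] E3 :=
  LinearMap.toContinuousLinearMap
    { toFun := rot3 R
      map_add' := fun x y => by simp [rot3, Matrix.mulVec_add]
      map_smul' := fun c x => by simp [rot3, Matrix.mulVec_smul] }

/-- Rotations of spacetime as continuous linear maps. -/
def rotL4 (R : Matrix (Fin 3) (Fin 3) ℝ) : Spacetime →L[ℝ] Spacetime :=
  LinearMap.toContinuousLinearMap
    { toFun := rot4 R
      map_add' := fun x y => by
        refine spacetime_ext rfl ?_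
        have : ∀ u v : Spacetime, pos (u + v) = pos u + pos v := fun u v => by
          ext i; simp [pos_apply]
        rw [this, pos_rot4, pos_rot4, pos_rot4, this, Matrix.mulVec_add]
      map_smul' := fun c x => by
        refine spacetime_ext rfl ?_
        have : ∀ u : Spacetime, pos (c • u) = c • pos u := fun u => by
          ext i; simp [pos_apply]
        rw [pos_rot4, this, Matrix.mulVec_smul, RingHom.id_apply, this, pos_rot4] }

theorem pos_rotGen (i : Fin 3) (p : Spacetime) :
    pos (rotGen i p) = crs (Pi.single i 1) (pos p) := by
  ext j
  rw [pos_apply, rotGen, Fin.cons_succ]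

/-- The curve of rotations of a point of spacetime about the `i`-th axis. -/
theorem hasDerivAt_rot4 (i : Fin 3) (p : Spacetime) (s : ℝ) :
    HasDerivAt (fun s => rot4 (rotMat (Pi.single i 1) s) p)
      (rotGen i (rot4 (rotMat (Pi.single i 1) s) p)) s := by
  rw [hasDerivAt_pi]
  intro a
  have hc := Real.hasDerivAt_cos s
  have hs := Real.hasDerivAt_sin s
  refine Fin.cases ?_ (fun j => ?_) a
  · exact hasDerivAt_const s (p 0)
  · simp only [← pos_apply, pos_rotGen, pos_rot4, rotMat_mulVec]
    have h := ((hc.mul_const (pos p j)).add ((hc.const_sub 1).mul_const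
      (dot (Pi.single i 1) (pos p) * (Pi.single i 1 : Fin 3 → ℝ) j))).add
      (hs.mul_const (crs (Pi.single i 1) (pos p) j))
    refine h.congr_deriv ?_
    fin_cases i <;> fin_cases j <;> simp [crs, dot] <;> ring

theorem hasDerivAt_rot3 (i : Fin 3) (x : E3) :
    HasDerivAt (fun s => rot3 (rotMat (Pi.single i 1) s) x)
      (WithLp.toLp 2 (crs (Pi.single i 1) x.ofLp)) 0 := by
  have h : HasDerivAt (fun s => (rotMat (Pi.single i 1) s).mulVec x.ofLp)
      (crs (Pi.single i 1) x.ofLp) 0 := by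
    rw [hasDerivAt_pi]
    intro j
    have hc := Real.hasDerivAt_cos 0
    have hs := Real.hasDerivAt_sin 0
    simp only [rotMat_mulVec]
    have h := ((hc.mul_const (x.ofLp j)).add ((hc.const_sub 1).mul_const
      (dot (Pi.single i 1) x.ofLp * (Pi.single i 1 : Fin 3 → ℝ) j))).add
      (hs.mul_const (crs (Pi.single i 1) x.ofLp j))
    refine h.congr_deriv ?_
    simp
  exact (PiLp.continuousLinearEquiv 2 ℝ
    (fun _ : Fin 3 => ℝ)).symm.toContinuousLinearMap.hasFDerivAt.comp_hasDerivAt 0 h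

theorem rotMat_zero (n : Fin 3 → ℝ) (v : Fin 3 → ℝ) : (rotMat n 0).mulVec v = v := by
  rw [rotMat_mulVec]; simp

theorem rotMat_two_pi (n : Fin 3 → ℝ) (v : Fin 3 → ℝ) :
    (rotMat n (2 * Real.pi)).mulVec v = v := by
  rw [rotMat_mulVec]; simp

theorem rotMat_pi (n : Fin 3 → ℝ) (v : Fin 3 → ℝ) :
    (rotMat n Real.pi).mulVec v = fun a => 2 * (dot n v * n a) - v a := by
  rw [rotMat_mulVec]; ext a; simp; ring

theorem dot_single_self (i : Fin 3) :
    dot (Pi.single i 1 : Fin 3 → ℝ) (Pi.single i 1 : Fin 3 → ℝ) = 1 := by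
  fin_cases i <;> simp [dot]

end Rotations

/-! ### Geometry of spherically symmetric slices -/

namespace SphericalSlice

section Geometry

variable {M : ℝ} (S : SphericalSlice M) {x : E3}

theorem emb_mem (hx : x ∈ S.dom) : S.emb x ∈ exterior M := S.mapsTo hx

theorem differentiableAt_emb (hx : x ∈ S.dom) : DifferentiableAt ℝ S.emb x :=
  (S.smooth.contDiffAt (S.isOpen_dom.mem_nhds hx)).differentiableAt (by simp)

theorem fderiv_emb_rot {R : Matrix (Fin 3) (Fin 3) ℝ}
    (hR : R ∈ Matrix.specialOrthogonalGroup (Fin 3) ℝ) (hx : x ∈ S.dom) (v : E3) :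
    fderiv ℝ S.emb (rot3 R x) (rot3 R v) = rot4 R (fderiv ℝ S.emb x v) := by
  have e : (fun y => S.emb (rotL3 R y)) =ᶠ[nhds x] fun y => rotL4 R (S.emb y) := by
    filter_upwards [S.isOpen_dom.mem_nhds hx] with y hy
    exact S.equivariant R hR y hy
  have h1 : HasFDerivAt (fun y => S.emb (rotL3 R y))
      ((fderiv ℝ S.emb (rot3 R x)).comp (rotL3 R)) x :=
    (S.differentiableAt_emb (S.rot_mem R hR x hx)).hasFDerivAt.comp x (rotL3 R).hasFDerivAt
  have h2 : HasFDerivAt (fun y => rotL4 R (S.emb y))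
      ((rotL4 R).comp (fderiv ℝ S.emb x)) x :=
    (rotL4 R).hasFDerivAt.comp x (S.differentiableAt_emb hx).hasFDerivAt
  have h3 := (h1.congr_of_eventuallyEq e.symm).unique h2
  exact congrArg (fun L => L v) h3

/-- A vector fixed by a half-turn lies on its axis. Combined with equivariance this detects radial
vectors using a single rotation. -/
theorem eq_of_rotMat_pi {n v : Fin 3 → ℝ} (h : (rotMat n Real.pi).mulVec v = v) :
    v = fun a => dot n v * n a := by
  rw [rotMat_pi] at h
  ext a
  have := congrFun h a
  linarith

/-- The image of the origin would be fixed by half-turns about two different axes, hence have r = 0.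
-/
theorem zero_notMem (hM : 0 < M) : (0 : E3) ∉ S.dom := by
  intro h0
  have hfix : ∀ n, dot n n = 1 → pos (S.emb 0) = fun a => dot n (pos (S.emb 0)) * n a := by
    intro n hn
    have hR := rotMat_mem hn Real.pi
    have h1 := S.equivariant _ hR 0 h0
    have h2 : rot3 (rotMat n Real.pi) (0 : E3) = 0 := (rotL3 _).map_zero
    rw [h2] at h1
    apply eq_of_rotMat_pi
    rw [← pos_rot4, ← h1]
  have e0 := hfix _ (dot_single_self 0)
  have e1 := hfix _ (dot_single_self 1)
  have hz : pos (S.emb 0) = 0 := by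
    ext a
    fin_cases a
    · have := congrFun e1 0
      simpa using this
    · have := congrFun e0 1
      simpa using this
    · have := congrFun e0 2
      simpa using this
  have hr := rad_pos hM (S.emb_mem h0)
  rw [rad_eq, hz] at hr
  simp [dot] at hr

/-- The unit vector in the direction of `x`. -/
def dir (x : E3) : Fin 3 → ℝ := fun a => ‖x‖⁻¹ * x a

theorem norm_sq_eq_dot (x : E3) : ‖x‖ ^ 2 = dot x.ofLp x.ofLp := by
  rw [EuclideanSpace.norm_sq_eq, Fin.sum_univ_three]
  simp only [dot, Real.norm_eq_abs, sq_abs]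
  ring

theorem dot_dir (hx : x ≠ 0) : dot (dir x) (dir x) = 1 := by
  have h := norm_sq_eq_dot x
  have h0 : ‖x‖ ≠ 0 := norm_ne_zero_iff.2 hx
  simp only [dot, dir] at *
  field_simp
  linarith

theorem rot3_dir_pi (hx : x ≠ 0) : rot3 (rotMat (dir x) Real.pi) x = x := by
  have h := norm_sq_eq_dot x
  have h0 : ‖x‖ ≠ 0 := norm_ne_zero_iff.2 hx
  have e : dot (dir x) x.ofLp = ‖x‖ := by
    have : dot (dir x) x.ofLp = ‖x‖⁻¹ * dot x.ofLp x.ofLp := by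
      simp only [dot, dir]; ring
    rw [this, ← h]
    field_simp
  ext a
  simp only [rot3, rotMat_pi, e, dir]
  field_simp
  ring

/-- The half-turn about the line through x fixes x, hence also its image. -/
theorem pos_emb (hM : 0 < M) (hx : x ∈ S.dom) :
    pos (S.emb x) = fun a => dot (dir x) (pos (S.emb x)) * dir x a := by
  have h0 : x ≠ 0 := fun h => S.zero_notMem hM (h ▸ hx)
  have h1 := S.equivariant _ (rotMat_mem (dot_dir h0) Real.pi) x hx
  rw [rot3_dir_pi h0] at h1
  apply eq_of_rotMat_pi
  rw [← pos_rot4, ← h1]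

/-- The radial tangent vector of the slice. -/
def radialTangent (x : E3) : Spacetime := fderiv ℝ S.emb x x

theorem pos_radialTangent (hM : 0 < M) (hx : x ∈ S.dom) :
    pos (S.radialTangent x) = fun a => dot (dir x) (pos (S.radialTangent x)) * dir x a := by
  have h0 : x ≠ 0 := fun h => S.zero_notMem hM (h ▸ hx)
  have h1 := S.fderiv_emb_rot (rotMat_mem (dot_dir h0) Real.pi) hx x
  rw [rot3_dir_pi h0] at h1
  apply eq_of_rotMat_pi
  rw [← pos_rot4]
  exact congrArg pos h1.symm

/-- The radial component of the radial tangent vector. -/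
def radialSpeed (x : E3) : ℝ :=
  dot (pos (S.radialTangent x)) (pos (S.emb x)) / rad (S.emb x)

theorem eq_radialVec {p v : Spacetime} (hr : 0 < rad p) {c : ℝ}
    (h : pos v = fun a => c * pos p a) :
    v = radialVec p (v 0) (dot (pos v) (pos p) / rad p) := by
  have e : dot (pos v) (pos p) = c * rad p ^ 2 := by
    rw [h, ← dot_pos_self]; simp only [dot]; ring
  refine spacetime_ext rfl ?_
  rw [e, h]
  ext a
  fin_cases a <;> simp [pos, radialVec] <;> field_simp

theorem radialTangent_eq (hM : 0 < M) (hx : x ∈ S.dom) :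
    S.radialTangent x = radialVec (S.emb x) (S.radialTangent x 0) (S.radialSpeed x) := by
  have hr := rad_pos hM (S.emb_mem hx)
  have h1 := S.pos_emb hM hx
  have h2 := S.pos_radialTangent hM hx
  set l := dot (dir x) (pos (S.emb x)) with hl
  have hl0 : l ≠ 0 := by
    intro h
    rw [rad_eq, h1, h] at hr
    simp [dot] at hr
  refine eq_radialVec hr (c := dot (dir x) (pos (S.radialTangent x)) / l) ?_
  rw [h1]
  refine h2.trans ?_
  ext a
  field_simp

theorem fderiv_emb_gen (hx : x ∈ S.dom) (i : Fin 3) :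
    fderiv ℝ S.emb x (WithLp.toLp 2 (crs (Pi.single i 1) x.ofLp)) = rotGen i (S.emb x) := by
  have hz : rot3 (rotMat (Pi.single i 1) 0) x = x := by
    ext a; simp [rot3, rotMat_zero]
  have h1 : HasDerivAt (fun s => S.emb (rot3 (rotMat (Pi.single i 1) s) x)) _ 0 :=
    HasFDerivAt.comp_hasDerivAt 0 (by rw [hz]; exact (S.differentiableAt_emb hx).hasFDerivAt)
      (hasDerivAt_rot3 i x)
  have h2 := hasDerivAt_rot4 i (S.emb x) 0
  have e : (fun s => S.emb (rot3 (rotMat (Pi.single i 1) s) x)) =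
      fun s => rot4 (rotMat (Pi.single i 1) s) (S.emb x) := by
    funext s
    exact S.equivariant _ (rotMat_mem (dot_single_self i) s) x hx
  have hz' : rot4 (rotMat (Pi.single i 1) 0) (S.emb x) = S.emb x := by
    refine spacetime_ext rfl ?_
    rw [pos_rot4, rotMat_zero]
  rw [e] at h1
  rw [hz'] at h2
  exact h1.unique h2

variable {N : E3 → Spacetime}

/-- The radial component of the normal. -/
def normalSpeed (S : SphericalSlice M) (N : E3 → Spacetime) (x : E3) : ℝ :=
  dot (pos (N x)) (pos (S.emb x)) / rad (S.emb x)

/-- The slice contains the rotation orbits, so the normal is orthogonal to all rotation generators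
and has no angular part. -/
theorem normal_eq (hM : 0 < M) (hN : S.IsUnitNormal N) (hx : x ∈ S.dom) :
    N x = radialVec (S.emb x) (N x 0) (S.normalSpeed N x) := by
  have hp := S.emb_mem hx
  have hr := rad_pos hM hp
  have h : ∀ i, dot (pos (N x)) (crs (Pi.single i 1) (pos (S.emb x))) = 0 := by
    intro i
    have h1 := hN.orthogonal x hx (WithLp.toLp 2 (crs (Pi.single i 1) x.ofLp))
    rw [S.fderiv_emb_gen hx, inner4_eq hM hp, pos_rotGen] at h1
    have h2 : dot (pos (S.emb x)) (crs (Pi.single i 1) (pos (S.emb x))) = 0 := by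
      simp [dot, crs]; ring
    rw [h2] at h1
    simp [rotGen] at h1
    exact h1
  have hs := dot_pos_self (S.emb x)
  have h0 := h 0
  have h1 := h 1
  have h2 := h 2
  refine eq_radialVec hr (c := dot (pos (N x)) (pos (S.emb x)) / rad (S.emb x) ^ 2) ?_
  ext a
  rw [div_mul_eq_mul_div, eq_div_iff (by positivity), ← hs]
  generalize pos (N x) = u at *
  generalize pos (S.emb x) = y at *
  fin_cases a <;> simp [dot, crs] at h0 h1 h2 ⊢
  · linear_combination y 2 * h1 - y 1 * h2
  · linear_combination y 0 * h2 - y 2 * h0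
  · linear_combination y 1 * h0 - y 0 * h1

theorem inner4_radial (hM : 0 < M) {p : Spacetime} (hp : p ∈ exterior M) (a b a' b' : ℝ) :
    inner4 M p (radialVec p a b) (radialVec p a' b') =
      (1 - 2 * M / rad p) * (a * a') - rad p / (rad p - 2 * M) * (b * b') :=
  metric_radial hM hp a b a' b'

/-- The slope of the slice. -/
def slope (x : E3) : ℝ := S.radialTangent x 0 / S.radialSpeed x

/-- Otherwise the radial tangent would be a multiple of ∂_t, which is not spacelike. -/
theorem radialSpeed_ne_zero (hM : 0 < M) (hx : x ∈ S.dom) : S.radialSpeed x ≠ 0 := by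
  have hp := S.emb_mem hx
  have hr := rad_pos hM hp
  have h0 : x ≠ 0 := fun h => S.zero_notMem hM (h ▸ hx)
  have h := S.spacelike x hx x h0
  change inner4 M (S.emb x) (S.radialTangent x) (S.radialTangent x) < 0 at h
  rw [S.radialTangent_eq hM hx, inner4_radial hM hp] at h
  intro h1
  rw [h1] at h
  have h2 : 0 < 1 - 2 * M / rad (S.emb x) := by
    rw [sub_pos, div_lt_one hr]; exact hp
  have := mul_nonneg h2.le (mul_self_nonneg (S.radialTangent x 0))
  linarith

/-- Orthogonality to the radial tangent fixes the ratio of the two components, normalisation and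
time orientation the rest. The normal is only given pointwise; these formulas yield its continuity
and rotation invariance, while the second conjunct makes both null weights positive. -/
theorem normal_formula (hM : 0 < M) (hN : S.IsUnitNormal N) (hx : x ∈ S.dom) :
    0 < N x 0 ∧
    |S.normalSpeed N x| * (rad (S.emb x) / (rad (S.emb x) - 2 * M)) < N x 0 ∧
    0 < (1 - 2 * M / rad (S.emb x)) - (1 - 2 * M / rad (S.emb x)) ^ 3 * S.slope x ^ 2 ∧
    N x 0 = 1 / √((1 - 2 * M / rad (S.emb x)) - (1 - 2 * M / rad (S.emb x)) ^ 3 * S.slope x ^ 2) ∧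
    S.normalSpeed N x = (1 - 2 * M / rad (S.emb x)) ^ 2 * S.slope x * N x 0 := by
  have hp := S.emb_mem hx
  have hr := rad_pos hM hp
  have h2 : 0 < rad (S.emb x) - 2 * M := sub_pos.2 (show 2 * M < rad (S.emb x) from hp)
  have hf : 0 < 1 - 2 * M / rad (S.emb x) := by
    rw [sub_pos, div_lt_one hr]; exact hp
  have hg : rad (S.emb x) / (rad (S.emb x) - 2 * M) = 1 / (1 - 2 * M / rad (S.emb x)) := by
    have := hf.ne'
    have := h2.ne'
    field_simp
  have u := hN.unit x hx
  have fu := hN.future x hx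
  have og := hN.orthogonal x hx x
  change inner4 M (S.emb x) (N x) (S.radialTangent x) = 0 at og
  have exi : xi = radialVec (S.emb x) 1 0 := by
    ext i; fin_cases i <;> simp [xi, radialVec]
  rw [S.normal_eq hM hN hx, inner4_radial hM hp, hg] at u
  rw [S.normal_eq hM hN hx, exi, inner4_radial hM hp] at fu
  rw [S.normal_eq hM hN hx, S.radialTangent_eq hM hx, inner4_radial hM hp, hg] at og
  have hρ := S.radialSpeed_ne_zero hM hx
  rw [hg]
  have hs : S.radialTangent x 0 = S.slope x * S.radialSpeed x := by
    unfold slope; field_simp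
  rw [hs] at og
  generalize 1 - 2 * M / rad (S.emb x) = f at *
  generalize N x 0 = a at *
  generalize S.normalSpeed N x = b at *
  generalize S.slope x = k at *
  generalize S.radialSpeed x = ρ at *
  have ha : 0 < a := by
    simp at fu
    exact (mul_pos_iff_of_pos_left hf).1 fu
  have hb : b = f ^ 2 * k * a := by
    have h3 : ρ * (f ^ 2 * k * a - b) = 0 := by
      field_simp at og
      linarith
    rcases mul_eq_zero.1 h3 with h | h
    · exact absurd h hρ
    · linarith
  have hu : a ^ 2 * (f - f ^ 3 * k ^ 2) = 1 := by
    rw [hb] at u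
    field_simp at u
    linarith
  have hpos : 0 < f - f ^ 3 * k ^ 2 := by
    by_contra h
    have := mul_nonpos_of_nonneg_of_nonpos (sq_nonneg a) (not_lt.1 h)
    linarith
  refine ⟨ha, ?_, hpos, ?_, hb⟩
  · refine lt_of_pow_lt_pow_left₀ 2 ha.le ?_
    rw [mul_pow, sq_abs, div_pow, one_pow, mul_one_div, div_lt_iff₀ (by positivity)]
    field_simp at u
    linarith
  · rw [eq_div_iff (Real.sqrt_pos.2 hpos).ne']
    have h5 : (a * √(f - f ^ 3 * k ^ 2)) ^ 2 = 1 ^ 2 := by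
      rw [mul_pow, Real.sq_sqrt hpos.le, hu]; norm_num
    exact (sq_eq_sq₀ (by positivity) zero_le_one).1 h5

end Geometry

end SphericalSlice

/-! ### Rotation invariance of Lebesgue measure -/

section RotationMeasure

theorem norm_rot3 {R : Matrix (Fin 3) (Fin 3) ℝ}
    (hR : R ∈ Matrix.specialOrthogonalGroup (Fin 3) ℝ) (x : E3) : ‖rot3 R x‖ = ‖x‖ := by
  have h : ‖rot3 R x‖ ^ 2 = ‖x‖ ^ 2 := by
    rw [SphericalSlice.norm_sq_eq_dot, SphericalSlice.norm_sq_eq_dot]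
    exact dot_mulVec hR _ _
  exact (sq_eq_sq₀ (norm_nonneg _) (norm_nonneg _)).1 h

/-- Rotations of Euclidean space as linear isometries. -/
def rotIso {R : Matrix (Fin 3) (Fin 3) ℝ}
    (hR : R ∈ Matrix.specialOrthogonalGroup (Fin 3) ℝ) : E3 ≃ₗᵢ[ℝ] E3 :=
  LinearIsometry.toLinearIsometryEquiv
    { toLinearMap := (rotL3 R : E3 →ₗ[ℝ] E3), norm_map' := norm_rot3 hR } rfl

theorem transpose_mem {R : Matrix (Fin 3) (Fin 3) ℝ}
    (hR : R ∈ Matrix.specialOrthogonalGroup (Fin 3) ℝ) :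
    R.transpose ∈ Matrix.specialOrthogonalGroup (Fin 3) ℝ := by
  rw [Matrix.mem_specialOrthogonalGroup_iff, Matrix.mem_orthogonalGroup_iff] at *
  refine ⟨?_, by rw [Matrix.det_transpose]; exact hR.2⟩
  have h1 : R.transpose * R = 1 := mul_eq_one_comm.1 hR.1
  simpa using h1

theorem rot3_rot3_transpose {R : Matrix (Fin 3) (Fin 3) ℝ}
    (hR : R ∈ Matrix.specialOrthogonalGroup (Fin 3) ℝ) (x : E3) :
    rot3 R (rot3 R.transpose x) = x := by
  have h : R * R.transpose = 1 :=
    (Matrix.mem_orthogonalGroup_iff _ _).1 (Matrix.mem_specialOrthogonalGroup_iff.1 hR).1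
  simp [rot3, Matrix.mulVec_mulVec, h]

theorem rot3_transpose_rot3 {R : Matrix (Fin 3) (Fin 3) ℝ}
    (hR : R ∈ Matrix.specialOrthogonalGroup (Fin 3) ℝ) (x : E3) :
    rot3 R.transpose (rot3 R x) = x := by
  simpa using rot3_rot3_transpose (transpose_mem hR) x

theorem setIntegral_rot3 {R : Matrix (Fin 3) (Fin 3) ℝ}
    (hR : R ∈ Matrix.specialOrthogonalGroup (Fin 3) ℝ) {K : Set E3}
    (hK : ∀ R ∈ Matrix.specialOrthogonalGroup (Fin 3) ℝ, ∀ x ∈ K, rot3 R x ∈ K) (G : E3 → ℝ) :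
    ∫ x in K, G (rot3 R x) = ∫ x in K, G x := by
  have hpre : rotIso hR ⁻¹' K = K := by
    ext x
    refine ⟨fun h => ?_, fun h => hK R hR x h⟩
    have := hK _ (transpose_mem hR) _ (show rot3 R x ∈ K from h)
    rwa [rot3_transpose_rot3 hR] at this
  have h := (rotIso hR).measurePreserving.setIntegral_preimage_emb
    (rotIso hR).toHomeomorph.measurableEmbedding G K
  rw [hpre] at h
  exact h

theorem continuous_rot3_rotMat (n : Fin 3 → ℝ) :
    Continuous fun q : E3 × ℝ => rot3 (rotMat n q.2) q.1 := by
  simp only [rot3, rotMat_mulVec]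
  refine (PiLp.continuous_toLp 2 (fun _ : Fin 3 => ℝ)).comp (continuous_pi fun a => ?_)
  have h1 : ∀ b, Continuous fun q : E3 × ℝ => q.1.ofLp b := fun b => by fun_prop
  have h2 : Continuous fun q : E3 × ℝ => crs n q.1.ofLp a := by
    fin_cases a <;> simp [crs] <;> fun_prop
  have h3 : Continuous fun q : E3 × ℝ => dot n q.1.ofLp := by
    simp only [dot]; fun_prop
  have h4 := h1 a
  fun_prop

end RotationMeasure

/-! ### Rotation invariant functions on a slice -/

namespace SphericalSlice

section RadialFunctions

variable {M : ℝ} (S : SphericalSlice M) {x : E3}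

/-- Continuous rotation invariant functions on the domain of a slice. -/
def IsRadial (g : E3 → ℝ) : Prop :=
  ContinuousOn g S.dom ∧
    ∀ R ∈ Matrix.specialOrthogonalGroup (Fin 3) ℝ, ∀ x ∈ S.dom, g (rot3 R x) = g x

variable {S} {g g' : E3 → ℝ}

theorem IsRadial.congr (h : S.IsRadial g) (e : ∀ x ∈ S.dom, g' x = g x) : S.IsRadial g' :=
  ⟨h.1.congr e, fun R hR x hx => by rw [e x hx, e _ (S.rot_mem R hR x hx), h.2 R hR x hx]⟩

theorem isRadial_const (c : ℝ) : S.IsRadial fun _ => c :=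
  ⟨continuousOn_const, fun _ _ _ _ => rfl⟩

theorem IsRadial.add (h : S.IsRadial g) (h' : S.IsRadial g') : S.IsRadial fun x => g x + g' x :=
  ⟨h.1.add h'.1, fun R hR x hx => by beta_reduce; rw [h.2 R hR x hx, h'.2 R hR x hx]⟩

theorem IsRadial.sub (h : S.IsRadial g) (h' : S.IsRadial g') : S.IsRadial fun x => g x - g' x :=
  ⟨h.1.sub h'.1, fun R hR x hx => by beta_reduce; rw [h.2 R hR x hx, h'.2 R hR x hx]⟩

theorem IsRadial.mul (h : S.IsRadial g) (h' : S.IsRadial g') : S.IsRadial fun x => g x * g' x :=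
  ⟨h.1.mul h'.1, fun R hR x hx => by beta_reduce; rw [h.2 R hR x hx, h'.2 R hR x hx]⟩

theorem IsRadial.div (h : S.IsRadial g) (h' : S.IsRadial g') (h0 : ∀ x ∈ S.dom, g' x ≠ 0) :
    S.IsRadial fun x => g x / g' x :=
  ⟨h.1.div h'.1 h0, fun R hR x hx => by beta_reduce; rw [h.2 R hR x hx, h'.2 R hR x hx]⟩

theorem IsRadial.sqrt (h : S.IsRadial g) : S.IsRadial fun x => √(g x) :=
  ⟨h.1.sqrt, fun R hR x hx => by beta_reduce; rw [h.2 R hR x hx]⟩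

theorem IsRadial.pow (h : S.IsRadial g) (n : ℕ) : S.IsRadial fun x => g x ^ n :=
  ⟨h.1.pow n, fun R hR x hx => by beta_reduce; rw [h.2 R hR x hx]⟩

theorem continuous_rad : Continuous rad := by unfold rad; fun_prop

theorem continuous_pos : Continuous pos :=
  continuous_pi fun i => by simp only [pos_apply]; fun_prop

theorem _root_.ContinuousOn.dot3 {X : Type*} [TopologicalSpace X] {s : Set X}
    {u v : X → Fin 3 → ℝ} (hu : ContinuousOn u s) (hv : ContinuousOn v s) :
    ContinuousOn (fun x => dot (u x) (v x)) s := by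
  have hu' := fun i => continuousOn_pi.1 hu i
  have hv' := fun i => continuousOn_pi.1 hv i
  exact (((hu' 0).mul (hv' 0)).add ((hu' 1).mul (hv' 1))).add ((hu' 2).mul (hv' 2))

variable (S)

theorem continuousOn_emb : ContinuousOn S.emb S.dom := S.smooth.continuousOn

theorem continuousOn_fderiv_emb : ContinuousOn (fderiv ℝ S.emb) S.dom :=
  S.smooth.continuousOn_fderiv_of_isOpen S.isOpen_dom (by simp)

theorem isRadial_rad : S.IsRadial fun x => rad (S.emb x) :=
  ⟨continuous_rad.comp_continuousOn S.continuousOn_emb, fun R hR x hx => by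
    beta_reduce
    rw [S.equivariant R hR x hx, rad_rot4 hR]⟩

theorem continuousOn_radialTangent : ContinuousOn S.radialTangent S.dom :=
  S.continuousOn_fderiv_emb.clm_apply continuousOn_id

theorem radialTangent_rot {R : Matrix (Fin 3) (Fin 3) ℝ}
    (hR : R ∈ Matrix.specialOrthogonalGroup (Fin 3) ℝ) (hx : x ∈ S.dom) :
    S.radialTangent (rot3 R x) = rot4 R (S.radialTangent x) :=
  S.fderiv_emb_rot hR hx x

theorem isRadial_radialTangent_zero : S.IsRadial fun x => S.radialTangent x 0 :=
  ⟨continuousOn_pi.1 S.continuousOn_radialTangent 0, fun R hR x hx => by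
    beta_reduce
    rw [S.radialTangent_rot hR hx, rot4_zero]⟩

theorem isRadial_radialSpeed (hM : 0 < M) : S.IsRadial S.radialSpeed := by
  refine IsRadial.div ⟨?_, fun R hR x hx => ?_⟩ S.isRadial_rad
    fun x hx => (rad_pos hM (S.emb_mem hx)).ne'
  · exact (continuous_pos.comp_continuousOn S.continuousOn_radialTangent).dot3
      (continuous_pos.comp_continuousOn S.continuousOn_emb)
  · beta_reduce
    rw [S.radialTangent_rot hR hx, S.equivariant R hR x hx, pos_rot4, pos_rot4, dot_mulVec hR]

theorem isRadial_slope (hM : 0 < M) : S.IsRadial S.slope :=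
  S.isRadial_radialTangent_zero.div (S.isRadial_radialSpeed hM)
    fun _ hx => S.radialSpeed_ne_zero hM hx

theorem isRadial_lapse (hM : 0 < M) : S.IsRadial fun x => 1 - 2 * M / rad (S.emb x) :=
  (isRadial_const 1).sub ((isRadial_const (2 * M)).div S.isRadial_rad
    fun _ hx => (rad_pos hM (S.emb_mem hx)).ne')

theorem isRadial_normal_zero (hM : 0 < M) {N : E3 → Spacetime} (hN : S.IsUnitNormal N) :
    S.IsRadial fun x => N x 0 := by
  refine IsRadial.congr ((isRadial_const 1).div ((S.isRadial_lapse hM).sub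
    (((S.isRadial_lapse hM).pow 3).mul ((S.isRadial_slope hM).pow 2))).sqrt fun x hx => ?_)
    fun x hx => (S.normal_formula hM hN hx).2.2.2.1
  exact (Real.sqrt_pos.2 (S.normal_formula hM hN hx).2.2.1).ne'

theorem isRadial_normalSpeed (hM : 0 < M) {N : E3 → Spacetime} (hN : S.IsUnitNormal N) :
    S.IsRadial (S.normalSpeed N) :=
  IsRadial.congr ((((S.isRadial_lapse hM).pow 2).mul (S.isRadial_slope hM)).mul
    (S.isRadial_normal_zero hM hN)) fun _ hx => (S.normal_formula hM hN hx).2.2.2.2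

theorem isRadial_det_induced (hM : 0 < M) : S.IsRadial fun x => (S.induced x).det := by
  constructor
  · have h : ∀ i j, ContinuousOn (fun x => S.induced x i j) S.dom := by
      intro i j
      have h1 : ∀ v : E3, ContinuousOn (fun x => fderiv ℝ S.emb x v) S.dom :=
        fun v => S.continuousOn_fderiv_emb.clm_apply continuousOn_const
      set v : E3 := EuclideanSpace.single i 1
      set w : E3 := EuclideanSpace.single j 1
      have h2 : ∀ v : E3, ContinuousOn (fun x => fderiv ℝ S.emb x v 0) S.dom :=
        fun v => continuousOn_pi.1 (h1 v) 0
      have h3 : ∀ v : E3, ContinuousOn (fun x => pos (fderiv ℝ S.emb x v)) S.dom :=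
        fun v => continuous_pos.comp_continuousOn (h1 v)
      have h4 : ContinuousOn (fun x => pos (S.emb x)) S.dom :=
        continuous_pos.comp_continuousOn S.continuousOn_emb
      have h5 := S.isRadial_rad.1
      refine ContinuousOn.congr (f := fun x => - ((1 - 2 * M / rad (S.emb x)) *
        (fderiv ℝ S.emb x v 0 * fderiv ℝ S.emb x w 0)
        - dot (pos (fderiv ℝ S.emb x v)) (pos (fderiv ℝ S.emb x w))
        - 2 * M / (rad (S.emb x) ^ 2 * (rad (S.emb x) - 2 * M)) *
          (dot (pos (S.emb x)) (pos (fderiv ℝ S.emb x v)) *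
            dot (pos (S.emb x)) (pos (fderiv ℝ S.emb x w))))) ?_ ?_
      · refine (((((S.isRadial_lapse hM).1.mul ((h2 v).mul (h2 w))).sub
          ((h3 v).dot3 (h3 w))).sub (ContinuousOn.mul (continuousOn_const.div
          ((h5.pow 2).mul (h5.sub continuousOn_const)) ?_)
          ((h4.dot3 (h3 v)).mul (h4.dot3 (h3 w)))))).neg
        intro x hx
        have hp := S.emb_mem hx
        have hr := rad_pos hM hp
        have h2 : 0 < rad (S.emb x) - 2 * M := sub_pos.2 (show 2 * M < rad (S.emb x) from hp)
        exact (mul_pos (pow_pos hr 2) h2).ne'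
      · intro x hx
        change - inner4 M (S.emb x) (fderiv ℝ S.emb x v) (fderiv ℝ S.emb x w) = _
        rw [inner4_eq hM (S.emb_mem hx)]
    simp only [Matrix.det_fin_three]
    have := h
    fun_prop
  · intro R hR x hx
    -- The metric at the rotated point is the conjugated matrix, so the determinant is unchanged.
    have key : S.induced (rot3 R x) = R * S.induced x * R.transpose := by
      have e : ∀ i : Fin 3, rot3 R (∑ k, R i k • EuclideanSpace.single k (1 : ℝ)) =
          EuclideanSpace.single i 1 := by
        intro i
        have h1 : (∑ k, R i k • EuclideanSpace.single k (1 : ℝ) : E3) =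
            rot3 R.transpose (EuclideanSpace.single i 1) := by
          ext a
          simp [rot3, Fin.sum_univ_three]
          fin_cases a <;> simp
        rw [h1, rot3_rot3_transpose hR]
      ext i j
      change - inner4 M (S.emb (rot3 R x)) (fderiv ℝ S.emb (rot3 R x) (EuclideanSpace.single i 1))
        (fderiv ℝ S.emb (rot3 R x) (EuclideanSpace.single j 1)) = _
      rw [← e i, ← e j, S.fderiv_emb_rot hR hx, S.fderiv_emb_rot hR hx, S.equivariant R hR x hx,
        inner4_rot4 hM hR (S.emb_mem hx)]
      simp only [Matrix.mul_apply, Fin.sum_univ_three, Matrix.transpose_apply, induced,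
        Matrix.of_apply, map_add, map_smul, inner4, Pi.add_apply, Pi.smul_apply, smul_eq_mul,
        Fin.sum_univ_four]
      ring
    beta_reduce
    rw [key, Matrix.det_mul, Matrix.det_mul, Matrix.det_transpose,
      (Matrix.mem_specialOrthogonalGroup_iff.1 hR).2]
    ring

end RadialFunctions

/-! ### Vanishing of integrated rotational derivatives -/

section RotationIntegral

variable {M : ℝ} (S : SphericalSlice M)

theorem continuousOn_fderiv_rotGen {h : Spacetime → ℝ} (hh : ContDiffOn ℝ ∞ h (exterior M))
    (i : Fin 3) : ContinuousOn (fun y => fderiv ℝ h y (rotGen i y)) (exterior M) := by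
  refine (hh.continuousOn_fderiv_of_isOpen (isOpen_exterior M) (by simp)).clm_apply
    (Continuous.continuousOn ?_)
  refine continuous_pi fun a => Fin.cases continuous_const (fun j => ?_) a
  simp only [rotGen, Fin.cons_succ]
  have := continuous_pos
  fin_cases i <;> fin_cases j <;> simp [crs, pos] <;> fun_prop

/-- Rotational derivatives integrate to zero over compact rotation invariant sets. -/
theorem integral_rotGen {h : Spacetime → ℝ} (hh : ContDiffOn ℝ ∞ h (exterior M))
    {g : E3 → ℝ} (hg : S.IsRadial g) {K : Set E3} (hK : IsCompact K) (hKd : K ⊆ S.dom)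
    (hKr : ∀ R ∈ Matrix.specialOrthogonalGroup (Fin 3) ℝ, ∀ x ∈ K, rot3 R x ∈ K) (i : Fin 3) :
    IntegrableOn (fun x => g x * fderiv ℝ h (S.emb x) (rotGen i (S.emb x))) K ∧
      ∫ x in K, g x * fderiv ℝ h (S.emb x) (rotGen i (S.emb x)) = 0 := by
  set G : E3 → ℝ := fun x => g x * fderiv ℝ h (S.emb x) (rotGen i (S.emb x)) with hG
  have hGc : ContinuousOn G K := (hg.1.mul ((continuousOn_fderiv_rotGen hh i).comp
    S.continuousOn_emb S.mapsTo)).mono hKd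
  refine ⟨hGc.integrableOn_compact hK, ?_⟩
  have hmem : ∀ s, rotMat (Pi.single i 1) s ∈ Matrix.specialOrthogonalGroup (Fin 3) ℝ :=
    fun s => rotMat_mem (dot_single_self i) s
  have hcont : ContinuousOn (fun q : E3 × ℝ => G (rot3 (rotMat (Pi.single i 1) q.2) q.1))
      (K ×ˢ Icc 0 (2 * Real.pi)) := by
    exact hGc.comp (continuous_rot3_rotMat _).continuousOn fun q hq => hKr _ (hmem _) _ hq.1
  have hint : Integrable (Function.uncurry fun x s => G (rot3 (rotMat (Pi.single i 1) s) x))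
      ((volume.restrict K).prod (volume.restrict (Ioc 0 (2 * Real.pi)))) := by
    rw [Measure.prod_restrict]
    exact (hcont.integrableOn_compact (hK.prod isCompact_Icc)).mono_set
      (prod_mono_right Ioc_subset_Icc_self)
  -- The integral over `K` is unchanged by rotating the argument, so 2π times it is the double
  -- integral over angle and `K`. In the other order the inner integral is that of the derivative of
  -- a 2π-periodic function, since the weight is constant on orbits.
  have hswap := integral_integral_swap hint
  have h1 : ∀ s, ∫ x in K, G (rot3 (rotMat (Pi.single i 1) s) x) = ∫ x in K, G x :=
    fun s => setIntegral_rot3 (hmem s) hKr G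
  have h2 : ∀ x ∈ K, ∫ s in Ioc 0 (2 * Real.pi), G (rot3 (rotMat (Pi.single i 1) s) x) = 0 := by
    intro x hx
    have hxd := hKd hx
    have hder : ∀ s ∈ uIcc 0 (2 * Real.pi), HasDerivAt
        (fun s => g x * h (rot4 (rotMat (Pi.single i 1) s) (S.emb x)))
        (G (rot3 (rotMat (Pi.single i 1) s) x)) s := by
      intro s _
      have hp := rot4_mem_exterior (hmem s) (S.emb_mem hxd)
      have hd : DifferentiableAt ℝ h (rot4 (rotMat (Pi.single i 1) s) (S.emb x)) :=
        (hh.contDiffAt (exterior_mem_nhds hp)).differentiableAt (by simp)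
      have h3 := (hd.hasFDerivAt.comp_hasDerivAt s (hasDerivAt_rot4 i (S.emb x) s)).const_mul (g x)
      refine h3.congr_deriv ?_
      rw [hG]
      simp only [hg.2 _ (hmem s) x hxd, S.equivariant _ (hmem s) x hxd]
    have hii : IntervalIntegrable (fun s => G (rot3 (rotMat (Pi.single i 1) s) x)) volume
        0 (2 * Real.pi) := by
      refine ContinuousOn.intervalIntegrable ?_
      rw [uIcc_of_le (by positivity)]
      exact hcont.comp (f := fun s : ℝ => (x, s)) (by fun_prop) fun s hs => ⟨hx, hs⟩
    rw [← intervalIntegral.integral_of_le (by positivity),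
      intervalIntegral.integral_eq_sub_of_hasDerivAt hder hii]
    have e0 : rot4 (rotMat (Pi.single i 1) 0) (S.emb x) = S.emb x :=
      spacetime_ext rfl (by rw [pos_rot4, rotMat_zero])
    have e1 : rot4 (rotMat (Pi.single i 1) (2 * Real.pi)) (S.emb x) = S.emb x :=
      spacetime_ext rfl (by rw [pos_rot4, rotMat_two_pi])
    rw [e0, e1, sub_self]
  have h3 : ∫ x in K, ∫ s in Ioc 0 (2 * Real.pi), G (rot3 (rotMat (Pi.single i 1) s) x) = 0 := by
    rw [setIntegral_congr_fun hK.measurableSet h2]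
    simp
  rw [h3] at hswap
  simp only [h1] at hswap
  rw [setIntegral_const] at hswap
  simp only [smul_eq_mul] at hswap
  have hpi : (volume : Measure ℝ).real (Ioc 0 (2 * Real.pi)) ≠ 0 := by
    simp [Measure.real, Real.volume_Ioc, Real.pi_pos.le, Real.pi_ne_zero]
  rcases mul_eq_zero.1 hswap.symm with h | h
  · exact absurd h hpi
  · exact h

end RotationIntegral

end SphericalSlice

/-! ### Null components and their potentials -/

section NullFields

variable {M : ℝ} {F : Tensor2}

theorem smoothOn_nullField (hM : 0 < M) (o : ℤˣ) (hF : ContDiffOn ℝ ∞ F (exterior M)) (ε : ℝ) :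
    SmoothOn M (nullField M o F ε) := fun i =>
  contDiffOn_const.mul ((smoothOn_fieldS hM o hF i).add
    (contDiffOn_const.mul (smoothOn_fieldD hM o hF i)))

theorem tangential_nullField (hM : 0 < M) (o : ℤˣ) (F : Tensor2) (ε : ℝ) :
    Tangential M (nullField M o F ε) := by
  intro p hp
  have h1 := dot_fieldS M o F p
  have h2 := dot_fieldD (M := M) (rad_pos hM hp) o F
  simp only [dot, nullField] at *
  linear_combination 1 / 2 * h1 + 1 / 2 * ε * h2

/-- The potential whose rotational derivatives bound the excess of a null component. -/
def potential (M : ℝ) (o : ℤˣ) (F : Tensor2) (ε : ℝ) (i : Fin 3) (y : Spacetime) : ℝ :=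
  crs (pos y) (bochnerField (nullField M o F ε) y) i

theorem contDiffOn_potential (hM : 0 < M) (o : ℤˣ) (hF : ContDiffOn ℝ ∞ F (exterior M)) (ε : ℝ)
    (i : Fin 3) : ContDiffOn ℝ ∞ (potential M o F ε i) (exterior M) :=
  (smoothOn_nullField hM o hF ε).bochnerField.crs_pos i

end NullFields

/-! ### Exhaustion and integration over the slice -/

namespace SphericalSlice

variable {M : ℝ} (S : SphericalSlice M)

/-- An exhaustion of the domain of a slice by compact rotation invariant sets. -/
def exhaustion (n : ℕ) : Set E3 :=
  {x | ‖x‖ ≤ n ∧ ∀ y ∉ S.dom, 1 / ((n : ℝ) + 1) ≤ dist x y}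

/-- The shift to n + 1 keeps the distance bound positive at n = 0 as well. -/
theorem exhaustion_subset (n : ℕ) : S.exhaustion n ⊆ S.dom := by
  intro x hx
  by_contra h
  have := hx.2 x h
  rw [dist_self] at this
  have h2 : 0 < 1 / ((n : ℝ) + 1) := by positivity
  linarith

theorem isCompact_exhaustion (n : ℕ) : IsCompact (S.exhaustion n) := by
  refine Metric.isCompact_of_isClosed_isBounded ?_ ?_
  · have h : S.exhaustion n = {x | ‖x‖ ≤ n} ∩ ⋂ y ∈ S.domᶜ, {x | 1 / ((n : ℝ) + 1) ≤ dist x y} := by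
      ext x; simp [exhaustion]
    rw [h]
    refine (isClosed_le continuous_norm continuous_const).inter
      (isClosed_biInter fun y _ => isClosed_le continuous_const (by fun_prop))
  · exact (Metric.isBounded_closedBall (x := (0 : E3)) (r := n)).subset fun x hx => by
      simpa using hx.1

theorem rot_mem_exhaustion (n : ℕ) (R : Matrix (Fin 3) (Fin 3) ℝ)
    (hR : R ∈ Matrix.specialOrthogonalGroup (Fin 3) ℝ) (x : E3) (hx : x ∈ S.exhaustion n) :
    rot3 R x ∈ S.exhaustion n := by
  refine ⟨by rw [norm_rot3 hR]; exact hx.1, fun y hy => ?_⟩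
  have h1 : rot3 R.transpose y ∉ S.dom := by
    intro h
    apply hy
    rw [← rot3_rot3_transpose hR y]
    exact S.rot_mem R hR _ h
  have h2 : dist (rot3 R x) y = dist x (rot3 R.transpose y) := by
    conv_lhs => rw [← rot3_rot3_transpose hR y]
    exact (rotIso hR).isometry.dist_eq x _
  rw [h2]
  exact hx.2 _ h1

theorem monotone_exhaustion : Monotone S.exhaustion := by
  intro m n hmn x hx
  have h : (m : ℝ) ≤ n := by exact_mod_cast hmn
  refine ⟨hx.1.trans h, fun y hy => le_trans ?_ (hx.2 y hy)⟩
  gcongr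

theorem iUnion_exhaustion : ⋃ n, S.exhaustion n = S.dom := by
  refine Subset.antisymm (iUnion_subset S.exhaustion_subset) fun x hx => ?_
  obtain ⟨δ, hδ, hb⟩ := Metric.isOpen_iff.1 S.isOpen_dom x hx
  obtain ⟨n, hn⟩ := exists_nat_gt (max ‖x‖ (1 / δ))
  refine mem_iUnion.2 ⟨n, ((le_max_left _ _).trans_lt hn).le, fun y hy => ?_⟩
  have h1 : δ ≤ dist x y := by
    by_contra h
    exact hy (hb (by rw [Metric.mem_ball, dist_comm]; exact not_le.1 h))
  refine le_trans ?_ h1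
  rw [div_le_iff₀ (by positivity)]
  have h2 := (le_max_right ‖x‖ (1 / δ)).trans_lt hn
  rw [div_lt_iff₀ hδ] at h2
  nlinarith

/-- Only the volume density has to be measurable for this change of measure; `f` is arbitrary. -/
theorem lintegral_vol_of_subset (hM : 0 < M) {K : Set E3} (hK : IsCompact K) (hKd : K ⊆ S.dom)
    (f : E3 → ℝ) : ∫⁻ x in K, ENNReal.ofReal (f x) ∂S.vol =
      ∫⁻ x in K, ENNReal.ofReal (√(S.induced x).det * f x) := by
  unfold vol
  rw [restrict_withDensity hK.measurableSet, Measure.restrict_restrict_of_subset hKd,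
    lintegral_withDensity_eq_lintegral_mul_non_measurable₀]
  · refine lintegral_congr fun x => ?_
    rw [Pi.mul_apply, ENNReal.ofReal_mul (Real.sqrt_nonneg _)]
  · exact (((S.isRadial_det_induced hM).sqrt.1.mono hKd).aemeasurable
      hK.measurableSet).ennreal_ofReal
  · exact Filter.Eventually.of_forall fun x => ENNReal.ofReal_lt_top

/-- The weight of a null component in the lower bound for the energy density. -/
def weight (N : E3 → Spacetime) (c ε : ℝ) (x : E3) : ℝ :=
  √(S.induced x).det * (1 / 4 *
    (N x 0 + ε * (S.normalSpeed N x * (rad (S.emb x) / (rad (S.emb x) - 2 * M)))) *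
    (1 + ε * (c * morawetz M (rad (S.emb x)))) * (2 / rad (S.emb x) ^ 2))

theorem isRadial_weight (hM : 0 < M) {N : E3 → Spacetime} (hN : S.IsUnitNormal N) (c ε : ℝ) :
    S.IsRadial (S.weight N c ε) := by
  have hr := S.isRadial_rad
  have h0 : ∀ x ∈ S.dom, rad (S.emb x) ≠ 0 := fun x hx => (rad_pos hM (S.emb_mem hx)).ne'
  have h2 : ∀ x ∈ S.dom, rad (S.emb x) - 2 * M ≠ 0 := fun x hx =>
    (sub_pos.2 (show 2 * M < rad (S.emb x) from S.emb_mem hx)).ne'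
  exact (S.isRadial_det_induced hM).sqrt.mul ((((isRadial_const (1 / 4)).mul
    ((S.isRadial_normal_zero hM hN).add ((isRadial_const ε).mul
      ((S.isRadial_normalSpeed hM hN).mul (hr.div (hr.sub (isRadial_const (2 * M))) h2))))).mul
    ((isRadial_const 1).add ((isRadial_const ε).mul ((isRadial_const c).mul
      ((isRadial_const (1 / 2)).mul ((isRadial_const 1).sub
        ((isRadial_const (3 * M)).div hr h0))))))).mul
    ((isRadial_const 2).div (hr.pow 2) fun x hx => pow_ne_zero 2 (h0 x hx)))

/-- A combination of rotational derivatives which bounds the energy density from below. -/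
def lowerDensity (o : ℤˣ) (F : Tensor2) (N : E3 → Spacetime) (c : ℝ) (x : E3) : ℝ :=
  ∑ i, (S.weight N c 1 x * fderiv ℝ (potential M o F 1 i) (S.emb x) (rotGen i (S.emb x))
    + S.weight N c (-1) x * fderiv ℝ (potential M o F (-1) i) (S.emb x) (rotGen i (S.emb x)))

/-- This combines `density_ge` with `excess_ge` for both null components. The inequalities may be
multiplied by the weights because N⁰ exceeds the rescaled radial speed and |cm| ≤ 5/9 < 1. -/
theorem lowerDensity_le (hM : 0 < M) {o : ℤˣ} {F : Tensor2} (hF : ContDiffOn ℝ ∞ F (exterior M))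
    (hA : ∀ p ∈ exterior M, ∀ a b, F p a b = - F p b a) {N : E3 → Spacetime}
    (hN : S.IsUnitNormal N) {c : ℝ} (hc : |c| ≤ 10 / 9) {x : E3} (hx : x ∈ S.dom) :
    S.lowerDensity o F N c x ≤ √(S.induced x).det * S.density o F N c x := by
  have hp := S.emb_mem hx
  have hr := rad_pos hM hp
  have h2 : 2 * M < rad (S.emb x) := hp
  obtain ⟨-, hab, -⟩ := S.normal_formula hM hN hx
  have hm : |c * morawetz M (rad (S.emb x))| ≤ 10 / 9 * (1 / 2) := by
    rw [abs_mul]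
    refine mul_le_mul hc ?_ (abs_nonneg _) (by norm_num)
    have h3 : 3 * M / rad (S.emb x) < 3 / 2 := by rw [div_lt_iff₀ hr]; linarith
    have h4 : 0 < 3 * M / rad (S.emb x) := by positivity
    unfold morawetz
    rw [abs_le]
    constructor <;> linarith
  obtain ⟨hm1, hm2⟩ := abs_le.1 hm
  have hd := density_ge o hM hF hA hp (b := S.normalSpeed N x) hab hc
  rw [← S.normal_eq hM hN hx] at hd
  have hg : 0 < rad (S.emb x) / (rad (S.emb x) - 2 * M) := div_pos hr (sub_pos.2 h2)
  have hab' : |S.normalSpeed N x * (rad (S.emb x) / (rad (S.emb x) - 2 * M))| < N x 0 := by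
    rw [abs_mul, abs_of_pos hg]; exact hab
  obtain ⟨hb1, hb2⟩ := abs_lt.1 hab'
  have e1 := excess_ge (tangential_nullField hM o F 1) (smoothOn_nullField hM o hF 1) hM hp
  have e2 := excess_ge (tangential_nullField hM o F (-1)) (smoothOn_nullField hM o hF (-1)) hM hp
  have k1 := mul_le_mul_of_nonneg_left e1 (a := 1 / 4 *
    (N x 0 + S.normalSpeed N x * (rad (S.emb x) / (rad (S.emb x) - 2 * M))) *
    (1 + c * morawetz M (rad (S.emb x)))) (by
      refine mul_nonneg (mul_nonneg (by norm_num) ?_) ?_ <;> linarith)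
  have k2 := mul_le_mul_of_nonneg_left e2 (a := 1 / 4 *
    (N x 0 - S.normalSpeed N x * (rad (S.emb x) / (rad (S.emb x) - 2 * M))) *
    (1 - c * morawetz M (rad (S.emb x)))) (by
      refine mul_nonneg (mul_nonneg (by norm_num) ?_) ?_ <;> linarith)
  have k3 := mul_le_mul_of_nonneg_left ((add_le_add k1 k2).trans hd)
    (Real.sqrt_nonneg (S.induced x).det)
  refine le_of_eq_of_le ?_ k3
  unfold lowerDensity weight
  change ∑ i, (_ * fderiv ℝ (fun y => crs (pos y) (bochnerField (nullField M o F 1) y) i) _ _ +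
    _ * fderiv ℝ (fun y => crs (pos y) (bochnerField (nullField M o F (-1)) y) i) _ _) = _
  simp only [Fin.sum_univ_three]
  ring

theorem lintegral_neg_le_of_exhaustion (hM : 0 < M) {o : ℤˣ} {F : Tensor2}
    (hF : ContDiffOn ℝ ∞ F (exterior M))
    (hA : ∀ p ∈ exterior M, ∀ a b, F p a b = - F p b a) {N : E3 → Spacetime}
    (hN : S.IsUnitNormal N) {c : ℝ} (hc : |c| ≤ 10 / 9) (n : ℕ) :
    ∫⁻ x in S.exhaustion n, ENNReal.ofReal (-(S.density o F N c x)) ∂S.vol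
      ≤ ∫⁻ x in S.exhaustion n, ENNReal.ofReal (S.density o F N c x) ∂S.vol := by
  have hK := S.isCompact_exhaustion n
  have hKd := S.exhaustion_subset n
  have hint : ∀ ε i, _ := fun ε i => S.integral_rotGen (contDiffOn_potential hM o hF ε i)
    (S.isRadial_weight hM hN c ε) hK hKd (S.rot_mem_exhaustion n) i
  set G := S.lowerDensity o F N c with hG
  have hadd : ∀ i, IntegrableOn (fun x =>
      S.weight N c 1 x * fderiv ℝ (potential M o F 1 i) (S.emb x) (rotGen i (S.emb x)) +
        S.weight N c (-1) x * fderiv ℝ (potential M o F (-1) i) (S.emb x) (rotGen i (S.emb x)))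
      (S.exhaustion n) := fun i => (hint 1 i).1.add (hint (-1) i).1
  have hGi : IntegrableOn G (S.exhaustion n) := integrable_finsetSum _ fun i _ => hadd i
  have hG0 : ∫ x in S.exhaustion n, G x = 0 := by
    rw [hG]
    unfold lowerDensity
    rw [integral_finsetSum _ fun i _ => hadd i]
    refine Finset.sum_eq_zero fun i _ => ?_
    rw [integral_add (hint 1 i).1 (hint (-1) i).1, (hint 1 i).2, (hint (-1) i).2, add_zero]
  -- The lower bound `G` is integrable with integral zero, so its positive and negative parts have
  -- equal integrals. Passing from `G` up to the density shrinks the negative part and enlarges the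
  -- positive part.
  have hGe : ∫⁻ x in S.exhaustion n, ENNReal.ofReal (-(G x)) =
      ∫⁻ x in S.exhaustion n, ENNReal.ofReal (G x) := by
    rw [integral_eq_lintegral_pos_part_sub_lintegral_neg_part hGi] at hG0
    have h1 : ∫⁻ x in S.exhaustion n, ENNReal.ofReal (G x) ≠ ⊤ := hGi.lintegral_lt_top.ne
    have h2 : ∫⁻ x in S.exhaustion n, ENNReal.ofReal (-(G x)) ≠ ⊤ := hGi.neg.lintegral_lt_top.ne
    exact ((ENNReal.toReal_eq_toReal_iff' h1 h2).1 (sub_eq_zero.1 hG0)).symm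
  rw [S.lintegral_vol_of_subset hM hK hKd, S.lintegral_vol_of_subset hM hK hKd]
  refine le_trans (setLIntegral_mono' hK.measurableSet fun x hx => ENNReal.ofReal_le_ofReal ?_)
    (hGe.le.trans (setLIntegral_mono' hK.measurableSet fun x hx => ENNReal.ofReal_le_ofReal ?_))
  · rw [mul_neg]
    exact neg_le_neg (S.lowerDensity_le hM hF hA hN hc (hKd hx))
  · exact S.lowerDensity_le hM hF hA hN hc (hKd hx)

theorem lintegral_neg_le (hM : 0 < M) {o : ℤˣ} {F : Tensor2}
    (hF : ContDiffOn ℝ ∞ F (exterior M))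
    (hA : ∀ p ∈ exterior M, ∀ a b, F p a b = - F p b a) {N : E3 → Spacetime}
    (hN : S.IsUnitNormal N) {c : ℝ} (hc : |c| ≤ 10 / 9) :
    ∫⁻ x, ENNReal.ofReal (-(S.density o F N c x)) ∂S.vol
      ≤ ∫⁻ x, ENNReal.ofReal (S.density o F N c x) ∂S.vol := by
  have hv : S.vol = S.vol.restrict (⋃ n, S.exhaustion n) := by
    rw [S.iUnion_exhaustion]
    unfold vol
    rw [restrict_withDensity S.isOpen_dom.measurableSet,
      Measure.restrict_restrict_of_subset Subset.rfl]
  have hdir : Directed (· ⊆ ·) S.exhaustion := S.monotone_exhaustion.directed_le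
  -- Both sides are suprema over the exhaustion, so the inequality passes to the limit with no
  -- integrability.
  rw [hv, setLIntegral_iUnion_of_directed _ hdir, setLIntegral_iUnion_of_directed _ hdir]
  exact iSup_mono fun n => S.lintegral_neg_le_of_exhaustion hM hF hA hN hc n

end SphericalSlice

end Schwarzschild

end

theorem mainTheorem3 (M : ℝ) (hM : 0 < M) (o : ℤˣ)
    (F : Schwarzschild.Tensor2) (hF : Schwarzschild.IsMaxwellField M F)
    (S : Schwarzschild.SphericalSlice M)
    (N : Schwarzschild.E3 → Schwarzschild.Spacetime) (hN : S.IsUnitNormal N)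
    (c₁ : ℝ) (hc : |c₁| ≤ 10 / 9) :
    (∫⁻ x, ENNReal.ofReal (-(S.density o F N c₁ x)) ∂S.vol
        ≤ ∫⁻ x, ENNReal.ofReal (S.density o F N c₁ x) ∂S.vol) ∧
      0 ≤ ∫ x, S.density o F N c₁ x ∂S.vol := by
  have h := S.lintegral_neg_le hM hF.smooth hF.antisymm hN hc (o := o)
  refine ⟨h, ?_⟩
  by_cases hi : Integrable (S.density o F N c₁) S.vol
  · rw [integral_eq_lintegral_pos_part_sub_lintegral_neg_part hi, sub_nonneg]
    exact ENNReal.toReal_mono hi.lintegral_lt_top.ne h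
  -- Without integrability the Bochner integral is zero by convention; the content is then in the
  -- first conjunct.
  · rw [integral_undef hi]
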